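/- There are a program $P$ of a real random access machine and a constant $c$ such that the following holds. Let $S=\{s_1<\dots<s_y\}$ and $T=\{t_1<\dots<t_z\}$ be finite sets of points on the real line, let $n=y+z$, and let every point $p$ of $S$ and of $T$ have a capacity $\mathrm{Cap}(p)\in\mathbb{N}$ (a point lying in both sets counts as two points, with a capacity for each). A limited-capacity many-to-many matching (OLCMM) between $S$ and $T$ is a set $M\subseteq S\times T$ of pairs in which every point $p$ of $S$ and of $T$ occurs in at least one and in at most $\mathrm{Cap}(p)$ pairs; its cost is $\sum_{(a,b)\in M}|a-b|$. If at least one OLCMM between $S$ and $T$ exists, then $P$, given $y$, $z$, the coordinates of the points of $S$ and of $T$ as two arrays sorted increasingly, and the arrays of their capacities, halts after at most $c\,(n+1)$ steps and outputs the list, without repetition, of the pairs of an OLCMM of minimum cost. In short: a minimum-cost OLCMM of sorted input can be computed in $O(n)$ time. Here the memory of the machine consists of arrays of integers and arrays of real numbers, addressed by integers. A program is built from assignments to array cells, conditionals and while loops, using integer constants and the real constant $0$. Reading or writing a cell and adding, subtracting or comparing two integers or two reals each take one step; there is no multiplication and no conversion between integers and reals. -/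

import Mathlib

namespace LCMM

/-! ## Limited-capacity many-to-many matchings on the real line

The point sets are `S = {s 0 < s 1 < ⋯ }` and `T = {t 0 < t 1 < ⋯ }`, with `y` and `z` points.
A set of pairs `(i, j)` stands for the pairs `(s i, t j)`. -/

/-- The number of points of `T` matched to the `i`-th point of `S`. -/
def degS {y z : ℕ} (M : Finset (Fin y × Fin z)) (i : Fin y) : ℕ :=
  (M.filter (fun p => p.1 = i)).card

/-- The number of points of `S` matched to the `j`-th point of `T`. -/
def degT {y z : ℕ} (M : Finset (Fin y × Fin z)) (j : Fin z) : ℕ :=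
  (M.filter (fun p => p.2 = j)).card

/-- Every point is matched to at least one point of the other set, and to no more points than its
capacity allows. -/
def IsMatching {y z : ℕ} (capS : Fin y → ℕ) (capT : Fin z → ℕ)
    (M : Finset (Fin y × Fin z)) : Prop :=
  (∀ i, 1 ≤ degS M i ∧ degS M i ≤ capS i) ∧ (∀ j, 1 ≤ degT M j ∧ degT M j ≤ capT j)

/-- The sum of the distances of the matched pairs. -/
def cost {y z : ℕ} (s : Fin y → ℝ) (t : Fin z → ℝ) (M : Finset (Fin y × Fin z)) : ℝ :=
  ∑ p ∈ M, |s p.1 - t p.2|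

/-- A limited-capacity many-to-many matching of minimum cost. -/
def IsMinCostMatching {y z : ℕ} (s : Fin y → ℝ) (t : Fin z → ℝ) (capS : Fin y → ℕ)
    (capT : Fin z → ℕ) (M : Finset (Fin y × Fin z)) : Prop :=
  IsMatching capS capT M ∧ ∀ M', IsMatching capS capT M' → cost s t M ≤ cost s t M'

/-! ## A real random access machine

The memory consists of integer arrays and real arrays, each addressed by an integer. A program uses
finitely many of them; scalar variables are cells with a fixed address. Integers and reals can be
added, subtracted and compared, at unit cost; there is no multiplication, no conversion between the
two sorts, and no real constant other than `0`. -/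

/-- A memory content: `int a i` and `real a i` are the `i`-th cells of the `a`-th arrays. -/
structure State where
  int : ℕ → ℤ → ℤ
  real : ℕ → ℤ → ℝ

/-- Integer expressions. `cell a e` reads the cell of integer array `a` with address `e`. -/
inductive IntExpr : Type
  | const (n : ℤ)
  | cell (a : ℕ) (idx : IntExpr)
  | add (e₁ e₂ : IntExpr)
  | sub (e₁ e₂ : IntExpr)

/-- Real expressions. `cell a e` reads the cell of real array `a` with address `e`. -/
inductive RealExpr : Type
  | zero
  | cell (a : ℕ) (idx : IntExpr)
  | add (e₁ e₂ : RealExpr)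
  | sub (e₁ e₂ : RealExpr)

/-- Tests: comparisons and their Boolean combinations. -/
inductive Test : Type
  | intLE (e₁ e₂ : IntExpr)
  | realLE (e₁ e₂ : RealExpr)
  | not (b : Test)
  | and (b₁ b₂ : Test)

namespace IntExpr

def eval (σ : State) : IntExpr → ℤ
  | const n => n
  | cell a e => σ.int a (e.eval σ)
  | add e₁ e₂ => e₁.eval σ + e₂.eval σ
  | sub e₁ e₂ => e₁.eval σ - e₂.eval σ

/-- The number of steps of an evaluation. -/
def time : IntExpr → ℕ
  | const _ => 1
  | cell _ e => e.time + 1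
  | add e₁ e₂ => e₁.time + e₂.time + 1
  | sub e₁ e₂ => e₁.time + e₂.time + 1

end IntExpr

namespace RealExpr

def eval (σ : State) : RealExpr → ℝ
  | zero => 0
  | cell a e => σ.real a (e.eval σ)
  | add e₁ e₂ => e₁.eval σ + e₂.eval σ
  | sub e₁ e₂ => e₁.eval σ - e₂.eval σ

/-- The number of steps of an evaluation. -/
def time : RealExpr → ℕ
  | zero => 1
  | cell _ e => e.time + 1
  | add e₁ e₂ => e₁.time + e₂.time + 1
  | sub e₁ e₂ => e₁.time + e₂.time + 1

end RealExpr

namespace Test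

def Holds (σ : State) : Test → Prop
  | intLE e₁ e₂ => e₁.eval σ ≤ e₂.eval σ
  | realLE e₁ e₂ => e₁.eval σ ≤ e₂.eval σ
  | not b => ¬ b.Holds σ
  | and b₁ b₂ => b₁.Holds σ ∧ b₂.Holds σ

/-- The number of steps of an evaluation. -/
def time : Test → ℕ
  | intLE e₁ e₂ => e₁.time + e₂.time + 1
  | realLE e₁ e₂ => e₁.time + e₂.time + 1
  | not b => b.time + 1
  | and b₁ b₂ => b₁.time + b₂.time + 1

end Test

/-- Programs. -/
inductive Program : Type
  /-- do nothing -/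
  | skip
  /-- store the value of `e` in the cell of integer array `a` with address `idx` -/
  | setInt (a : ℕ) (idx : IntExpr) (e : IntExpr)
  /-- store the value of `e` in the cell of real array `a` with address `idx` -/
  | setReal (a : ℕ) (idx : IntExpr) (e : RealExpr)
  /-- run `P`, then `Q` -/
  | seq (P Q : Program)
  /-- run `P` if `b` holds, and `Q` otherwise -/
  | cond (b : Test) (P Q : Program)
  /-- run `P` as long as `b` holds -/
  | loop (b : Test) (P : Program)

namespace State

def setInt (σ : State) (a : ℕ) (i v : ℤ) : State :=
  { σ with int := Function.update σ.int a (Function.update (σ.int a) i v) }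

def setReal (σ : State) (a : ℕ) (i : ℤ) (v : ℝ) : State :=
  { σ with real := Function.update σ.real a (Function.update (σ.real a) i v) }

end State

/-- `Run P σ n σ'`: started with memory content `σ`, the program `P` halts after exactly `n` steps
with memory content `σ'`. -/
inductive Run : Program → State → ℕ → State → Prop
  | skip (σ : State) : Run .skip σ 1 σ
  | setInt (σ : State) (a : ℕ) (idx e : IntExpr) :
      Run (.setInt a idx e) σ (idx.time + e.time + 1) (σ.setInt a (idx.eval σ) (e.eval σ))
  | setReal (σ : State) (a : ℕ) (idx : IntExpr) (e : RealExpr) :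
      Run (.setReal a idx e) σ (idx.time + e.time + 1) (σ.setReal a (idx.eval σ) (e.eval σ))
  | seq {P Q : Program} {σ σ₁ σ₂ : State} {m n : ℕ} :
      Run P σ m σ₁ → Run Q σ₁ n σ₂ → Run (.seq P Q) σ (m + n) σ₂
  | condTrue {b : Test} {P Q : Program} {σ σ' : State} {n : ℕ} :
      b.Holds σ → Run P σ n σ' → Run (.cond b P Q) σ (b.time + n + 1) σ'
  | condFalse {b : Test} {P Q : Program} {σ σ' : State} {n : ℕ} :
      ¬ b.Holds σ → Run Q σ n σ' → Run (.cond b P Q) σ (b.time + n + 1) σ'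
  | loopStop {b : Test} {P : Program} {σ : State} :
      ¬ b.Holds σ → Run (.loop b P) σ (b.time + 1) σ
  | loopStep {b : Test} {P : Program} {σ σ₁ σ₂ : State} {m n : ℕ} :
      b.Holds σ → Run P σ m σ₁ → Run (.loop b P) σ₁ n σ₂ →
        Run (.loop b P) σ (b.time + m + n + 1) σ₂

/-! ## Input and output -/

/-- The array with entries `f 0, f 1, …, f (n - 1)` at the addresses `0, 1, …, n - 1` and `0`
elsewhere. -/
def arrayOf {α : Type} [Zero α] {n : ℕ} (f : Fin n → α) : ℤ → α := fun i =>
  if h : 0 ≤ i ∧ i < n then f ⟨i.toNat, by omega⟩ else 0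

/-- The initial memory content: real arrays `0` and `1` hold the coordinates of the points of `S`
and `T`, integer arrays `0` and `1` their capacities, and integer array `2` the numbers `y` and `z`
of points. All other cells are `0`. -/
noncomputable def input {y z : ℕ} (s : Fin y → ℝ) (t : Fin z → ℝ) (capS : Fin y → ℕ)
    (capT : Fin z → ℕ) : State where
  int
    | 0 => arrayOf (fun i => (capS i : ℤ))
    | 1 => arrayOf (fun j => (capT j : ℤ))
    | 2 => arrayOf ![(y : ℤ), (z : ℤ)]
    | _ => fun _ => 0
  real
    | 0 => arrayOf s
    | 1 => arrayOf t
    | _ => fun _ => 0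

/-- The memory content `σ` holds the set of pairs `M` as a list without repetition: its length is
in cell `0` of integer array `3`, and its `k`-th pair consists of the `k`-th cells of integer
arrays `4` and `5`. -/
def Outputs {y z : ℕ} (σ : State) (M : Finset (Fin y × Fin z)) : Prop :=
  ∃ L : List (Fin y × Fin z), L.Nodup ∧ L.toFinset = M ∧ σ.int 3 0 = (L.length : ℤ) ∧
    ∀ (k : ℕ) (hk : k < L.length),
      σ.int 4 (k : ℤ) = ((L[k].1 : ℕ) : ℤ) ∧ σ.int 5 (k : ℤ) = ((L[k].2 : ℕ) : ℤ)

end LCMM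

namespace LCMM

/-! ## Programs without loops -/

/-! A matching is reduced to an integer path. Merge the points in increasing order and let the
height at `k` be the number of pairs crossing the gap before the `k`-th point with their `S`-point
on the left, minus the number crossing it the other way. A point of `S` raises the height by its
degree and a point of `T` lowers it, so a matching yields a path from 0 to 0 whose steps lie between
1 and the capacity (`IsMatching.isPath`). Weighting each gap by its width, the triangle inequality
bounds the path cost by the cost of the matching (`pathCost_height_le`).

Conversely, the steps of a path cut two copies of one interval into consecutive pieces, one copy by
`S` and one by `T`. The lengths of the overlaps are weights on pairs. No two overlapping pairs
cross, so nothing cancels in any gap and the weighted cost equals the path cost. Passing to the set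
of overlapping pairs lowers degrees and cost but leaves every degree positive. Hence the pairs of a
cheapest path form a cheapest matching (`isMinCostMatching_overlapPairs`); multiplicities need not
be excluded in advance.

A cheapest path comes from a dynamic program with convex value functions. The best predecessor of a
height is the admissible one nearest to the minimum of the previous function
(`IsValley.clampStep_le`), so storing the minima suffices to trace the path back. The start is not
forced to be 0 but penalized by twice the span of the points; lattice operations on paths show that
an optimal path then starts at 0 (`start_eq_zero`). This needs a positive span, so inputs with at
most one point in each set are treated apart.

Only the slopes of the value functions are kept, as one sequence on each side of 0. A step inserts
zeros at the minimum and shifts the two halves (`slope_moveSides`); adding a multiple of the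
absolute value changes one common offset, the current coordinate (`slope_add`). Outward slopes of
negative sign are single entries, which separate 0 from the minimum; the others are compressed into
runs. A step creates at most one single entry, and all superfluous work removes single entries, so a
potential proportional to their number gives constant amortized time (`run_lower`, `run_move`). The
tracing back and the listing of overlaps, by a sweep along both subdivisions, are plainly linear. -/

open Classical in
/-- The final memory content of a loop-free program. -/
noncomputable def Program.exec : Program → State → State
  | .skip, σ => σ
  | .setInt a i e, σ => σ.setInt a (i.eval σ) (e.eval σ)
  | .setReal a i e, σ => σ.setReal a (i.eval σ) (e.eval σ)
  | .seq P Q, σ => Q.exec (P.exec σ)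
  | .cond b P Q, σ => if b.Holds σ then P.exec σ else Q.exec σ
  | .loop _ _, σ => σ

/-- The program contains no loop. -/
def Program.LoopFree : Program → Prop
  | .seq P Q => P.LoopFree ∧ Q.LoopFree
  | .cond _ P Q => P.LoopFree ∧ Q.LoopFree
  | .loop _ _ => False
  | _ => True

/-- A bound on the number of steps of a loop-free program. -/
def Program.maxTime : Program → ℕ
  | .skip => 1
  | .setInt _ i e => i.time + e.time + 1
  | .setReal _ i e => i.time + e.time + 1
  | .seq P Q => P.maxTime + Q.maxTime
  | .cond b P Q => b.time + (P.maxTime + Q.maxTime) + 1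
  | .loop _ _ => 0

theorem run_exec {P : Program} (hP : P.LoopFree) (σ : State) :
    ∃ n, Run P σ n (P.exec σ) ∧ n ≤ P.maxTime := by
  induction P generalizing σ with
  | skip => exact ⟨_, Run.skip σ, le_rfl⟩
  | setInt a i e => exact ⟨_, Run.setInt σ a i e, le_rfl⟩
  | setReal a i e => exact ⟨_, Run.setReal σ a i e, le_rfl⟩
  | seq P Q ihP ihQ =>
    obtain ⟨m, hm, hm'⟩ := ihP hP.1 σ
    obtain ⟨n, hn, hn'⟩ := ihQ hP.2 (P.exec σ)
    exact ⟨_, Run.seq hm hn, Nat.add_le_add hm' hn'⟩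
  | cond b P Q ihP ihQ =>
    by_cases hb : b.Holds σ
    · obtain ⟨m, hm, hm'⟩ := ihP hP.1 σ
      refine ⟨_, by simp only [Program.exec, hb, if_true]; exact Run.condTrue hb hm, ?_⟩
      simp only [Program.maxTime]; omega
    · obtain ⟨m, hm, hm'⟩ := ihQ hP.2 σ
      refine ⟨_, by simp only [Program.exec, hb, if_false]; exact Run.condFalse hb hm, ?_⟩
      simp only [Program.maxTime]; omega
  | loop b P _ => exact hP.elim

/-- The loop rule: `I g σ` is an invariant that relates the memory content `σ` to a model `g`, and
`Φ` is a potential that pays for the steps. -/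
theorem run_loop {ι : Type*} {b : Test} {P : Program} (I : ι → State → Prop) (Φ : ι → ℕ)
    (step : ∀ g σ, I g σ → b.Holds σ →
      ∃ g' n σ', Run P σ n σ' ∧ I g' σ' ∧ n + b.time + 1 + Φ g' ≤ Φ g)
    (g : ι) (σ : State) (hI : I g σ) :
    ∃ g' n σ', Run (.loop b P) σ n σ' ∧ I g' σ' ∧ ¬ b.Holds σ' ∧ n + Φ g' ≤ Φ g + b.time + 1 := by
  induction hN : Φ g using Nat.strong_induction_on generalizing g σ with
  | _ N ih =>
    subst hN
    by_cases hb : b.Holds σ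
    · obtain ⟨g₁, n₁, σ₁, h₁, hI₁, hn₁⟩ := step g σ hI hb
      obtain ⟨g₂, n₂, σ₂, h₂, hI₂, hb₂, hn₂⟩ := ih (Φ g₁) (by omega) g₁ σ₁ hI₁ rfl
      exact ⟨g₂, _, σ₂, Run.loopStep hb h₁ h₂, hI₂, hb₂, by omega⟩
    · exact ⟨g, _, σ, Run.loopStop hb, hI, hb, by omega⟩

/-- The loop rule for a loop-free body and an invariant that counts at most `N` iterations. -/
theorem run_loop_count {b : Test} {P : Program} (hP : P.LoopFree) (N : ℕ) (I : ℕ → State → Prop)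
    (hle : ∀ k σ, I k σ → k ≤ N) (step : ∀ k σ, I k σ → b.Holds σ → I (k + 1) (P.exec σ))
    {σ : State} (hI : I 0 σ) :
    ∃ k n σ', Run (.loop b P) σ n σ' ∧ I k σ' ∧ ¬ b.Holds σ' ∧
      n ≤ (P.maxTime + b.time + 1) * (N + 1) := by
  obtain ⟨k, n, σ', h₁, h₂, h₃, h₄⟩ := run_loop I (fun k => (P.maxTime + b.time + 1) * (N - k))
    (fun k σ hk hb => by
      obtain ⟨n, hn, hn'⟩ := run_exec hP σ
      refine ⟨k + 1, n, _, hn, step k σ hk hb, ?_⟩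
      -- The bound is applied after the iteration: it gives `k + 1 ≤ N`, so the truncated difference
      -- `N - k` really drops by one.
      have h₁ := hle _ _ (step k σ hk hb)
      obtain ⟨d, rfl⟩ : ∃ d, N = k + 1 + d := ⟨N - (k + 1), by omega⟩
      rw [show k + 1 + d - (k + 1) = d by omega, show k + 1 + d - k = d + 1 by omega]
      linarith) 0 σ hI
  refine ⟨k, n, σ', h₁, h₂, h₃, ?_⟩
  simp only [Nat.sub_zero] at h₄
  rw [mul_add, mul_one]
  omega

/-! ## Reading cells -/

namespace State

@[simp] theorem int_setInt_self (σ : State) (a : ℕ) (i v : ℤ) :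
    (σ.setInt a i v).int a = Function.update (σ.int a) i v := by
  simp [setInt]

@[simp] theorem int_setInt_of_ne (σ : State) {a b : ℕ} (i v : ℤ) (h : b ≠ a) :
    (σ.setInt a i v).int b = σ.int b := by
  simp [setInt, h]

@[simp] theorem real_setInt (σ : State) (a : ℕ) (i v : ℤ) : (σ.setInt a i v).real = σ.real := rfl

@[simp] theorem real_setReal_self (σ : State) (a : ℕ) (i : ℤ) (v : ℝ) :
    (σ.setReal a i v).real a = Function.update (σ.real a) i v := by
  simp [setReal]

@[simp] theorem real_setReal_of_ne (σ : State) {a b : ℕ} (i : ℤ) (v : ℝ) (h : b ≠ a) :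
    (σ.setReal a i v).real b = σ.real b := by
  simp [setReal, h]

@[simp] theorem int_setReal (σ : State) (a : ℕ) (i : ℤ) (v : ℝ) :
    (σ.setReal a i v).int = σ.int := rfl

end State

/-- The scalar integer variable `a`. -/
abbrev IntExpr.var (a : ℕ) : IntExpr := .cell a (.const 0)

/-- The scalar real variable `a`. -/
abbrev RealExpr.var (a : ℕ) : RealExpr := .cell a (.const 0)

/-- Assignment to the scalar integer variable `a`. -/
abbrev Program.assign (a : ℕ) (e : IntExpr) : Program := .setInt a (.const 0) e

/-- The test `e₁ < e₂`. -/
abbrev Test.intLT (e₁ e₂ : IntExpr) : Test := .intLE (.add e₁ (.const 1)) e₂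

/-! ## Paths on the integers and their dynamic program -/

/-- `m` is a minimum of `f`, and `f` is monotone on both sides of it. -/
def IsValley (f : ℤ → ℝ) (m : ℤ) : Prop :=
  (∀ h < m, f (h + 1) ≤ f h) ∧ ∀ h, m ≤ h → f h ≤ f (h + 1)

theorem IsValley.le_of_le {f : ℤ → ℝ} {m a b : ℤ} (hf : IsValley f m) (ha : m ≤ a) (hab : a ≤ b) :
    f a ≤ f b := by
  induction b, hab using Int.leInduction with
  | base => exact le_rfl
  | succ b hb ih => exact ih.trans (hf.2 b (ha.trans hb))

theorem IsValley.le_of_ge {f : ℤ → ℝ} {m a b : ℤ} (hf : IsValley f m) (ha : a ≤ m) (hab : b ≤ a) :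
    f a ≤ f b := by
  induction b, hab using Int.leInductionDown with
  | base => exact le_rfl
  | pred b hb ih =>
    refine ih.trans ?_
    have := hf.1 (b - 1) (by omega)
    simpa using this

/-- `IsStep up c h h'`: the integer `h'` is obtained from `h` by going up (or down, if `up` is
`false`) by at least `1` and at most `c`. -/
def IsStep (up : Bool) (c h h' : ℤ) : Prop :=
  if up then h + 1 ≤ h' ∧ h' ≤ h + c else h' + 1 ≤ h ∧ h ≤ h' + c

/-- With the next two lemmas, paths are closed under pointwise maximum, minimum and translation;
`IsPath.exists_start_eq_zero` rests on this. -/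
theorem IsStep.max {up : Bool} {c a a' b b' : ℤ} (ha : IsStep up c a a') (hb : IsStep up c b b') :
    IsStep up c (max a b) (max a' b') := by
  cases up <;> simp only [IsStep, if_true, if_false, Bool.false_eq_true] at ha hb ⊢ <;> omega

theorem IsStep.min {up : Bool} {c a a' b b' : ℤ} (ha : IsStep up c a a') (hb : IsStep up c b b') :
    IsStep up c (min a b) (min a' b') := by
  cases up <;> simp only [IsStep, if_true, if_false, Bool.false_eq_true] at ha hb ⊢ <;> omega

theorem IsStep.sub {up : Bool} {c a a' : ℤ} (ha : IsStep up c a a') (d : ℤ) :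
    IsStep up c (a - d) (a' - d) := by
  cases up <;> simp only [IsStep, if_true, if_false, Bool.false_eq_true] at ha ⊢ <;> omega

/-- The point next to `m` from which a step leads to `h`. -/
def clampStep (up : Bool) (c m h : ℤ) : ℤ :=
  if up then max (h - c) (min m (h - 1)) else max (h + 1) (min m (h + c))

theorem isStep_clampStep (up : Bool) {c : ℤ} (hc : 1 ≤ c) (m h : ℤ) :
    IsStep up c (clampStep up c m h) h := by
  cases up <;> simp only [IsStep, clampStep, if_true, if_false, Bool.false_eq_true] <;> omega

/-- The predecessors of `h'` form an interval. Its point nearest to `m` lies between `m` and any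
other predecessor, and `f` does not decrease away from `m`. -/
theorem IsValley.clampStep_le {f : ℤ → ℝ} {m : ℤ} (hf : IsValley f m) {up : Bool} {c h h' : ℤ}
    (hs : IsStep up c h h') : f (clampStep up c m h') ≤ f h := by
  have key : ∀ p, (p ≤ m ∧ h ≤ p) ∨ (m ≤ p ∧ p ≤ h) → f p ≤ f h := by
    rintro p (⟨h₁, h₂⟩ | ⟨h₁, h₂⟩)
    · exact hf.le_of_ge h₁ h₂
    · exact hf.le_of_le h₁ h₂
  apply key
  cases up <;> simp only [IsStep, clampStep, if_true, if_false, Bool.false_eq_true] at hs ⊢ <;> omega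

/-- The path `h` has a step of the prescribed kind at every `k < n`. -/
def IsPath (n : ℕ) (E : ℕ → Bool) (c : ℕ → ℤ) (h : ℕ → ℤ) : Prop :=
  ∀ k < n, IsStep (E k) (c k) (h k) (h (k + 1))

/-- The cost of the first `n` steps of a path. -/
def pathCost (n : ℕ) (X : ℕ → ℝ) (h : ℕ → ℤ) : ℝ :=
  ∑ k ∈ Finset.range n, (X (k + 1) - X k) * |(h (k + 1) : ℝ)|

/-- The value function of the dynamic program with penalty `β` for the starting point, where `m k`
is the guess for the minimum of the `k`-th value function. -/
noncomputable def pathValue (β : ℝ) (X : ℕ → ℝ) (E : ℕ → Bool) (c m : ℕ → ℤ) : ℕ → ℤ → ℝ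
  | 0, h => β * |(h : ℝ)|
  | k + 1, h => pathValue β X E c m k (clampStep (E k) (c k) (m k) h) + (X (k + 1) - X k) * |(h : ℝ)|

section

variable {β : ℝ} {X : ℕ → ℝ} {E : ℕ → Bool} {c m : ℕ → ℤ} {n : ℕ}

/-- The recursion unfolds along the clamped path itself, so this holds for arbitrary guesses `m`;
only the lower bound below needs them to be minima. -/
theorem pathValue_eq {h : ℕ → ℤ} (hh : ∀ k < n, h k = clampStep (E k) (c k) (m k) (h (k + 1))) :
    ∀ k ≤ n, pathValue β X E c m k (h k) = β * |(h 0 : ℝ)| + pathCost k X h := by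
  intro k hk
  induction k with
  | zero => simp [pathValue, pathCost]
  | succ k ih =>
    rw [pathValue, ← hh k hk, ih (by omega), pathCost, pathCost, Finset.sum_range_succ]
    ring

theorem pathValue_le (hm : ∀ k < n, IsValley (pathValue β X E c m k) (m k)) {h : ℕ → ℤ}
    (hh : IsPath n E c h) :
    ∀ k ≤ n, pathValue β X E c m k (h k) ≤ β * |(h 0 : ℝ)| + pathCost k X h := by
  intro k hk
  induction k with
  | zero => simp [pathValue, pathCost]
  | succ k ih =>
    have h₁ := (hm k hk).clampStep_le (hh k hk)
    have h₂ := ih (by omega)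
    rw [pathValue, pathCost, Finset.sum_range_succ]
    rw [pathCost] at h₂
    linarith

/-- Going back along the minima of the value functions gives a path of minimum penalized cost. -/
theorem penalized_pathCost_le (hm : ∀ k < n, IsValley (pathValue β X E c m k) (m k)) {h h' : ℕ → ℤ}
    (hh : ∀ k < n, h k = clampStep (E k) (c k) (m k) (h (k + 1))) (hh' : IsPath n E c h')
    (hn : h n = h' n) :
    β * |(h 0 : ℝ)| + pathCost n X h ≤ β * |(h' 0 : ℝ)| + pathCost n X h' := by
  rw [← pathValue_eq hh n le_rfl, hn]
  exact pathValue_le hm hh' n le_rfl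

/-! ### Removing the penalty on the starting point -/

theorem IsPath.exists_start_eq_zero {h h' : ℕ → ℤ} (hh : IsPath n E c h) (hh' : IsPath n E c h')
    (hn : h n = 0) (hn' : h' n = 0) (h0' : h' 0 = 0) :
    ∃ g, IsPath n E c g ∧ g n = 0 ∧ g 0 = 0 ∧ ∀ k, |g k| ≤ |h k| + |h 0| := by
  rcases le_total 0 (h 0) with h0 | h0
  -- This path stays between `h k - h 0` and `h k`, which gives the bound; at the start both terms
  -- of the maximum vanish because `h' 0 = 0 ≤ h 0`.
  · refine ⟨fun k => max (min (h' k) (h k)) (h k - h 0), fun k hk => ?_, ?_, ?_, fun k => ?_⟩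
    · exact ((hh' k hk).min (hh k hk)).max ((hh k hk).sub _)
    all_goals dsimp only; try omega
    rcases abs_cases (h k) with h₁ | h₁ <;> rcases abs_cases (h 0) with h₂ | h₂ <;>
      rw [abs_le] <;> omega
  · refine ⟨fun k => min (max (h' k) (h k)) (h k - h 0), fun k hk => ?_, ?_, ?_, fun k => ?_⟩
    · exact ((hh' k hk).max (hh k hk)).min ((hh k hk).sub _)
    all_goals dsimp only; try omega
    rcases abs_cases (h k) with h₁ | h₁ <;> rcases abs_cases (h 0) with h₂ | h₂ <;>
      rw [abs_le] <;> omega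

/-- If the penalty is larger than the sum of the weights, then a path of minimum penalized cost is
not penalized. -/
theorem start_eq_zero (hX : Monotone X) (hβ : X n - X 0 < β) {h h' : ℕ → ℤ}
    (hh : IsPath n E c h) (hh' : IsPath n E c h') (hn : h n = 0) (hn' : h' n = 0) (h0' : h' 0 = 0)
    (hmin : ∀ g, IsPath n E c g → g n = 0 →
      β * |(h 0 : ℝ)| + pathCost n X h ≤ β * |(g 0 : ℝ)| + pathCost n X g) : h 0 = 0 := by
  obtain ⟨g, hg, hgn, hg0, hgle⟩ := hh.exists_start_eq_zero hh' hn hn' h0'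
  have h₁ := hmin g hg hgn
  -- Moving the start to 0 costs at most the span times `|h 0|`, less than the penalty `β * |h 0|`
  -- that it saves.
  have h₂ : pathCost n X g ≤ pathCost n X h + (X n - X 0) * |(h 0 : ℝ)| := by
    rw [← Finset.sum_range_sub, Finset.sum_mul, pathCost, pathCost, ← Finset.sum_add_distrib]
    refine Finset.sum_le_sum fun k _ => ?_
    rw [← mul_add]
    refine mul_le_mul_of_nonneg_left ?_ (sub_nonneg.2 (hX k.le_succ))
    exact_mod_cast hgle (k + 1)
  by_contra h0
  have h₃ : (0 : ℝ) < |(h 0 : ℝ)| := by positivity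
  simp only [hg0, Int.cast_zero, abs_zero, mul_zero, zero_add] at h₁
  nlinarith

end

/-! ## Slopes of the value functions -/

/-- The slope function with slopes `b 0 + x, b 1 + x, …` to the right of `0` and
`-(a 0 + x), -(a 1 + x), …` to the left of `0`. -/
noncomputable def slope (a b : ℕ → ℝ) (x : ℝ) (h : ℤ) : ℝ :=
  if 0 ≤ h then b h.toNat + x else -(a (-1 - h).toNat + x)

/-- A slope at `h` belongs to the edge from `h` to `h + 1`, so reflecting the function at 0 takes
`h` to `-1 - h`. This reduces steps down to steps up. -/
theorem slope_swap (a b : ℕ → ℝ) (x : ℝ) (h : ℤ) : slope b a x (-1 - h) = -slope a b x h := by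
  unfold slope
  split_ifs with h₁ h₂ h₂
  · omega
  · simp
  · simp
  · omega

/-- The slopes after a step up: `c - 1` zeros are inserted at the minimum `m`, and everything is
shifted by `1`. -/
noncomputable def upSlope (g : ℤ → ℝ) (c m h : ℤ) : ℝ :=
  if h ≤ m then g (h - 1) else if h < m + c then 0 else g (h - c)

/-- The slopes after a step down. -/
noncomputable def downSlope (g : ℤ → ℝ) (c m h : ℤ) : ℝ :=
  if m - 1 ≤ h then g (h + 1) else if m - c ≤ h then 0 else g (h + c)

theorem downSlope_eq (g : ℤ → ℝ) (c m h : ℤ) :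
    downSlope g c m h = -upSlope (fun i => -g (-1 - i)) c (-m) (-1 - h) := by
  unfold downSlope upSlope
  split_ifs <;> first | omega | simp <;> ring_nf

/-- The three ranges of `upSlope` are those where the best predecessor is the highest one, is the
minimum itself, or is the lowest one. In the middle range it does not move, whence slope 0. -/
theorem sub_clampStep_up {f g : ℤ → ℝ} (hf : ∀ h, f (h + 1) - f h = g h) {c : ℤ} (hc : 1 ≤ c)
    (m h : ℤ) : f (clampStep true c m (h + 1)) - f (clampStep true c m h) = upSlope g c m h := by
  unfold upSlope
  simp only [clampStep, if_true]
  split_ifs with h₁ h₂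
  · rw [← hf]
    congr 2 <;> omega
  · rw [sub_eq_zero]
    congr 1; omega
  · rw [← hf]
    congr 2 <;> omega

theorem sub_clampStep_down {f g : ℤ → ℝ} (hf : ∀ h, f (h + 1) - f h = g h) {c : ℤ} (hc : 1 ≤ c)
    (m h : ℤ) : f (clampStep false c m (h + 1)) - f (clampStep false c m h) = downSlope g c m h := by
  unfold downSlope
  simp only [clampStep, if_false, Bool.false_eq_true]
  split_ifs with h₁ h₂
  · rw [← hf]
    congr 2 <;> omega
  · rw [sub_eq_zero]
    congr 1; omega
  · rw [← hf]
    congr 2 <;> omega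

/-- Convexity survives because the zeros enter exactly between the nonpositive and the nonnegative
slopes. -/
theorem upSlope_monotone {g : ℤ → ℝ} (hg : Monotone g) {c m : ℤ}
    (h₀ : ∀ h < m, g h ≤ 0) (h₁ : ∀ h, m ≤ h → 0 ≤ g h) : Monotone (upSlope g c m) := by
  intro h h' hh
  unfold upSlope
  split_ifs <;> first
    | omega
    | exact le_rfl
    | exact hg (by omega)
    | exact h₀ _ (by omega)
    | exact h₁ _ (by omega)

theorem downSlope_monotone {g : ℤ → ℝ} (hg : Monotone g) {c m : ℤ}
    (h₀ : ∀ h < m, g h ≤ 0) (h₁ : ∀ h, m ≤ h → 0 ≤ g h) : Monotone (downSlope g c m) := by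
  intro h h' hh
  unfold downSlope
  split_ifs <;> first
    | omega
    | exact le_rfl
    | exact hg (by omega)
    | exact h₀ _ (by omega)
    | exact h₁ _ (by omega)

/-- Adding `w * |h|` raises all outward slopes alike. It is therefore done lazily, through the
offset, without touching any entry. -/
theorem slope_add (a b : ℕ → ℝ) (x w : ℝ) (h : ℤ) :
    slope a b (x + w) h = slope a b x h + w * (|((h + 1 : ℤ) : ℝ)| - |(h : ℝ)|) := by
  unfold slope
  split_ifs with h₀
  · rw [abs_of_nonneg, abs_of_nonneg]
    · push_cast; ring
    · exact_mod_cast h₀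
    · exact_mod_cast (by omega : 0 ≤ h + 1)
  · rw [abs_of_nonpos, abs_of_nonpos]
    · push_cast; ring
    · exact_mod_cast (by omega : h ≤ 0)
    · exact_mod_cast (by omega : h + 1 ≤ 0)

theorem slope_monotone_add {a b : ℕ → ℝ} {x x' : ℝ} (hx : x ≤ x') (h : Monotone (slope a b x)) :
    Monotone (slope a b x') := by
  refine monotone_int_of_le_succ fun i => ?_
  have h₁ := h (by omega : i ≤ i + 1)
  unfold slope at h₁ ⊢
  split_ifs at h₁ ⊢ <;> first | omega | linarith

theorem isValley_of_slope {f g : ℤ → ℝ} (hf : ∀ h, f (h + 1) - f h = g h) {m : ℤ}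
    (h₀ : ∀ h < m, g h ≤ 0) (h₁ : ∀ h, m ≤ h → 0 ≤ g h) : IsValley f m :=
  ⟨fun h hh => by have := h₀ h hh; have := hf h; linarith,
    fun h hh => by have := h₁ h hh; have := hf h; linarith⟩

/-! ## A data structure for the slopes on one side of `0` -/

/-- The sequence that starts with the list `l` and goes on with the sequence `f`. -/
def prepend (l : List ℝ) (f : ℕ → ℝ) (i : ℕ) : ℝ :=
  if h : i < l.length then l[i] else f (i - l.length)

theorem prepend_append (l l' : List ℝ) (f : ℕ → ℝ) :
    prepend (l ++ l') f = prepend l (prepend l' f) := by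
  funext i
  unfold prepend
  simp only [List.length_append, List.getElem_append]
  split_ifs <;> first | omega | rfl | (congr 1; omega)

@[simp] theorem prepend_nil (f : ℕ → ℝ) : prepend [] f = f := by
  funext i
  simp [prepend]

@[simp] theorem prepend_cons_zero (u : ℝ) (l : List ℝ) (f : ℕ → ℝ) : prepend (u :: l) f 0 = u := by
  simp [prepend]

@[simp] theorem prepend_cons_succ (u : ℝ) (l : List ℝ) (f : ℕ → ℝ) (i : ℕ) :
    prepend (u :: l) f (i + 1) = prepend l f i := by
  simp [prepend]

/-- The sequence `f` with `c` terms `z` inserted at the index `p`. -/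
def insertSeq (p c : ℕ) (z : ℝ) (f : ℕ → ℝ) (i : ℕ) : ℝ :=
  if i < p then f i else if i < p + c then z else f (i - c)

theorem prepend_replicate (l : List ℝ) (c : ℕ) (z : ℝ) (f : ℕ → ℝ) :
    prepend l (prepend (List.replicate c z) f) = insertSeq l.length c z (prepend l f) := by
  funext i
  unfold insertSeq prepend
  simp only [List.length_replicate, List.getElem_replicate]
  split_ifs <;> first | omega | rfl | (congr 1; omega)

theorem prepend_replicate_nil (c : ℕ) (z : ℝ) (f : ℕ → ℝ) :
    prepend (List.replicate c z) f = insertSeq 0 c z f := by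
  simpa using prepend_replicate [] c z f

/-- The list of the entries of a stack of runs, where `(v, c)` stands for `c` entries `v`. -/
def expand (K : List (ℝ × ℕ)) : List ℝ := K.flatMap fun r => List.replicate r.2 r.1

/-- The slopes on one side of `0`: a list of single entries, and below it a stack of runs. -/
structure Side where
  runs : List (ℝ × ℕ)
  units : List ℝ

namespace Side

/-- The sequence of slopes that is represented by the data structure; it ends with terms `β`. -/
def seq (β : ℝ) (A : Side) : ℕ → ℝ := prepend A.units (prepend (expand A.runs) fun _ => β)

/-- The entries of the runs are nonnegative at the position `x`. -/
def Good (x : ℝ) (A : Side) : Prop := ∀ r ∈ A.runs, 0 ≤ r.1 + x ∧ 1 ≤ r.2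

end Side

/-- Push a run, unless it is empty. -/
def pushRun (v : ℝ) (c : ℕ) (K : List (ℝ × ℕ)) : List (ℝ × ℕ) := if c = 0 then K else (v, c) :: K

/-- Remove one entry from the topmost run. -/
def popRun : List (ℝ × ℕ) → List (ℝ × ℕ)
  | [] => []
  | (v, c) :: K => if c ≤ 1 then K else (v, c - 1) :: K

/-- The topmost entry. -/
def topRun (β : ℝ) : List (ℝ × ℕ) → ℝ
  | [] => β
  | (v, _) :: _ => v

theorem expand_pushRun (v : ℝ) (c : ℕ) (K : List (ℝ × ℕ)) :
    expand (pushRun v c K) = List.replicate c v ++ expand K := by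
  unfold pushRun expand
  split_ifs with h <;> simp [h]

/-- An empty stack stands for a constant sequence `β`, so removing an entry from it rightly changes
nothing. -/
theorem prepend_popRun (β : ℝ) {K : List (ℝ × ℕ)} (hK : ∀ r ∈ K, 1 ≤ r.2) (i : ℕ) :
    prepend (expand (popRun K)) (fun _ => β) i = prepend (expand K) (fun _ => β) (i + 1) := by
  match K with
  | [] => simp [popRun, expand]
  | (v, c) :: K =>
    obtain ⟨c, rfl⟩ : ∃ c', c = c' + 1 := ⟨c - 1, by have := hK (v, c) (by simp); simp at this; omega⟩
    have : expand (popRun ((v, c + 1) :: K)) = List.replicate c v ++ expand K := by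
      simp only [popRun, expand]
      split_ifs with h
      · obtain rfl : c = 0 := by omega
        simp
      · simp
    rw [this]
    simp [expand, List.replicate_succ]

theorem prepend_topRun (β : ℝ) {K : List (ℝ × ℕ)} (hK : ∀ r ∈ K, 1 ≤ r.2) :
    prepend (expand K) (fun _ => β) 0 = topRun β K := by
  match K with
  | [] => simp [topRun, expand]
  | (v, c) :: K =>
    obtain ⟨c, rfl⟩ : ∃ c', c = c' + 1 := ⟨c - 1, by have := hK (v, c) (by simp); simp at this; omega⟩
    simp [expand, List.replicate_succ, topRun]

/-- The topmost `r` entries of `D`, in reverse order and reflected at `-x`, on top of `K`. -/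
noncomputable def transfer (x : ℝ) : ℕ → List ℝ → List (ℝ × ℕ) → List (ℝ × ℕ)
  | r + 1, u :: D, K => transfer x r D ((0 - u - x - x, 1) :: K)
  | _, _, K => K

open Classical in
/-- The effect of a step up on the entries `A` to the left and the entries `B` to the right of `0`:
`c - 1` zeros are inserted at the minimum, and everything is shifted by `1`, respectively `c`. -/
noncomputable def moveSides (β x : ℝ) (c : ℕ) (A B : Side) : Side × Side :=
  if A.units = [] then
    (⟨popRun A.runs, []⟩,
      ⟨pushRun (0 - x) (c - 1) B.runs, (0 - topRun β A.runs - x - x) :: B.units⟩)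
  else
    let r := min c A.units.length
    (⟨pushRun (0 - x) (r - 1) A.runs, A.units.drop r⟩,
      ⟨pushRun (0 - x) (c - r) (transfer x r A.units B.runs), B.units⟩)

/-! ### The effect of a step on the represented slopes -/

theorem slope_insertSeq_left (a b : ℕ → ℝ) (x : ℝ) (p c : ℕ) (h : ℤ) :
    slope (insertSeq p c (0 - x) a) b x h =
      if -(p : ℤ) ≤ h then slope a b x h
      else if -(p + c : ℤ) ≤ h then 0 else slope a b x (h + c) := by
  unfold slope insertSeq
  split_ifs <;> first | omega | rfl | (congr 3; omega) | simp

theorem slope_insertSeq_right (a b : ℕ → ℝ) (x : ℝ) (p c : ℕ) (h : ℤ) :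
    slope a (insertSeq p c (0 - x) b) x h =
      if h < p then slope a b x h else if h < p + c then 0 else slope a b x (h - c) := by
  unfold slope insertSeq
  split_ifs <;> first | omega | rfl | simp

/-- One entry crosses 0. The slope `-(a 0 + x)` must be read as `b' 0 + x` on the other side, which
forces the reflected value `0 - a 0 - x - x`. -/
theorem slope_shift {a a' b b' : ℕ → ℝ} {x : ℝ} (ha : ∀ i, a' i = a (i + 1))
    (hb0 : b' 0 = 0 - a 0 - x - x) (hb : ∀ i, b' (i + 1) = b i) (h : ℤ) :
    slope a' b' x h = slope a b x (h - 1) := by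
  unfold slope
  rcases lt_trichotomy h 0 with h₀ | rfl | h₀
  · rw [if_neg (by omega), if_neg (by omega), ha]
    congr 3; omega
  · simp [hb0]; ring
  · rw [if_pos (by omega), if_pos (by omega), ← hb]
    congr 2; omega

theorem slope_transfer (β x : ℝ) (f : ℕ → ℝ) (r : ℕ) (D : List ℝ) (hr : r ≤ D.length)
    (K : List (ℝ × ℕ)) (h : ℤ) :
    slope (prepend (D.drop r) f) (prepend (expand (transfer x r D K)) fun _ => β) x h =
      slope (prepend D f) (prepend (expand K) fun _ => β) x (h - r) := by
  induction r generalizing D K with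
  | zero => cases D <;> simp [transfer]
  | succ r ih =>
    obtain _ | ⟨u, D⟩ := D
    · simp at hr
    rw [List.drop_succ_cons, transfer, ih D (by simpa using hr)]
    rw [slope_shift (a := prepend (u :: D) f) (b := prepend (expand K) fun _ => β)]
    · congr 1; push_cast; ring
    · simp
    · simp [expand]
    · intro i
      simp [expand]

/-- If `A` has no single entries, the minimum is not left of 0: one slope crosses 0, and the `c - 1`
zeros go below the single entries of `B`. Otherwise the minimum lies left of 0, at distance
`A.units.length`. Then `r` slopes cross, and the zeros split into `r - 1` on the left and `c - r` on
the right. An entry of slope 0 is stored as `0 - x`. -/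
theorem slope_moveSides {β x : ℝ} {c : ℕ} (hc : 1 ≤ c) {A B : Side} (hA : A.Good x)
    (hAB : A.units = [] ∨ B.units = []) (h : ℤ) :
    slope ((moveSides β x c A B).1.seq β) ((moveSides β x c A B).2.seq β) x h =
      upSlope (slope (A.seq β) (B.seq β) x) c (B.units.length - A.units.length) h := by
  unfold moveSides
  by_cases hA0 : A.units = []
  · rw [if_pos hA0]
    rw [slope_shift (a := A.seq β) (b := insertSeq B.units.length (c - 1) (0 - x) (B.seq β))]
    · rw [slope_insertSeq_right, hA0, upSlope]
      simp only [List.length_nil]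
      split_ifs <;> first | omega | rfl | (congr 1; omega)
    · intro i
      simp only [Side.seq, hA0, prepend_nil]
      exact prepend_popRun β (fun r hr => (hA r hr).2) i
    · simp only [Side.seq, hA0, prepend_nil, prepend_cons_zero]
      rw [prepend_topRun β fun r hr => (hA r hr).2]
    · intro i
      simp only [Side.seq, prepend_cons_succ, expand_pushRun, prepend_append, prepend_replicate]
  · have hB0 : B.units = [] := hAB.resolve_left hA0
    have hq : 1 ≤ A.units.length := List.length_pos_iff.2 hA0
    rw [if_neg hA0]
    simp only [Side.seq, hB0, prepend_nil, expand_pushRun, prepend_append, List.length_nil]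
    rw [prepend_replicate_nil (c - min c A.units.length), slope_insertSeq_right]
    rw [slope_transfer _ _ _ _ _ (min_le_right _ _), slope_transfer _ _ _ _ _ (min_le_right _ _),
      prepend_replicate, slope_insertSeq_left, slope_insertSeq_left, upSlope]
    generalize A.units.length = q at *
    obtain ⟨r, hr⟩ : ∃ r, r = min c q := ⟨_, rfl⟩
    rw [← hr]
    split_ifs <;> first | omega | rfl | (congr 1; omega)

/-- Reflection changes the sign of an outward slope, so nonpositive single entries become admissible
runs. -/
theorem transfer_good {x : ℝ} {r : ℕ} {D : List ℝ} {K : List (ℝ × ℕ)} (hD : ∀ u ∈ D, u + x ≤ 0)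
    (hK : ∀ r ∈ K, 0 ≤ r.1 + x ∧ 1 ≤ r.2) : ∀ s ∈ transfer x r D K, 0 ≤ s.1 + x ∧ 1 ≤ s.2 := by
  induction r generalizing D K with
  | zero => simpa [transfer] using hK
  | succ r ih =>
    obtain _ | ⟨u, D⟩ := D
    · simpa [transfer] using hK
    rw [transfer]
    refine ih (fun v hv => hD v (by simp [hv])) fun s hs => ?_
    rcases List.mem_cons.1 hs with rfl | hs
    · refine ⟨?_, le_rfl⟩
      have := hD u (by simp)
      dsimp only
      linarith
    · exact hK s hs

theorem pushRun_good {x : ℝ} {c : ℕ} {K : List (ℝ × ℕ)}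
    (hK : ∀ r ∈ K, 0 ≤ r.1 + x ∧ 1 ≤ r.2) :
    ∀ s ∈ pushRun (0 - x) c K, 0 ≤ s.1 + x ∧ 1 ≤ s.2 := by
  unfold pushRun
  split_ifs with h
  · exact hK
  · intro s hs
    rcases List.mem_cons.1 hs with rfl | hs
    · exact ⟨by simp, by dsimp only; omega⟩
    · exact hK s hs

theorem popRun_good {x : ℝ} {K : List (ℝ × ℕ)} (hK : ∀ r ∈ K, 0 ≤ r.1 + x ∧ 1 ≤ r.2) :
    ∀ s ∈ popRun K, 0 ≤ s.1 + x ∧ 1 ≤ s.2 := by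
  match K with
  | [] => simp [popRun]
  | (v, c) :: K =>
    have h₁ := hK (v, c) (by simp)
    have h₂ : ∀ s ∈ K, 0 ≤ s.1 + x ∧ 1 ≤ s.2 := fun s hs => hK s (by simp [hs])
    simp only [popRun]
    split_ifs with h
    · exact h₂
    · intro s hs
      rcases List.mem_cons.1 hs with rfl | hs
      · exact ⟨h₁.1, by dsimp only; omega⟩
      · exact h₂ s hs

theorem moveSides_good {β x : ℝ} {c : ℕ} {A B : Side} (hA : A.Good x) (hB : B.Good x)
    (hD : ∀ u ∈ A.units, u + x ≤ 0) :
    (moveSides β x c A B).1.Good x ∧ (moveSides β x c A B).2.Good x := by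
  unfold moveSides
  split_ifs
  · exact ⟨popRun_good hA, pushRun_good hB⟩
  · exact ⟨pushRun_good hA, pushRun_good (transfer_good hD hB)⟩

/-- As the offset grows, a run stays a run; only single entries can acquire the wrong sign, and
`Side.lower` repairs those. -/
theorem Side.Good.mono {x x' : ℝ} (hx : x ≤ x') {A : Side} (hA : A.Good x) : A.Good x' :=
  fun r hr => ⟨by have := (hA r hr).1; linarith, (hA r hr).2⟩

/-! ### Normal form -/

/-- Move the lowest single entry to the runs. -/
def Side.lower (A : Side) (D : List ℝ) (u : ℝ) : Side := ⟨(u, 1) :: A.runs, D⟩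

theorem Side.seq_lower (β : ℝ) {A : Side} {D : List ℝ} {u : ℝ} (h : A.units = D ++ [u]) :
    (A.lower D u).seq β = A.seq β := by
  simp [Side.seq, Side.lower, h, expand, ← prepend_append]

theorem Side.good_lower {x : ℝ} {A : Side} (hA : A.Good x) (D : List ℝ) {u : ℝ} (hu : 0 ≤ u + x) :
    (A.lower D u).Good x := by
  intro r hr
  rcases List.mem_cons.1 hr with rfl | hr
  · exact ⟨hu, le_rfl⟩
  · exact hA r hr

/-- The lowest single entry is negative. -/
def Side.Normal (x : ℝ) (A : Side) : Prop := ∀ D u, A.units = D ++ [u] → u + x < 0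

theorem Side.seq_of_lt (β : ℝ) {A : Side} {i : ℕ} (hi : i < A.units.length) :
    A.seq β i = A.units[i] := by
  simp [Side.seq, prepend, hi]

theorem Side.Good.seq_nonneg {β x : ℝ} (hβ : 0 ≤ β + x) {A : Side} (hA : A.Good x) {i : ℕ}
    (hi : A.units.length ≤ i) : 0 ≤ A.seq β i + x := by
  simp only [Side.seq, prepend, hi.not_gt, dite_false]
  split_ifs with h
  · have := List.getElem_mem h
    simp only [expand, List.mem_flatMap, List.mem_replicate] at this
    obtain ⟨r, hr, _, hr'⟩ := this
    simp only [expand] at *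
    rw [hr']
    exact (hA r hr).1
  · exact hβ

/-- The entries are nondecreasing away from 0, so testing the lowest single entry is enough. -/
theorem Side.Normal.seq_neg {β x : ℝ} {A : Side} (hA : A.Normal x)
    (hmono : ∀ i, A.seq β i ≤ A.seq β (i + 1)) {i : ℕ} (hi : i < A.units.length) :
    A.seq β i + x < 0 := by
  have hne : A.units ≠ [] := by rintro h; simp [h] at hi
  have h₁ := hA _ _ (List.dropLast_append_getLast hne).symm
  rw [List.getLast_eq_getElem, ← Side.seq_of_lt β] at h₁
  have h₂ : A.seq β i ≤ A.seq β (A.units.length - 1) := monotone_nat_of_le_succ hmono (by omega)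
  linarith

theorem slope_monotone_iff {a b : ℕ → ℝ} {x : ℝ} : Monotone (slope a b x) ↔
    (∀ i, a i ≤ a (i + 1)) ∧ (∀ i, b i ≤ b (i + 1)) ∧ 0 ≤ a 0 + x + (b 0 + x) := by
  constructor
  · intro h
    refine ⟨fun i => ?_, fun i => ?_, ?_⟩
    · have := h (by omega : -1 - ((i + 1 : ℕ) : ℤ) ≤ -1 - (i : ℤ))
      rw [slope, slope, if_neg (by omega), if_neg (by omega)] at this
      rw [show (-1 - (-1 - (i : ℤ))).toNat = i by omega,
        show (-1 - (-1 - ((i + 1 : ℕ) : ℤ))).toNat = i + 1 by omega] at this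
      linarith
    · have := h (by omega : (i : ℤ) ≤ ((i + 1 : ℕ) : ℤ))
      rw [slope, slope, if_pos (by omega), if_pos (by omega)] at this
      simp only [Int.toNat_natCast] at this
      linarith
    · have := h (by omega : (-1 : ℤ) ≤ 0)
      simp [slope] at this
      linarith
  · rintro ⟨ha, hb, h0⟩
    refine monotone_int_of_le_succ fun i => ?_
    unfold slope
    rcases lt_trichotomy i (-1) with h₀ | rfl | h₀
    · rw [if_neg (by omega), if_neg (by omega)]
      have := ha (-1 - (i + 1)).toNat
      rw [show (-1 - (i + 1)).toNat + 1 = (-1 - i).toNat by omega] at this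
      linarith
    · simp; linarith
    · rw [if_pos (by omega), if_pos (by omega)]
      have := hb i.toNat
      rw [show i.toNat + 1 = (i + 1).toNat by omega] at this
      linarith

/-- The minimum of a function with nondecreasing slopes can be read off from the normal form. -/
theorem slope_sign {β x : ℝ} (hβ : 0 ≤ β + x) {A B : Side} (hA : A.Good x) (hB : B.Good x)
    (hA' : A.Normal x) (hB' : B.Normal x) (hg : Monotone (slope (A.seq β) (B.seq β) x)) :
    (A.units = [] ∨ B.units = []) ∧
    (∀ h < (B.units.length - A.units.length : ℤ), slope (A.seq β) (B.seq β) x h ≤ 0) ∧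
    (∀ h, (B.units.length - A.units.length : ℤ) ≤ h → 0 ≤ slope (A.seq β) (B.seq β) x h) := by
  obtain ⟨ha, hb, h0⟩ := slope_monotone_iff.1 hg
  -- Single entries on both sides would make the two outward slopes next to 0 negative, against
  -- convexity at 0.
  have hdisj : A.units = [] ∨ B.units = [] := by
    by_contra! hne
    have h₁ := hA'.seq_neg ha (List.length_pos_iff.2 hne.1)
    have h₂ := hB'.seq_neg hb (List.length_pos_iff.2 hne.2)
    linarith
  refine ⟨hdisj, fun h hh => ?_, fun h hh => ?_⟩
  · unfold slope
    split_ifs with h₀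
    · exact (hB'.seq_neg hb (by omega)).le
    · have : A.units.length ≤ (-1 - h).toNat := by
        rcases hdisj with h₁ | h₁ <;> replace h₁ := congrArg List.length h₁ <;>
        rw [List.length_nil] at h₁ <;> omega
      have := hA.seq_nonneg hβ this
      linarith
  · unfold slope
    split_ifs with h₀
    · refine hB.seq_nonneg hβ ?_
      rcases hdisj with h₁ | h₁ <;> replace h₁ := congrArg List.length h₁ <;>
        rw [List.length_nil] at h₁ <;> omega
    · have := hA'.seq_neg ha (i := (-1 - h).toNat) (by omega)
      linarith

/-! ### The dynamic program on the data structure -/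

/-- Recording a new minimum at `k` leaves the value functions up to index `k` unchanged. -/
theorem pathValue_congr {β : ℝ} {X : ℕ → ℝ} {E : ℕ → Bool} {c m m' : ℕ → ℤ} {k : ℕ}
    (h : ∀ j < k, m j = m' j) : pathValue β X E c m k = pathValue β X E c m' k := by
  induction k with
  | zero => rfl
  | succ k ih =>
    funext i
    rw [pathValue, pathValue, ih fun j hj => h j (by omega), h k (by omega)]

/-- The entries `A` to the left and `B` to the right of `0` are the slopes of the `k`-th value
function, and `m` holds the minima of the previous ones. -/
structure SlopeInv (β : ℝ) (X : ℕ → ℝ) (E : ℕ → Bool) (c : ℕ → ℕ) (m : ℕ → ℤ) (k : ℕ)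
    (A B : Side) : Prop where
  slopes : ∀ h, pathValue (β + X 0) X E (fun j => c j) m k (h + 1) -
    pathValue (β + X 0) X E (fun j => c j) m k h = slope (A.seq β) (B.seq β) (X k) h
  mono : Monotone (slope (A.seq β) (B.seq β) (X k))
  goodA : A.Good (X k)
  goodB : B.Good (X k)
  valley : ∀ j < k, IsValley (pathValue (β + X 0) X E (fun j => c j) m j) (m j)

section

variable {β : ℝ} {X : ℕ → ℝ} {E : ℕ → Bool} {c : ℕ → ℕ} {m : ℕ → ℤ} {k : ℕ} {A B : Side}

/-- The initial function has outward slopes `β + X 0`: at offset `X 0` these are constant entries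
`β`, hence two empty structures. -/
theorem slopeInv_zero (hβ : 0 ≤ β + X 0) (E : ℕ → Bool) (c : ℕ → ℕ) (m : ℕ → ℤ) :
    SlopeInv β X E c m 0 ⟨[], []⟩ ⟨[], []⟩ := by
  have hseq : Side.seq β ⟨[], []⟩ = fun _ => β := by simp [Side.seq, expand]
  refine ⟨fun h => ?_, ?_, by simp [Side.Good], by simp [Side.Good], by simp⟩
  · have := slope_add (fun _ => 0) (fun _ => 0) 0 (β + X 0) h
    rw [hseq]
    simp only [pathValue]
    simp only [slope, zero_add] at this ⊢
    rw [this]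
    simp
    ring
  · rw [hseq, slope_monotone_iff]
    exact ⟨fun _ => le_rfl, fun _ => le_rfl, by linarith⟩

theorem SlopeInv.lower_left (h : SlopeInv β X E c m k A B) {D : List ℝ} {u : ℝ}
    (hA : A.units = D ++ [u]) (hu : 0 ≤ u + X k) : SlopeInv β X E c m k (A.lower D u) B := by
  obtain ⟨h₁, h₂, h₃, h₄, h₅⟩ := h
  rw [← Side.seq_lower β hA] at h₁ h₂
  exact ⟨h₁, h₂, Side.good_lower h₃ D hu, h₄, h₅⟩

theorem SlopeInv.lower_right (h : SlopeInv β X E c m k A B) {D : List ℝ} {u : ℝ}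
    (hB : B.units = D ++ [u]) (hu : 0 ≤ u + X k) : SlopeInv β X E c m k A (B.lower D u) := by
  obtain ⟨h₁, h₂, h₃, h₄, h₅⟩ := h
  rw [← Side.seq_lower β hB] at h₁ h₂
  exact ⟨h₁, h₂, h₃, Side.good_lower h₄ D hu, h₅⟩

/-- The minimum of the value function. -/
def sideMin (A B : Side) : ℤ := B.units.length - A.units.length

/-- The step of the data structure for a point of the kind `up`. -/
noncomputable def stepSides (β x : ℝ) (up : Bool) (c : ℕ) (A B : Side) : Side × Side :=
  if up then moveSides β x c A B else (moveSides β x c B A).swap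

/-- Normal form locates the minimum (`slope_sign`); the step acts at the old offset `X k`, and then
the offset advances to `X (k + 1)`, which adds the cost of the gap. -/
theorem SlopeInv.step (hX : Monotone X) (hβ : 0 ≤ β + X 0) (hc : 1 ≤ c k)
    (h : SlopeInv β X E c m k A B) (hA : A.Normal (X k)) (hB : B.Normal (X k)) :
    SlopeInv β X E c (Function.update m k (sideMin A B)) (k + 1)
      (stepSides β (X k) (E k) (c k) A B).1 (stepSides β (X k) (E k) (c k) A B).2 := by
  have hβk : 0 ≤ β + X k := by linarith [hX k.zero_le]
  obtain ⟨hdisj, hs₀, hs₁⟩ := slope_sign hβk h.goodA h.goodB hA hB h.mono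
  have hXk := hX k.le_succ
  have hm : ∀ j ≤ k, pathValue (β + X 0) X E (fun j => c j) (Function.update m k (sideMin A B)) j =
      pathValue (β + X 0) X E (fun j => c j) m j := fun j hj =>
    pathValue_congr fun i hi => Function.update_of_ne (by omega) _ _
  set m' := Function.update m k (sideMin A B) with hm'
  have hm'k : m' k = sideMin A B := Function.update_self _ _ _
  generalize hA' : (stepSides β (X k) (E k) (c k) A B).1 = A'
  generalize hB' : (stepSides β (X k) (E k) (c k) A B).2 = B'
  have hslope : ∀ i, slope (A'.seq β) (B'.seq β) (X k) i =
      (if E k then upSlope (slope (A.seq β) (B.seq β) (X k)) (c k) (sideMin A B) i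
      else downSlope (slope (A.seq β) (B.seq β) (X k)) (c k) (sideMin A B) i) := by
    intro i
    cases hE : E k
    · simp only [stepSides, hE, Bool.false_eq_true, if_false, Prod.fst_swap, Prod.snd_swap] at hA' hB' ⊢
      -- A step down is a step up for the interchanged sides, seen through the reflection `i ↦ -1 -
      -- i`.
      have h₁ := slope_moveSides (β := β) hc h.goodB hdisj.symm (-1 - i)
      rw [hA', hB', slope_swap] at h₁
      rw [downSlope_eq, ← neg_eq_iff_eq_neg, h₁]
      congr 1
      · funext j
        rw [slope_swap, neg_neg]
      · simp [sideMin]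
    · simp only [stepSides, hE, if_true] at hA' hB' ⊢
      rw [← hA', ← hB']
      exact slope_moveSides hc h.goodA hdisj i
  have hneg : ∀ {A : Side}, A.Normal (X k) → (∀ i, A.seq β i ≤ A.seq β (i + 1)) →
      ∀ u ∈ A.units, u + X k ≤ 0 := by
    intro A hA ha u hu
    obtain ⟨i, hi, rfl⟩ := List.mem_iff_getElem.1 hu
    rw [← Side.seq_of_lt β hi]
    exact (hA.seq_neg ha hi).le
  obtain ⟨ha, hb, -⟩ := slope_monotone_iff.1 h.mono
  have hgood : A'.Good (X k) ∧ B'.Good (X k) := by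
    cases hE : E k
    · simp only [stepSides, hE, Bool.false_eq_true, if_false, Prod.fst_swap, Prod.snd_swap] at hA' hB'
      rw [← hA', ← hB']
      exact (moveSides_good h.goodB h.goodA (hneg hB hb)).symm
    · simp only [stepSides, hE, if_true] at hA' hB'
      rw [← hA', ← hB']
      exact moveSides_good h.goodA h.goodB (hneg hA ha)
  refine ⟨fun i => ?_, slope_monotone_add hXk ?_, hgood.1.mono hXk, hgood.2.mono hXk,
    fun j hj => ?_⟩
  · rw [show X (k + 1) = X k + (X (k + 1) - X k) by ring, slope_add, hslope, pathValue, pathValue,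
      hm k le_rfl, hm'k]
    have e : ∀ p q u v w : ℝ, p + w * u - (q + w * v) = p - q + w * (u - v) := fun _ _ _ _ _ => by ring
    rw [e]
    congr 1
    cases E k
    · exact sub_clampStep_down h.slopes (by exact_mod_cast hc) _ _
    · exact sub_clampStep_up h.slopes (by exact_mod_cast hc) _ _
  · rw [show slope (A'.seq β) (B'.seq β) (X k) = _ from funext hslope]
    cases E k
    · exact downSlope_monotone h.mono hs₀ hs₁
    · exact upSlope_monotone h.mono hs₀ hs₁
  · rw [hm j (by omega)]
    rcases Nat.lt_succ_iff_lt_or_eq.1 hj with hj | rfl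
    · rw [hm', Function.update_of_ne (by omega)]
      exact h.valley j hj
    · rw [hm'k]
      exact isValley_of_slope h.slopes hs₀ hs₁

end

/-! ## Merging the two point sets -/

/-- The points of `S` and `T` in increasing order: the `k`-th point of both sets together lies at
`X k`, belongs to `S` if `E k` holds, and is preceded by `a k` points of `S` and `b k` points of
`T`. -/
structure IsMerge (y z : ℕ) (s t : ℕ → ℝ) (E : ℕ → Bool) (a b : ℕ → ℕ) (X : ℕ → ℝ) : Prop where
  a_zero : a 0 = 0
  b_zero : b 0 = 0
  a_succ : ∀ k, a (k + 1) = if E k then a k + 1 else a k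
  b_succ : ∀ k, b (k + 1) = if E k then b k else b k + 1
  a_end : a (y + z) = y
  b_end : b (y + z) = z
  coord : ∀ k < y + z, X k = if E k then s (a k) else t (b k)
  mono : Monotone X

/-- Locates the `i`-th point of a set in the merged order. The final equivalence turns the counting
condition in `crossing` into a comparison of positions. For `T` it is applied with `E` negated. -/
theorem exists_index {a : ℕ → ℕ} {E : ℕ → Bool} (h0 : a 0 = 0)
    (hs : ∀ k, a (k + 1) = if E k then a k + 1 else a k) {i n : ℕ} (hi : i < a n) :
    ∃ p < n, E p = true ∧ a p = i ∧ ∀ k, i < a (k + 1) ↔ p ≤ k := by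
  have hmono : Monotone a := monotone_nat_of_le_succ fun k => by rw [hs]; split_ifs <;> omega
  obtain ⟨p, hp, hE, ha⟩ : ∃ p < n, E p = true ∧ a p = i := by
    induction n with
    | zero => omega
    | succ n ih =>
      by_cases h : i < a n
      · obtain ⟨p, hp, h'⟩ := ih h
        exact ⟨p, by omega, h'⟩
      · rw [hs] at hi
        split_ifs at hi with hE
        · exact ⟨n, by omega, hE, by omega⟩
        · omega
  refine ⟨p, hp, hE, ha, fun k => ⟨fun h => ?_, fun h => ?_⟩⟩
  · by_contra! hk
    have := hmono (show k + 1 ≤ p from hk)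
    omega
  · have h₁ := hmono (show p + 1 ≤ k + 1 by omega)
    rw [hs p, if_pos hE] at h₁
    omega

theorem sum_range_ite (X : ℕ → ℝ) {n r : ℕ} (hr : r ≤ n) :
    ∑ k ∈ Finset.range n, (X (k + 1) - X k) * (if r ≤ k then (1 : ℝ) else 0) = X n - X r := by
  induction n, hr using Nat.le_induction with
  | base =>
    rw [sub_self]
    refine Finset.sum_eq_zero fun k hk => ?_
    rw [if_neg (by simpa using hk), mul_zero]
  | succ n hr ih => rw [Finset.sum_range_succ, ih, if_pos hr]; ring

theorem sum_range_ite_le (X : ℕ → ℝ) {n p q : ℕ} (hpq : p ≤ q) (hq : q ≤ n) :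
    ∑ k ∈ Finset.range n, (X (k + 1) - X k) *
      ((if p ≤ k then 1 else 0) - (if q ≤ k then 1 else 0)) = X q - X p := by
  simp only [mul_sub, Finset.sum_sub_distrib]
  rw [sum_range_ite X (hpq.trans hq), sum_range_ite X hq]
  ring

/-- A distance is the sum of the widths of the gaps between the two positions; the difference of
indicators selects exactly these gaps. -/
theorem abs_sub_eq_sum {X : ℕ → ℝ} (hX : Monotone X) {n p q : ℕ} (hp : p ≤ n) (hq : q ≤ n) :
    |X p - X q| = ∑ k ∈ Finset.range n, (X (k + 1) - X k) *
      |(if p ≤ k then (1 : ℝ) else 0) - (if q ≤ k then 1 else 0)| := by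
  wlog hpq : p ≤ q generalizing p q
  · rw [abs_sub_comm, this hq hp (by omega)]
    exact Finset.sum_congr rfl fun k _ => by rw [abs_sub_comm]
  rw [abs_sub_comm, abs_of_nonneg (sub_nonneg.2 (hX hpq)), ← sum_range_ite_le X hpq hq]
  refine Finset.sum_congr rfl fun k _ => ?_
  rw [abs_of_nonneg]
  split_ifs <;> first | omega | norm_num

/-! ## Weighted sets of pairs and their heights -/

section

variable {y z : ℕ} {s t : ℕ → ℝ} {E : ℕ → Bool} {a b : ℕ → ℕ} {X : ℕ → ℝ}

/-- The sign with which the pair `p` crosses the gap before the `k`-th point. -/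
def crossing (a b : ℕ → ℕ) (k : ℕ) (p : Fin y × Fin z) : ℤ :=
  (if (p.1 : ℕ) < a k then 1 else 0) - (if (p.2 : ℕ) < b k then 1 else 0)

/-- The total sign of the crossings of the gap before the `k`-th point. -/
def height (a b : ℕ → ℕ) (q : Fin y × Fin z → ℤ) (k : ℕ) : ℤ := ∑ p, q p * crossing a b k p

theorem IsMerge.dist_eq (hm : IsMerge y z s t E a b X) (p : Fin y × Fin z) :
    |s p.1 - t p.2| = ∑ k ∈ Finset.range (y + z),
      (X (k + 1) - X k) * |(crossing a b (k + 1) p : ℝ)| := by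
  obtain ⟨i, hi, hEi, hai, hi'⟩ := exists_index (n := y + z) hm.a_zero hm.a_succ
    (show (p.1 : ℕ) < a (y + z) by rw [hm.a_end]; exact p.1.2)
  obtain ⟨j, hj, hEj, hbj, hj'⟩ := exists_index (n := y + z) (a := b) (E := fun k => !E k) hm.b_zero
    (fun k => by rw [hm.b_succ]; cases E k <;> simp)
    (show (p.2 : ℕ) < b (y + z) by rw [hm.b_end]; exact p.2.2)
  have h₁ : s p.1 = X i := by rw [hm.coord i hi, if_pos hEi, hai]
  have h₂ : t p.2 = X j := by
    rw [hm.coord j hj, if_neg (by simpa using hEj), hbj]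
  rw [h₁, h₂, abs_sub_eq_sum hm.mono hi.le hj.le]
  refine Finset.sum_congr rfl fun k _ => ?_
  simp only [crossing, hi', hj']
  push_cast
  rfl

theorem height_zero (hm : IsMerge y z s t E a b X) (q : Fin y × Fin z → ℤ) : height a b q 0 = 0 := by
  simp [height, crossing, hm.a_zero, hm.b_zero]

theorem height_end (hm : IsMerge y z s t E a b X) (q : Fin y × Fin z → ℤ) :
    height a b q (y + z) = 0 := by
  simp [height, crossing, hm.a_end, hm.b_end]

theorem IsMerge.mono_a (hm : IsMerge y z s t E a b X) : Monotone a :=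
  monotone_nat_of_le_succ fun k => by rw [hm.a_succ]; split_ifs <;> omega

theorem IsMerge.mono_b (hm : IsMerge y z s t E a b X) : Monotone b :=
  monotone_nat_of_le_succ fun k => by rw [hm.b_succ]; split_ifs <;> omega

theorem IsMerge.a_lt (hm : IsMerge y z s t E a b X) {k : ℕ} (hk : k < y + z) (hE : E k = true) :
    a k < y := by
  have := hm.mono_a (show k + 1 ≤ y + z from hk)
  rw [hm.a_succ, if_pos hE, hm.a_end] at this
  omega

theorem IsMerge.b_lt (hm : IsMerge y z s t E a b X) {k : ℕ} (hk : k < y + z) (hE : E k = false) :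
    b k < z := by
  have := hm.mono_b (show k + 1 ≤ y + z from hk)
  rw [hm.b_succ, hE, if_neg (by simp), hm.b_end] at this
  omega

/-- Only pairs containing the point just passed change their crossing, each by 1. -/
theorem height_succ_left (hm : IsMerge y z s t E a b X) (q : Fin y × Fin z → ℤ) {k : ℕ}
    (hk : k < y + z) (hE : E k = true) :
    height a b q (k + 1) = height a b q k + ∑ j, q (⟨a k, hm.a_lt hk hE⟩, j) := by
  rw [height, height, ← sub_eq_iff_eq_add', ← Finset.sum_sub_distrib, Fintype.sum_prod_type,
    Finset.sum_eq_single_of_mem (⟨a k, hm.a_lt hk hE⟩ : Fin y) (Finset.mem_univ _)]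
  · refine Finset.sum_congr rfl fun j _ => ?_
    simp only [crossing, hm.a_succ, hm.b_succ, hE, if_true]
    split_ifs <;> omega
  · intro i _ hi
    refine Finset.sum_eq_zero fun j _ => ?_
    have : (i : ℕ) ≠ a k := fun h => hi (Fin.ext h)
    have h' : (i : ℕ) < a k + 1 ↔ (i : ℕ) < a k := by omega
    simp [crossing, hm.a_succ, hm.b_succ, hE, h']

theorem height_succ_right (hm : IsMerge y z s t E a b X) (q : Fin y × Fin z → ℤ) {k : ℕ}
    (hk : k < y + z) (hE : E k = false) :
    height a b q k = height a b q (k + 1) + ∑ i, q (i, ⟨b k, hm.b_lt hk hE⟩) := by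
  rw [height, height, ← sub_eq_iff_eq_add', ← Finset.sum_sub_distrib, Fintype.sum_prod_type_right,
    Finset.sum_eq_single_of_mem (⟨b k, hm.b_lt hk hE⟩ : Fin z) (Finset.mem_univ _)]
  · refine Finset.sum_congr rfl fun j _ => ?_
    simp only [crossing, hm.a_succ, hm.b_succ, hE, if_false, Bool.false_eq_true]
    split_ifs <;> omega
  · intro j _ hj
    refine Finset.sum_eq_zero fun i _ => ?_
    have : (j : ℕ) ≠ b k := fun h => hj (Fin.ext h)
    have h' : (j : ℕ) < b k + 1 ↔ (j : ℕ) < b k := by omega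
    simp [crossing, hm.a_succ, hm.b_succ, hE, h']

theorem sum_dist_eq (hm : IsMerge y z s t E a b X) (q : Fin y × Fin z → ℤ) (hq : ∀ p, 0 ≤ q p) :
    ∑ p, (q p : ℝ) * |s p.1 - t p.2| = ∑ k ∈ Finset.range (y + z),
      (X (k + 1) - X k) * ∑ p, |((q p * crossing a b (k + 1) p : ℤ) : ℝ)| := by
  simp only [hm.dist_eq, Finset.mul_sum]
  rw [Finset.sum_comm]
  refine Finset.sum_congr rfl fun k _ => Finset.sum_congr rfl fun p _ => ?_
  push_cast
  rw [abs_mul, abs_of_nonneg (show (0 : ℝ) ≤ q p by exact_mod_cast hq p)]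
  ring

/-- The triangle inequality in each gap: opposite crossings may cancel in the height but not in the
cost. -/
theorem pathCost_height_le (hm : IsMerge y z s t E a b X) (q : Fin y × Fin z → ℤ)
    (hq : ∀ p, 0 ≤ q p) :
    pathCost (y + z) X (height a b q) ≤ ∑ p, (q p : ℝ) * |s p.1 - t p.2| := by
  rw [sum_dist_eq hm q hq, pathCost]
  refine Finset.sum_le_sum fun k _ =>
    mul_le_mul_of_nonneg_left ?_ (sub_nonneg.2 (hm.mono k.le_succ))
  rw [height]
  push_cast
  exact Finset.abs_sum_le_sum_abs _ _

/-- If no two pairs of positive weight cross, then there are no cancellations in the heights. -/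
theorem pathCost_height_eq (hm : IsMerge y z s t E a b X) (q : Fin y × Fin z → ℤ)
    (hq : ∀ p, 0 ≤ q p)
    (hcross : ∀ p p', 0 < q p → 0 < q p' → p.1 < p'.1 → p'.2 < p.2 → False) :
    ∑ p, (q p : ℝ) * |s p.1 - t p.2| = pathCost (y + z) X (height a b q) := by
  rw [sum_dist_eq hm q hq, pathCost]
  refine Finset.sum_congr rfl fun k _ => ?_
  congr 1
  rw [height]
  push_cast
  -- Two pairs traversing one gap in opposite directions would cross each other. Hence all terms of
  -- the sum have the same sign.
  by_cases h : ∃ p, 0 < q p ∧ crossing a b (k + 1) p = 1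
  · obtain ⟨p, hp, hpc⟩ := h
    have h₀ : ∀ p', (0 : ℝ) ≤ q p' * crossing a b (k + 1) p' := by
      intro p'
      norm_cast
      rcases (hq p').eq_or_lt with h' | h'
      · simp [← h']
      · refine mul_nonneg h'.le ?_
        by_contra! hneg
        refine hcross p p' hp h' ?_ ?_
        all_goals
          rw [Fin.lt_def]
          unfold crossing at hpc hneg
          split_ifs at hpc hneg <;> omega
    rw [abs_of_nonneg (Finset.sum_nonneg fun p' _ => h₀ p')]
    exact Finset.sum_congr rfl fun p' _ => abs_of_nonneg (h₀ p')
  · have h₀ : ∀ p', (q p' * crossing a b (k + 1) p' : ℝ) ≤ 0 := by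
      intro p'
      norm_cast
      rcases (hq p').eq_or_lt with h' | h'
      · simp [← h']
      · refine mul_nonpos_of_nonneg_of_nonpos h'.le ?_
        by_contra! hpos
        refine h ⟨p', h', ?_⟩
        unfold crossing at hpos ⊢
        split_ifs at hpos ⊢ <;> omega
    rw [abs_of_nonpos (Finset.sum_nonpos fun p' _ => h₀ p'), ← Finset.sum_neg_distrib]
    exact Finset.sum_congr rfl fun p' _ => abs_of_nonpos (h₀ p')

/-! ## Matchings as weights -/

/-- The weight `1` on the pairs of `M`. -/
def weight (M : Finset (Fin y × Fin z)) (p : Fin y × Fin z) : ℤ := if p ∈ M then 1 else 0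

theorem degS_eq (M : Finset (Fin y × Fin z)) (i : Fin y) :
    (degS M i : ℤ) = ∑ j, weight M (i, j) := by
  simp only [degS, weight, Finset.card_filter]
  push_cast
  rw [← Finset.sum_filter, ← Finset.sum_filter, Finset.sum_const, Finset.sum_const]
  congr 1
  refine Finset.card_bij (fun p _ => p.2) ?_ ?_ ?_
  · rintro ⟨i', j⟩ h
    simp only [Finset.mem_filter, Finset.mem_univ, true_and] at h ⊢
    rw [← h.2]; exact h.1
  · rintro ⟨i₁, j₁⟩ h₁ ⟨i₂, j₂⟩ h₂ h
    simp only [Finset.mem_filter] at h₁ h₂ h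
    rw [h₁.2, h₂.2, h]
  · intro j hj
    exact ⟨(i, j), by simpa using hj, rfl⟩

theorem degT_eq (M : Finset (Fin y × Fin z)) (j : Fin z) :
    (degT M j : ℤ) = ∑ i, weight M (i, j) := by
  simp only [degT, weight, Finset.card_filter]
  push_cast
  rw [← Finset.sum_filter, ← Finset.sum_filter, Finset.sum_const, Finset.sum_const]
  congr 1
  refine Finset.card_bij (fun p _ => p.1) ?_ ?_ ?_
  · rintro ⟨i, j'⟩ h
    simp only [Finset.mem_filter, Finset.mem_univ, true_and] at h ⊢
    rw [← h.2]; exact h.1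
  · rintro ⟨i₁, j₁⟩ h₁ ⟨i₂, j₂⟩ h₂ h
    simp only [Finset.mem_filter] at h₁ h₂ h
    rw [h₁.2, h₂.2, h]
  · intro i hi
    exact ⟨(i, j), by simpa using hi, rfl⟩

theorem weight_nonneg (M : Finset (Fin y × Fin z)) (p : Fin y × Fin z) : 0 ≤ weight M p := by
  unfold weight; split_ifs <;> norm_num

theorem cost_eq (sF : Fin y → ℝ) (tF : Fin z → ℝ) (M : Finset (Fin y × Fin z)) :
    cost sF tF M = ∑ p, (weight M p : ℝ) * |sF p.1 - tF p.2| := by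
  simp [cost, weight, Finset.sum_ite_mem]

/-- The path of a matching is a path for the capacities. -/
theorem IsMatching.isPath (hm : IsMerge y z s t E a b X) {capS : Fin y → ℕ} {capT : Fin z → ℕ}
    {c : ℕ → ℕ}
    (hcS : ∀ k (hk : k < y + z) (hE : E k = true), c k = capS ⟨a k, hm.a_lt hk hE⟩)
    (hcT : ∀ k (hk : k < y + z) (hE : E k = false), c k = capT ⟨b k, hm.b_lt hk hE⟩)
    {M : Finset (Fin y × Fin z)} (hM : IsMatching capS capT M) :
    IsPath (y + z) E (fun k => c k) (height a b (weight M)) := by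
  intro k hk
  cases hE : E k
  · have h₁ := hM.2 ⟨b k, hm.b_lt hk hE⟩
    rw [height_succ_right hm _ hk hE, ← degT_eq]
    have := hcT k hk hE
    simp only [IsStep, Bool.false_eq_true, if_false]
    omega
  · have h₁ := hM.1 ⟨a k, hm.a_lt hk hE⟩
    rw [height_succ_left hm _ hk hE, ← degS_eq]
    have := hcS k hk hE
    simp only [IsStep, if_true]
    omega

/-! ## The matching of a path -/

/-- The length of the intersection of the intervals `[P (i + 1), P i]` and `[R (j + 1), R j]`. -/
def overlap (P R : ℕ → ℤ) (p : Fin y × Fin z) : ℤ :=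
  max 0 (min (P p.1) (R p.2) - max (P (p.1 + 1)) (R (p.2 + 1)))

/-- The pairs of intervals that overlap. -/
def overlapPairs (y z : ℕ) (P R : ℕ → ℤ) : Finset (Fin y × Fin z) :=
  Finset.univ.filter fun p => P (p.1 + 1) < R p.2 ∧ R (p.2 + 1) < P p.1

/-- The intervals of `R` tile an interval containing `[P (i + 1), P i]`. Clamping their endpoints to
the latter makes the sum telescope. -/
theorem sum_overlap_right {P R : ℕ → ℤ} (hR : ∀ j < z, R (j + 1) < R j) (i : Fin y)
    (hP : P (i + 1) < P i) (h0 : P i ≤ R 0) (h0' : R z ≤ P (i + 1)) :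
    ∑ j : Fin z, overlap P R (i, j) = P i - P (i + 1) := by
  have h : ∀ j : Fin z, overlap P R (i, j) =
      max (P (i + 1)) (min (P i) (R j)) - max (P (i + 1)) (min (P i) (R (j + 1))) := by
    intro j
    have := hR j j.2
    simp only [overlap]
    omega
  rw [Finset.sum_congr rfl fun j _ => h j,
    Fin.sum_univ_eq_sum_range (fun j => max (P (i + 1)) (min (P i) (R j)) -
      max (P (i + 1)) (min (P i) (R (j + 1)))) z, Finset.sum_range_sub']
  omega

theorem overlap_swap (P R : ℕ → ℤ) (i : Fin y) (j : Fin z) :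
    overlap P R (i, j) = overlap R P (j, i) := by
  simp only [overlap]
  rw [min_comm, max_comm (P _)]

theorem overlap_pos {P R : ℕ → ℤ} {p : Fin y × Fin z} (hP : P (p.1 + 1) < P p.1)
    (hR : R (p.2 + 1) < R p.2) : 0 < overlap P R p ↔ P (p.1 + 1) < R p.2 ∧ R (p.2 + 1) < P p.1 := by
  simp only [overlap]
  omega

/-- The matching of a path of minimum cost has minimum cost. -/
theorem isMinCostMatching_overlapPairs (hm : IsMerge y z s t E a b X) {capS : Fin y → ℕ}
    {capT : Fin z → ℕ} {c : ℕ → ℕ}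
    (hcS : ∀ k (hk : k < y + z) (hE : E k = true), c k = capS ⟨a k, hm.a_lt hk hE⟩)
    (hcT : ∀ k (hk : k < y + z) (hE : E k = false), c k = capT ⟨b k, hm.b_lt hk hE⟩)
    {h : ℕ → ℤ} (hh : IsPath (y + z) E (fun k => c k) h) (hh0 : h 0 = 0)
    (hmin : ∀ h', IsPath (y + z) E (fun k => c k) h' → h' 0 = 0 → h' (y + z) = 0 →
      pathCost (y + z) X h ≤ pathCost (y + z) X h')
    {P R : ℕ → ℤ} (hPR : ∀ k ≤ y + z, R (b k) - P (a k) = h k) (hPy : P y = 0) (hRz : R z = 0) :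
    (∀ i < y, P (i + 1) < P i) ∧ (∀ j < z, R (j + 1) < R j) ∧ P 0 = R 0 ∧
    IsMinCostMatching (fun i => s i) (fun j => t j) capS capT (overlapPairs y z P R) := by
  have hPs : ∀ i : Fin y, P (i + 1) < P i ∧ P i - P (i + 1) ≤ capS i := by
    intro i
    obtain ⟨k, hk, hE, ha, -⟩ := exists_index (n := y + z) hm.a_zero hm.a_succ
      (show (i : ℕ) < a (y + z) by rw [hm.a_end]; exact i.2)
    have h₁ := hh k hk
    have h₂ := hPR k hk.le
    have h₃ := hPR (k + 1) hk
    have h₄ : c k = capS i := (hcS k hk hE).trans (congrArg capS (Fin.ext ha))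
    rw [hm.a_succ, hm.b_succ, if_pos hE, if_pos hE, ha] at h₃
    rw [ha] at h₂
    simp only [IsStep, hE, if_true] at h₁
    omega
  have hRs : ∀ j : Fin z, R (j + 1) < R j ∧ R j - R (j + 1) ≤ capT j := by
    intro j
    obtain ⟨k, hk, hE, hb, -⟩ := exists_index (n := y + z) (a := b) (E := fun k => !E k) hm.b_zero
      (fun k => by rw [hm.b_succ]; cases E k <;> simp)
      (show (j : ℕ) < b (y + z) by rw [hm.b_end]; exact j.2)
    have hE : E k = false := by simpa using hE
    have h₁ := hh k hk
    have h₂ := hPR k hk.le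
    have h₃ := hPR (k + 1) hk
    have h₄ : c k = capT j := (hcT k hk hE).trans (congrArg capT (Fin.ext hb))
    rw [hm.a_succ, hm.b_succ, if_neg (by simp [hE]), if_neg (by simp [hE]), hb] at h₃
    rw [hb] at h₂
    simp only [IsStep, hE, Bool.false_eq_true, if_false] at h₁
    omega
  have h00 : P 0 = R 0 := by
    have := hPR 0 (Nat.zero_le _)
    rw [hm.a_zero, hm.b_zero, hh0] at this
    omega
  have hPanti : ∀ i j, i ≤ j → j ≤ y → P j ≤ P i := by
    intro i j hij hj
    induction j, hij using Nat.le_induction with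
    | base => exact le_rfl
    | succ j hij ih => exact (hPs ⟨j, hj⟩).1.le.trans (ih (by omega))
  have hRanti : ∀ i j, i ≤ j → j ≤ z → R j ≤ R i := by
    intro i j hij hj
    induction j, hij using Nat.le_induction with
    | base => exact le_rfl
    | succ j hij ih => exact (hRs ⟨j, hj⟩).1.le.trans (ih (by omega))
  have hrow : ∀ i : Fin y, ∑ j : Fin z, overlap P R (i, j) = P i - P (i + 1) := fun i =>
    sum_overlap_right (fun j hj => (hRs ⟨j, hj⟩).1) i (hPs i).1
      (by rw [← h00]; exact hPanti _ _ (Nat.zero_le _) i.2.le)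
      (by rw [hRz, ← hPy]; exact hPanti _ _ i.2 le_rfl)
  have hcol : ∀ j : Fin z, ∑ i : Fin y, overlap P R (i, j) = R j - R (j + 1) := by
    intro j
    simp only [overlap_swap P R]
    exact sum_overlap_right (fun i hi => (hPs ⟨i, hi⟩).1) j (hRs j).1
      (by rw [h00]; exact hRanti _ _ (Nat.zero_le _) j.2.le)
      (by rw [hPy, ← hRz]; exact hRanti _ _ j.2 le_rfl)
  have hpos : ∀ p : Fin y × Fin z, 0 < overlap P R p ↔ p ∈ overlapPairs y z P R := fun p => by
    rw [overlap_pos (hPs p.1).1 (hRs p.2).1, overlapPairs]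
    simp
  have hnn : ∀ p : Fin y × Fin z, 0 ≤ overlap P R p := fun p => le_max_left _ _
  have hle : ∀ p : Fin y × Fin z, weight (overlapPairs y z P R) p ≤ overlap P R p := by
    intro p
    have h₁ := hpos p
    have h₂ := hnn p
    unfold weight
    split_ifs with h₃
    · have := h₁.2 h₃; omega
    · exact h₂
  -- The chosen pairs are exactly the support of the overlaps, so a vertex without chosen pairs
  -- would have overlap sum 0, whereas its interval has positive length.
  have hzero : ∀ p : Fin y × Fin z, weight (overlapPairs y z P R) p = 0 → overlap P R p = 0 := by
    intro p hp
    have h₃ : p ∉ overlapPairs y z P R := fun h₃ => by simp [weight, h₃] at hp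
    have h₁ := mt (hpos p).1 h₃
    have h₂ := hnn p
    omega
  have hmatch : IsMatching capS capT (overlapPairs y z P R) := by
    refine ⟨fun i => ?_, fun j => ?_⟩
    · have h₁ := degS_eq (overlapPairs y z P R) i
      have h₂ : ∑ j, weight (overlapPairs y z P R) (i, j) ≤ ∑ j, overlap P R (i, j) :=
        Finset.sum_le_sum fun j _ => hle (i, j)
      have h₃ : 0 < ∑ j, weight (overlapPairs y z P R) (i, j) := by
        refine lt_of_le_of_ne (Finset.sum_nonneg fun j _ => weight_nonneg _ _) fun h₀ => ?_
        have h₄ := (Finset.sum_eq_zero_iff_of_nonneg fun j _ => weight_nonneg _ _).1 h₀.symm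
        have h₅ := hrow i
        rw [Finset.sum_eq_zero fun j hj => hzero _ (h₄ j hj)] at h₅
        have := (hPs i).1
        omega
      rw [hrow] at h₂
      have := (hPs i).2
      omega
    · have h₁ := degT_eq (overlapPairs y z P R) j
      have h₂ : ∑ i, weight (overlapPairs y z P R) (i, j) ≤ ∑ i, overlap P R (i, j) :=
        Finset.sum_le_sum fun i _ => hle (i, j)
      have h₃ : 0 < ∑ i, weight (overlapPairs y z P R) (i, j) := by
        refine lt_of_le_of_ne (Finset.sum_nonneg fun i _ => weight_nonneg _ _) fun h₀ => ?_
        have h₄ := (Finset.sum_eq_zero_iff_of_nonneg fun i _ => weight_nonneg _ _).1 h₀.symm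
        have h₅ := hcol j
        rw [Finset.sum_eq_zero fun i hi => hzero _ (h₄ i hi)] at h₅
        have := (hRs j).1
        omega
      rw [hcol] at h₂
      have := (hRs j).2
      omega
  have hheight : ∀ k ≤ y + z, height a b (overlap P R : Fin y × Fin z → ℤ) k = h k := by
    intro k hk
    induction k with
    | zero => rw [height_zero hm, hh0]
    | succ k ih =>
      have h₁ := ih (by omega)
      have h₂ := hPR k (by omega)
      have h₃ := hPR (k + 1) hk
      cases hE : E k
      · have h₄ := height_succ_right hm (overlap P R) hk hE
        rw [hcol] at h₄
        rw [hm.a_succ, hm.b_succ, if_neg (by simp [hE]), if_neg (by simp [hE])] at h₃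
        simp only at h₄
        omega
      · rw [height_succ_left hm _ hk hE, hrow]
        rw [hm.a_succ, hm.b_succ, if_pos hE, if_pos hE] at h₃
        simp only
        omega
  refine ⟨fun i hi => (hPs ⟨i, hi⟩).1, fun j hj => (hRs ⟨j, hj⟩).1, h00, hmatch, fun M' hM' => ?_⟩
  have h₁ := pathCost_height_le hm (weight M') (weight_nonneg M')
  rw [← cost_eq (fun i : Fin y => s i) (fun j : Fin z => t j)] at h₁
  have h₂ := hmin _ (hM'.isPath hm hcS hcT) (height_zero hm _) (height_end hm _)
  -- Crossing pairs would give `P p'.1 ≤ P (p.1 + 1) < R p.2 ≤ R (p'.2 + 1) < P p'.1`.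
  have h₃ := pathCost_height_eq hm (overlap P R) hnn (by
    intro p p' hp hp' h₁ h₂
    rw [hpos, overlapPairs] at hp hp'
    simp only [Finset.mem_filter, Finset.mem_univ, true_and] at hp hp'
    have h₃ := hPanti (p.1 + 1) p'.1 h₁ p'.1.2.le
    have h₄ := hRanti (p'.2 + 1) p.2 h₂ p.2.2.le
    omega)
  have h₄ : pathCost (y + z) X (height a b (overlap P R : Fin y × Fin z → ℤ)) =
      pathCost (y + z) X h :=
    Finset.sum_congr rfl fun k hk => by rw [hheight _ (by simpa using hk)]
  have h₅ : cost (fun i : Fin y => s i) (fun j : Fin z => t j) (overlapPairs y z P R) ≤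
      ∑ p : Fin y × Fin z, (overlap P R p : ℝ) * |s p.1 - t p.2| := by
    rw [cost_eq]
    exact Finset.sum_le_sum fun p _ =>
      mul_le_mul_of_nonneg_right (by exact_mod_cast hle p) (abs_nonneg _)
  linarith

end

/-! ## The merge program -/

attribute [simp] Program.exec IntExpr.eval RealExpr.eval Test.Holds

open Classical in
/-- The next point of the merged sequence, after `i` points of `S` and `j` points of `T`, belongs to
`S`. -/
noncomputable def takeS (y z : ℕ) (s t : ℕ → ℝ) (i j : ℕ) : Bool :=
  decide (i < y ∧ ¬ (j < z ∧ ¬ s i ≤ t j))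

/-- The numbers of points of `S` and of `T` among the first `k` points. -/
noncomputable def mergePos (y z : ℕ) (s t : ℕ → ℝ) : ℕ → ℕ × ℕ
  | 0 => (0, 0)
  | k + 1 =>
    let p := mergePos y z s t k
    if takeS y z s t p.1 p.2 then (p.1 + 1, p.2) else (p.1, p.2 + 1)

/-- Whether the `k`-th point belongs to `S`. -/
noncomputable def mergeKind (y z : ℕ) (s t : ℕ → ℝ) (k : ℕ) : Bool :=
  takeS y z s t (mergePos y z s t k).1 (mergePos y z s t k).2

/-- The `k`-th entry of the merged sequence of the values of `s` and `t`. -/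
noncomputable def mergeVal {α : Type} (y z : ℕ) (s t : ℕ → ℝ) (f g : ℕ → α) (k : ℕ) : α :=
  if mergeKind y z s t k then f (mergePos y z s t k).1 else g (mergePos y z s t k).2

section

variable {y z : ℕ} {s t : ℕ → ℝ}

theorem mergePos_succ (k : ℕ) : mergePos y z s t (k + 1) =
    if mergeKind y z s t k then ((mergePos y z s t k).1 + 1, (mergePos y z s t k).2)
    else ((mergePos y z s t k).1, (mergePos y z s t k).2 + 1) := rfl

theorem mergePos_add (k : ℕ) : (mergePos y z s t k).1 + (mergePos y z s t k).2 = k := by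
  induction k with
  | zero => rfl
  | succ k ih =>
    rw [mergePos_succ]
    split_ifs <;> simp only <;> omega

theorem mergeKind_eq_true {k : ℕ} : mergeKind y z s t k = true ↔ (mergePos y z s t k).1 < y ∧
    ¬ ((mergePos y z s t k).2 < z ∧ ¬ s (mergePos y z s t k).1 ≤ t (mergePos y z s t k).2) := by
  simp only [mergeKind, takeS, decide_eq_true_eq]

theorem mergePos_le {k : ℕ} (hk : k ≤ y + z) :
    (mergePos y z s t k).1 ≤ y ∧ (mergePos y z s t k).2 ≤ z := by
  induction k with
  | zero => exact ⟨Nat.zero_le _, Nat.zero_le _⟩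
  | succ k ih =>
    have h₁ := ih (by omega)
    have h₂ := mergePos_add (y := y) (z := z) (s := s) (t := t) k
    rw [mergePos_succ]
    split_ifs with h
    · have := (mergeKind_eq_true.1 h).1
      exact ⟨this, h₁.2⟩
    · refine ⟨h₁.1, ?_⟩
      rw [mergeKind_eq_true] at h
      simp only
      by_contra! h'
      exact h ⟨by omega, fun h'' => by omega⟩

/-- The value just taken is at most both remaining candidates: by sortedness in its own set, by the
comparison made in the other. -/
theorem mergeVal_mono (hs : ∀ i, i + 1 < y → s i ≤ s (i + 1)) (ht : ∀ j, j + 1 < z → t j ≤ t (j + 1))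
    {k : ℕ} (hk : k + 1 < y + z) :
    mergeVal y z s t s t k ≤ mergeVal y z s t s t (k + 1) := by
  have hle := mergePos_le (y := y) (z := z) (s := s) (t := t) (k := k) (by omega)
  have hle' := mergePos_le (y := y) (z := z) (s := s) (t := t) (k := k + 1) (by omega)
  have hadd := mergePos_add (y := y) (z := z) (s := s) (t := t) (k + 1)
  have key : ((mergePos y z s t (k + 1)).1 < y →
      mergeVal y z s t s t k ≤ s (mergePos y z s t (k + 1)).1) ∧
      ((mergePos y z s t (k + 1)).2 < z →
      mergeVal y z s t s t k ≤ t (mergePos y z s t (k + 1)).2) := by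
    rw [mergePos_succ, mergeVal]
    split_ifs with h
    · rw [mergeKind_eq_true] at h
      refine ⟨fun h₁ => hs _ h₁, fun h₁ => ?_⟩
      by_contra h₂
      exact h.2 ⟨h₁, h₂⟩
    · rw [mergeKind_eq_true] at h
      refine ⟨fun h₁ => ?_, fun h₁ => ht _ h₁⟩
      by_contra h₂
      refine h ⟨h₁, fun h₃ => h₂ (not_le.1 h₃.2).le⟩
  rw [mergeVal.eq_def y z s t s t (k + 1)]
  split_ifs with h
  · exact key.1 (mergeKind_eq_true.1 h).1
  · refine key.2 ?_
    rw [mergeKind_eq_true] at h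
    by_contra h'
    exact h ⟨by omega, fun h'' => by omega⟩

/-- The merged sequence, continued by its last value. -/
theorem isMerge_mergePos (hs : ∀ i, i + 1 < y → s i ≤ s (i + 1))
    (ht : ∀ j, j + 1 < z → t j ≤ t (j + 1)) :
    IsMerge y z s t (mergeKind y z s t) (fun k => (mergePos y z s t k).1)
      (fun k => (mergePos y z s t k).2)
      (fun k => mergeVal y z s t s t (min k (y + z - 1))) where
  a_zero := rfl
  b_zero := rfl
  a_succ k := by rw [mergePos_succ]; split_ifs <;> rfl
  b_succ k := by rw [mergePos_succ]; split_ifs <;> rfl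
  a_end := by
    have h₁ := mergePos_le (y := y) (z := z) (s := s) (t := t) (k := y + z) le_rfl
    have h₂ := mergePos_add (y := y) (z := z) (s := s) (t := t) (y + z)
    omega
  b_end := by
    have h₁ := mergePos_le (y := y) (z := z) (s := s) (t := t) (k := y + z) le_rfl
    have h₂ := mergePos_add (y := y) (z := z) (s := s) (t := t) (y + z)
    omega
  coord k hk := by rw [min_eq_left (by omega)]; rfl
  mono := by
    refine monotone_nat_of_le_succ fun k => ?_
    by_cases hk : k + 1 < y + z
    · rw [min_eq_left (by omega), min_eq_left (by omega)]
      exact mergeVal_mono hs ht hk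
    · rw [min_eq_right (by omega), min_eq_right (by omega)]

end

/-- One step of the merge. The integer variables `6` and `7` count the points of `S` and `T` that
have been treated; coordinates, kinds and capacities of the merged sequence go to real array `30` and
integer arrays `30` and `31`. -/
def mergeBody : Program :=
  let i : IntExpr := .var 6
  let j : IntExpr := .var 7
  let put (v : RealExpr) (kind cap : IntExpr) : Program :=
    .seq (.setReal 30 (.add i j) v) (.seq (.setInt 30 (.add i j) kind) (.setInt 31 (.add i j) cap))
  .cond (.and (.intLT i (.cell 2 (.const 0)))
      (.not (.and (.intLT j (.cell 2 (.const 1))) (.not (.realLE (.cell 0 i) (.cell 1 j))))))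
    (.seq (put (.cell 0 i) (.const 1) (.cell 0 i)) (.assign 6 (.add i (.const 1))))
    (.seq (put (.cell 1 j) (.const 0) (.cell 1 j)) (.assign 7 (.add j (.const 1))))

def mergeTest : Test := .intLT (.add (.var 6) (.var 7)) (.add (.cell 2 (.const 0)) (.cell 2 (.const 1)))

/-- The merged sequence has been computed up to the `k`-th point. -/
structure MergeInv (y z : ℕ) (s t : ℕ → ℝ) (cS cT : ℕ → ℕ) (σ₀ : State) (k : ℕ) (σ : State) :
    Prop where
  le : k ≤ y + z
  i_eq : σ.int 6 0 = (mergePos y z s t k).1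
  j_eq : σ.int 7 0 = (mergePos y z s t k).2
  coord : ∀ l < k, σ.real 30 l = mergeVal y z s t s t l
  kind : ∀ l < k, σ.int 30 l = if mergeKind y z s t l then 1 else 0
  cap : ∀ l < k, σ.int 31 l = mergeVal y z s t cS cT l
  frame_int : ∀ a, a ≠ 6 → a ≠ 7 → a ≠ 30 → a ≠ 31 → σ.int a = σ₀.int a
  frame_real : ∀ a, a ≠ 30 → σ.real a = σ₀.real a

theorem mergeInv_step {y z : ℕ} {s t : ℕ → ℝ} {cS cT : ℕ → ℕ} {σ₀ : State}
    (hy : σ₀.int 2 0 = y) (hz : σ₀.int 2 1 = z) (hs : ∀ i < y, σ₀.real 0 i = s i)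
    (ht : ∀ j < z, σ₀.real 1 j = t j) (hcS : ∀ i < y, σ₀.int 0 i = cS i)
    (hcT : ∀ j < z, σ₀.int 1 j = cT j) {k : ℕ} {σ : State}
    (h : MergeInv y z s t cS cT σ₀ k σ) (hb : mergeTest.Holds σ) :
    MergeInv y z s t cS cT σ₀ (k + 1) (mergeBody.exec σ) := by
  obtain ⟨hle, hi, hj, hX, hE, hc, hfi, hfr⟩ := h
  have hadd := mergePos_add (y := y) (z := z) (s := s) (t := t) k
  have h2 := hfi 2 (by decide) (by decide) (by decide) (by decide)
  have h0 := hfi 0 (by decide) (by decide) (by decide) (by decide)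
  have h1 := hfi 1 (by decide) (by decide) (by decide) (by decide)
  have h0' := hfr 0 (by decide)
  have h1' := hfr 1 (by decide)
  have hk : k < y + z := by
    simp [mergeTest, hi, hj, h2, hy, hz] at hb
    omega
  have hpos := mergePos_le (y := y) (z := z) (s := s) (t := t) hle
  have hpos' := mergePos_succ (y := y) (z := z) (s := s) (t := t) k
  have hkind := mergeKind_eq_true (y := y) (z := z) (s := s) (t := t) (k := k)
  have hvalX : mergeVal y z s t s t k = _ := mergeVal.eq_def y z s t s t k
  have hvalc : mergeVal y z s t cS cT k = _ := mergeVal.eq_def y z s t cS cT k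
  generalize mergePos y z s t k = p at *
  obtain ⟨i, j⟩ := p
  simp only at hadd hpos hpos' hkind hi hj hvalX hvalc
  have hij : (i : ℤ) + j = k := by omega
  have hne : ∀ l < k + 1, l ≠ k → l < k ∧ (l : ℤ) ≠ k := fun l hl hl' => by omega
  have hT : (Test.and (.intLT (.var 6) (.cell 2 (.const 0)))
      (.not (.and (.intLT (.var 7) (.cell 2 (.const 1)))
        (.not (.realLE (.cell 0 (.var 6)) (.cell 1 (.var 7))))))).Holds σ ↔
      mergeKind y z s t k = true := by
    simp only [Test.Holds, IntExpr.eval, RealExpr.eval, hi, hj, h2, hy, hz, h0', h1', hkind]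
    rw [show ((i : ℤ) + 1 ≤ y) ↔ i < y by omega]
    refine and_congr_right fun hiy => not_congr ?_
    -- If `T` is exhausted, the real comparison reads an irrelevant cell, but the conjunct `j < z`
    -- already decides the test.
    by_cases hjz : j < z
    · rw [hs i hiy, ht j hjz]
      simp [hjz]
    · simp [hjz]
  by_cases hE' : mergeKind y z s t k = true
  · rw [if_pos hE'] at hpos' hvalX hvalc
    have hcond := hkind.1 hE'
    simp only [mergeBody, Program.exec, if_pos (hT.2 hE')]
    refine ⟨hk, ?_, ?_, ?_, ?_, ?_, ?_, ?_⟩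
    · simp [hpos', hi]
    · simp [hpos', hj]
    · intro l hl
      rcases eq_or_ne l k with rfl | hl'
      · simp [hi, hj, hij, h0', hvalX, hs i hcond.1]
      · obtain ⟨hl, hl'⟩ := hne l hl hl'
        simp [hi, hj, hij, hl', hX l hl]
    · intro l hl
      rcases eq_or_ne l k with rfl | hl'
      · simp [hi, hj, hij, hE']
      · obtain ⟨hl, hl'⟩ := hne l hl hl'
        simp [hi, hj, hij, hl', hE l hl]
    · intro l hl
      rcases eq_or_ne l k with rfl | hl'
      · simp [hi, hj, hij, h0, hvalc, hcS i hcond.1]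
      · obtain ⟨hl, hl'⟩ := hne l hl hl'
        simp [hi, hj, hij, hl', hc l hl]
    · intro a h₁ h₂ h₃ h₄
      simp [h₁, h₃, h₄, hfi a h₁ h₂ h₃ h₄]
    · intro a h₁
      simp [h₁, hfr a h₁]
  · rw [if_neg hE'] at hpos' hvalX hvalc
    have hjz : j < z := by
      by_contra hjz
      exact hE' (hkind.2 ⟨by omega, fun h => hjz h.1⟩)
    simp only [mergeBody, Program.exec, if_neg (mt hT.1 hE')]
    refine ⟨hk, ?_, ?_, ?_, ?_, ?_, ?_, ?_⟩
    · simp [hpos', hi]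
    · simp [hpos', hj]
    · intro l hl
      rcases eq_or_ne l k with rfl | hl'
      · simp [hi, hj, hij, h1', hvalX, ht j hjz]
      · obtain ⟨hl, hl'⟩ := hne l hl hl'
        simp [hi, hj, hij, hl', hX l hl]
    · intro l hl
      rcases eq_or_ne l k with rfl | hl'
      · simp [hi, hj, hij, hE']
      · obtain ⟨hl, hl'⟩ := hne l hl hl'
        simp [hi, hj, hij, hl', hE l hl]
    · intro l hl
      rcases eq_or_ne l k with rfl | hl'
      · simp [hi, hj, hij, h1, hvalc, hcT j hjz]
      · obtain ⟨hl, hl'⟩ := hne l hl hl'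
        simp [hi, hj, hij, hl', hc l hl]
    · intro a h₁ h₂ h₃ h₄
      simp [h₂, h₃, h₄, hfi a h₁ h₂ h₃ h₄]
    · intro a h₁
      simp [h₁, hfr a h₁]

theorem run_merge {y z : ℕ} {s t : ℕ → ℝ} {cS cT : ℕ → ℕ} {σ : State}
    (hy : σ.int 2 0 = y) (hz : σ.int 2 1 = z) (hs : ∀ i < y, σ.real 0 i = s i)
    (ht : ∀ j < z, σ.real 1 j = t j) (hcS : ∀ i < y, σ.int 0 i = cS i)
    (hcT : ∀ j < z, σ.int 1 j = cT j) (h6 : σ.int 6 0 = 0) (h7 : σ.int 7 0 = 0) :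
    ∃ n σ', Run (.loop mergeTest mergeBody) σ n σ' ∧ MergeInv y z s t cS cT σ (y + z) σ' ∧
      n ≤ (mergeBody.maxTime + mergeTest.time + 1) * (y + z + 1) := by
  obtain ⟨k, n, σ', h₁, h₂, h₃, h₄⟩ := run_loop_count (b := mergeTest) (P := mergeBody)
    (by simp [mergeBody, Program.LoopFree]) (y + z) (MergeInv y z s t cS cT σ) (fun k σ h => h.le)
    (fun k σ h hb => mergeInv_step hy hz hs ht hcS hcT h hb) (σ := σ)
    ⟨Nat.zero_le _, h6, h7, by simp, by simp, by simp, fun _ _ _ _ _ => rfl, fun _ _ => rfl⟩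
  refine ⟨n, σ', h₁, ?_, h₄⟩
  suffices hk : k = y + z by rwa [hk] at h₂
  have hadd := mergePos_add (y := y) (z := z) (s := s) (t := t) k
  have hle := h₂.le
  have h2 := h₂.frame_int 2 (by decide) (by decide) (by decide) (by decide)
  simp [mergeTest, h₂.i_eq, h₂.j_eq, h2, hy, hz] at h₃
  omega

/-! ## The data structure in memory -/

/-- The stack of runs `K` is stored with values `v` and multiplicities `m` at `1, …, p`. -/
def StackRep (v : ℤ → ℝ) (m : ℤ → ℤ) : ℤ → List (ℝ × ℕ) → Prop
  | p, [] => p = 0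
  | p, (u, c) :: K => 1 ≤ p ∧ v p = u ∧ m p = c ∧ StackRep v m (p - 1) K

/-- The list `D` is stored, in reverse order, at `lo, …, hi - 1`. -/
def DequeRep (d : ℤ → ℝ) (lo : ℤ) : ℤ → List ℝ → Prop
  | hi, [] => lo = hi
  | hi, u :: D => d (hi - 1) = u ∧ DequeRep d lo (hi - 1) D

theorem StackRep.nonneg {v : ℤ → ℝ} {m : ℤ → ℤ} {p : ℤ} {K : List (ℝ × ℕ)} (h : StackRep v m p K) :
    0 ≤ p := by
  match K, h with
  | [], h => exact h.ge
  | (u, c) :: K, h => have := h.1; omega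

theorem StackRep.congr {v v' : ℤ → ℝ} {m m' : ℤ → ℤ} {p : ℤ} {K : List (ℝ × ℕ)}
    (h : StackRep v m p K) (hv : ∀ q, 1 ≤ q → q ≤ p → v' q = v q)
    (hm : ∀ q, 1 ≤ q → q ≤ p → m' q = m q) : StackRep v' m' p K := by
  induction K generalizing p with
  | nil => exact h
  | cons r K ih =>
    obtain ⟨u, c⟩ := r
    obtain ⟨h₁, h₂, h₃, h₄⟩ := h
    exact ⟨h₁, (hv p h₁ le_rfl).trans h₂, (hm p h₁ le_rfl).trans h₃,
      ih h₄ (fun q hq hq' => hv q hq (by omega)) fun q hq hq' => hm q hq (by omega)⟩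

theorem DequeRep.length {d : ℤ → ℝ} {lo hi : ℤ} {D : List ℝ} (h : DequeRep d lo hi D) :
    hi = lo + D.length := by
  induction D generalizing hi with
  | nil => simpa using h.symm
  | cons u D ih => have := ih h.2; simp; omega

theorem DequeRep.congr {d d' : ℤ → ℝ} {lo hi : ℤ} {D : List ℝ} (h : DequeRep d lo hi D)
    (hd : ∀ q < hi, d' q = d q) : DequeRep d' lo hi D := by
  induction D generalizing hi with
  | nil => exact h
  | cons u D ih => exact ⟨(hd _ (by omega)).trans h.1, ih h.2 fun q hq => hd q (by omega)⟩

/-- The reversed storage makes both ends accessible: entries near 0 are pushed and popped at `hi`,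
and the lowest leaves at `lo`. -/
theorem DequeRep.lowest {d : ℤ → ℝ} {lo hi : ℤ} {D : List ℝ} {u : ℝ}
    (h : DequeRep d lo hi (D ++ [u])) : d lo = u ∧ DequeRep d (lo + 1) hi D := by
  induction D generalizing hi with
  | nil =>
    obtain ⟨h₁, h₂⟩ := h
    have h₂ : lo = hi - 1 := h₂
    exact ⟨by rw [h₂]; exact h₁, show lo + 1 = hi by omega⟩
  | cons v D ih =>
    obtain ⟨h₁, h₂⟩ := h
    exact ⟨(ih h₂).1, h₁, (ih h₂).2⟩

/-- The side `A` is stored in the integer arrays `o, …, o + 3` and the real arrays `o`, `o + 1`. -/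
structure SideRep (o : ℕ) (β : ℝ) (σ : State) (A : Side) : Prop where
  stack : StackRep (σ.real o) (σ.int o) (σ.int (o + 1) 0) A.runs
  bottom : σ.real o 0 = β
  deque : DequeRep (σ.real (o + 1)) (σ.int (o + 2) 0) (σ.int (o + 3) 0) A.units

theorem SideRep.congr {o : ℕ} {β : ℝ} {σ σ' : State} {A : Side} (h : SideRep o β σ A)
    (hi : ∀ a, o ≤ a → a ≤ o + 3 → σ'.int a = σ.int a)
    (hr : ∀ a, o ≤ a → a ≤ o + 1 → σ'.real a = σ.real a) : SideRep o β σ' A := by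
  obtain ⟨h₁, h₂, h₃⟩ := h
  constructor
  · rwa [hr o (by omega) (by omega), hi o (by omega) (by omega), hi (o + 1) (by omega) (by omega)]
  · rwa [hr o (by omega) (by omega)]
  · rwa [hr (o + 1) (by omega) (by omega), hi (o + 2) (by omega) (by omega),
      hi (o + 3) (by omega) (by omega)]

/-- The two sides are stored at `o` and `o'`, and the memory outside agrees with that of `σ₀`. -/
structure SidesRep (o o' : ℕ) (β : ℝ) (σ₀ σ : State) (A B : Side) : Prop where
  left : SideRep o β σ A
  right : SideRep o' β σ B
  frame_int : ∀ a, a < 10 ∨ 30 ≤ a → a ≠ 35 → a ≠ 36 → σ.int a = σ₀.int a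
  frame_real : ∀ a, a < 10 ∨ 30 ≤ a → σ.real a = σ₀.real a

theorem SidesRep.symm {o o' : ℕ} {β : ℝ} {σ₀ σ : State} {A B : Side}
    (h : SidesRep o o' β σ₀ σ A B) : SidesRep o' o β σ₀ σ B A :=
  ⟨h.right, h.left, h.frame_int, h.frame_real⟩

/-- The arrays of the two sides are disjoint and lie in the range reserved for them. -/
structure Separate (o o' : ℕ) : Prop where
  left : 10 ≤ o ∧ o + 3 < 30
  right : 10 ≤ o' ∧ o' + 3 < 30
  sep : o + 3 < o' ∨ o' + 3 < o

theorem Separate.symm {o o' : ℕ} (h : Separate o o') : Separate o' o := ⟨h.right, h.left, h.sep.symm⟩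

/-- A change of the memory that is confined to the side at `o`. -/
theorem SidesRep.change_left {o o' : ℕ} (ho : Separate o o') {β : ℝ} {σ₀ σ σ' : State}
    {A A' B : Side} (h : SidesRep o o' β σ₀ σ A B) (hA : SideRep o β σ' A')
    (hi : ∀ a, a < o ∨ o + 3 < a → σ'.int a = σ.int a)
    (hr : ∀ a, a < o ∨ o + 3 < a → σ'.real a = σ.real a) : SidesRep o o' β σ₀ σ' A' B := by
  obtain ⟨ho₁, ho₂, ho₃⟩ := ho
  refine ⟨hA, h.right.congr (fun a ha ha' => hi a (by omega)) (fun a ha ha' => hr a (by omega)),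
    fun a ha h35 h36 => ?_, fun a ha => ?_⟩
  · rw [hi a (by omega), h.frame_int a ha h35 h36]
  · rw [hr a (by omega), h.frame_real a ha]

/-- A change of the auxiliary variables `35` and `36`. -/
theorem SidesRep.change_aux {o o' : ℕ} (ho : Separate o o') {β : ℝ} {σ₀ σ σ' : State}
    {A B : Side} (h : SidesRep o o' β σ₀ σ A B)
    (hi : ∀ a, a ≠ 35 → a ≠ 36 → σ'.int a = σ.int a) (hr : σ'.real = σ.real) :
    SidesRep o o' β σ₀ σ' A B := by
  obtain ⟨ho₁, ho₂, ho₃⟩ := ho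
  refine ⟨h.left.congr (fun a ha ha' => hi a (by omega) (by omega)) (fun a _ _ => by rw [hr]),
    h.right.congr (fun a ha ha' => hi a (by omega) (by omega)) (fun a _ _ => by rw [hr]),
    fun a ha h35 h36 => ?_, fun a ha => ?_⟩
  · rw [hi a h35 h36, h.frame_int a ha h35 h36]
  · rw [hr, h.frame_real a ha]

/-! ### Elementary operations -/

theorem IntExpr.eval_setReal (σ : State) (a : ℕ) (i : ℤ) (v : ℝ) (e : IntExpr) :
    e.eval (σ.setReal a i v) = e.eval σ := by
  induction e with
  | const n => rfl
  | cell b e ih => simp [ih]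
  | add e₁ e₂ ih₁ ih₂ => simp [ih₁, ih₂]
  | sub e₁ e₂ ih₁ ih₂ => simp [ih₁, ih₂]

/-- Push a run with value `e` and multiplicity `m` on the stack at `o`. -/
def pushProg (o : ℕ) (e : RealExpr) (m : IntExpr) : Program :=
  let top : IntExpr := .add (.var (o + 1)) (.const 1)
  .seq (.setReal o top e) (.seq (.setInt o top m) (.assign (o + 1) top))

section

variable {o o' : ℕ} {β : ℝ} {σ₀ σ : State} {A B : Side}

theorem SidesRep.push (ho : Separate o o') (h : SidesRep o o' β σ₀ σ A B) {e : RealExpr} {m : IntExpr}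
    {u : ℝ} {c : ℕ} (he : e.eval σ = u) (hm : m.eval σ = c) :
    SidesRep o o' β σ₀ ((pushProg o e m).exec σ) ⟨(u, c) :: A.runs, A.units⟩ B := by
  refine h.change_left ho ⟨?_, ?_, ?_⟩ (fun a ha => ?_) fun a ha => ?_
  · have hp := h.left.stack.nonneg
    refine ⟨?_, ?_, ?_, ?_⟩
    · simp [pushProg]; omega
    · simp [pushProg, he]
    · simp [pushProg, IntExpr.eval_setReal, hm]
    · have := h.left.stack
      simp only [pushProg, Program.exec, IntExpr.eval]
      simp
      refine this.congr (fun q hq hq' => ?_) (fun q hq hq' => ?_)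
      · rw [Function.update_of_ne (by omega)]
      · rw [Function.update_of_ne (by omega)]
  -- The new top has a positive address, so the sentinel `β` in cell 0 is preserved.
  · have hp := h.left.stack.nonneg
    simp [pushProg, Function.update_of_ne (show (0 : ℤ) ≠ σ.int (o + 1) 0 + 1 by omega), h.left.bottom]
  · have := h.left.deque
    simpa [pushProg] using this
  · simp [pushProg, show a ≠ o by omega, show a ≠ o + 1 by omega]
  · simp [pushProg, show a ≠ o by omega]

end

section

variable {o o' : ℕ} {β : ℝ} {σ₀ σ : State} {A B : Side}

/-- Push a run of slope `0` and multiplicity `m`, unless it is empty. The real variable `31` holds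
the current position. -/
def pushZeros (o : ℕ) (m : IntExpr) : Program :=
  .cond (.intLE (.const 1) m) (pushProg o (.sub .zero (.var 31)) m) .skip

theorem SidesRep.pushZeros (ho : Separate o o') (h : SidesRep o o' β σ₀ σ A B) {m : IntExpr}
    {c : ℕ} (hm : m.eval σ = c) :
    SidesRep o o' β σ₀ ((pushZeros o m).exec σ)
      ⟨pushRun (0 - σ₀.real 31 0) c A.runs, A.units⟩ B := by
  have hx := h.frame_real 31 (by omega)
  unfold LCMM.pushZeros pushRun
  by_cases hc : c = 0
  · simpa [hc, hm] using h
  · simp only [Program.exec, Test.Holds, IntExpr.eval, hm]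
    rw [if_pos (by omega), if_neg hc]
    exact h.push ho (by simp [hx]) hm

/-- Remove the topmost single entry. -/
def popUnit (o : ℕ) : Program := .assign (o + 3) (.sub (.var (o + 3)) (.const 1))

theorem SidesRep.popUnit (ho : Separate o o') (h : SidesRep o o' β σ₀ σ A B) {u : ℝ} {D : List ℝ}
    (hA : A.units = u :: D) : SidesRep o o' β σ₀ ((popUnit o).exec σ) ⟨A.runs, D⟩ B := by
  refine h.change_left ho ⟨?_, ?_, ?_⟩ (fun a ha => ?_) fun a ha => ?_
  · simpa [LCMM.popUnit] using h.left.stack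
  · simpa [LCMM.popUnit] using h.left.bottom
  · have := h.left.deque
    rw [hA] at this
    simpa [LCMM.popUnit] using this.2
  · simp [LCMM.popUnit, show a ≠ o + 3 by omega]
  · simp [LCMM.popUnit]

/-- Put a single entry on top of the others. -/
def pushUnit (o : ℕ) (e : RealExpr) : Program :=
  .seq (.setReal (o + 1) (.var (o + 3)) e) (.assign (o + 3) (.add (.var (o + 3)) (.const 1)))

theorem SidesRep.pushUnit (ho : Separate o o') (h : SidesRep o o' β σ₀ σ A B) {e : RealExpr} {u : ℝ}
    (he : e.eval σ = u) :
    SidesRep o o' β σ₀ ((pushUnit o e).exec σ) ⟨A.runs, u :: A.units⟩ B := by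
  refine h.change_left ho ⟨?_, ?_, ?_⟩ (fun a ha => ?_) fun a ha => ?_
  · simpa [LCMM.pushUnit] using h.left.stack
  · simpa [LCMM.pushUnit] using h.left.bottom
  · have := h.left.deque
    refine ⟨by simp [LCMM.pushUnit, he], ?_⟩
    simp [LCMM.pushUnit]
    exact this.congr fun q hq => by rw [Function.update_of_ne (by omega)]
  · simp [LCMM.pushUnit, show a ≠ o + 3 by omega]
  · simp [LCMM.pushUnit, show a ≠ o + 1 by omega]

/-- Remove one entry from the topmost run. -/
def popRunProg (o : ℕ) : Program :=
  .cond (.intLE (.const 1) (.var (o + 1)))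
    (.cond (.intLE (.cell o (.var (o + 1))) (.const 1))
      (.assign (o + 1) (.sub (.var (o + 1)) (.const 1)))
      (.setInt o (.var (o + 1)) (.sub (.cell o (.var (o + 1))) (.const 1))))
    .skip

theorem SidesRep.popRun (ho : Separate o o') (h : SidesRep o o' β σ₀ σ A B) :
    SidesRep o o' β σ₀ ((popRunProg o).exec σ) ⟨popRun A.runs, A.units⟩ B := by
  obtain ⟨K, D⟩ := A
  have hs := h.left.stack
  match K, hs with
  | [], hs =>
    have hs : σ.int (o + 1) 0 = 0 := hs
    have : (popRunProg o).exec σ = σ := by simp [popRunProg, hs]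
    rw [this]
    exact h
  | (u, c) :: K, hs =>
    obtain ⟨h₁, h₂, h₃, h₄⟩ := hs
    have hT : (Test.intLE (.const 1) (.var (o + 1))).Holds σ := by simpa using h₁
    simp only [popRunProg, Program.exec, if_pos hT, LCMM.popRun]
    by_cases hc : c ≤ 1
    · rw [if_pos (by simp [h₃, hc]), if_pos hc]
      refine h.change_left ho ⟨?_, ?_, ?_⟩ (fun a ha => ?_) fun a ha => ?_
      · simpa using h₄
      · simpa using h.left.bottom
      · simpa using h.left.deque
      · simp [show a ≠ o + 1 by omega]
      · simp
    · rw [if_neg (by simp [h₃, hc]), if_neg hc]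
      refine h.change_left ho ⟨⟨?_, ?_, ?_, ?_⟩, ?_, ?_⟩ (fun a ha => ?_) fun a ha => ?_
      · simpa using h₁
      · simpa using h₂
      · simp [h₃]; omega
      · simp
        exact h₄.congr (fun q hq hq' => rfl)
          (fun q hq hq' => by rw [Function.update_of_ne (by omega)])
      · simpa using h.left.bottom
      · simpa using h.left.deque
      · simp [show a ≠ o by omega]
      · simp

/-- Thanks to the sentinel in cell 0, one read also serves the empty stack. -/
theorem SideRep.top_eq (h : SideRep o β σ A) : σ.real o (σ.int (o + 1) 0) = topRun β A.runs := by
  obtain ⟨K, D⟩ := A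
  have hs := h.stack
  match K, hs with
  | [], hs =>
    have hs : σ.int (o + 1) 0 = 0 := hs
    rw [hs, h.bottom]
    rfl
  | (u, c) :: K, hs => exact hs.2.1

/-! ### Normal form -/

def lowerTest (o : ℕ) : Test :=
  .and (.intLT (.var (o + 2)) (.var (o + 3)))
    (.realLE .zero (.add (.cell (o + 1) (.var (o + 2))) (.var 31)))

/-- Move the lowest single entry to the runs. -/
def lowerBody (o : ℕ) : Program :=
  .seq (pushProg o (.cell (o + 1) (.var (o + 2))) (.const 1))
    (.assign (o + 2) (.add (.var (o + 2)) (.const 1)))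

theorem SidesRep.lower (ho : Separate o o') (h : SidesRep o o' β σ₀ σ A B) {u : ℝ} {D : List ℝ}
    (hA : A.units = D ++ [u]) :
    SidesRep o o' β σ₀ ((lowerBody o).exec σ) (A.lower D u) B := by
  have hd := h.left.deque
  rw [hA] at hd
  have h₁ := h.push ho (e := .cell (o + 1) (.var (o + 2))) (m := .const 1) (u := u) (c := 1)
    (by simpa using hd.lowest.1) (by simp)
  rw [lowerBody, Program.exec]
  generalize (pushProg o (.cell (o + 1) (.var (o + 2))) (.const 1)).exec σ = τ at h₁
  have hd' := h₁.left.deque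
  simp only [hA] at hd'
  refine h₁.change_left ho ⟨?_, ?_, ?_⟩ (fun a ha => ?_) fun a ha => ?_
  · simpa [Side.lower] using h₁.left.stack
  · simpa using h₁.left.bottom
  · simpa [Side.lower] using hd'.lowest.2
  · simp [show a ≠ o + 2 by omega]
  · simp

/-- Each iteration turns one single entry into a run and is paid for by the 100 units of potential
that it releases. The predicate `P` carries along what is known of the other side. -/
theorem run_lower (ho : Separate o o') {P : Side → Prop}
    (hP : ∀ A D u, P A → A.units = D ++ [u] → 0 ≤ u + σ₀.real 31 0 → P (A.lower D u))
    (h : SidesRep o o' β σ₀ σ A B) (hA : P A) :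
    ∃ A' n σ', Run (.loop (lowerTest o) (lowerBody o)) σ n σ' ∧ SidesRep o o' β σ₀ σ' A' B ∧ P A' ∧
      A'.Normal (σ₀.real 31 0) ∧ n + 100 * A'.units.length ≤ 100 * A.units.length + 20 := by
  have htest : ∀ (A : Side) (σ : State), SidesRep o o' β σ₀ σ A B → ∀ D u, A.units = D ++ [u] →
      ((lowerTest o).Holds σ ↔ 0 ≤ u + σ₀.real 31 0) := by
    intro A σ h D u hA
    have hd := h.left.deque
    have hlen := hd.length
    rw [hA] at hd hlen
    simp only [List.length_append, List.length_singleton] at hlen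
    simp only [lowerTest, Test.Holds, IntExpr.eval, RealExpr.eval, hd.lowest.1,
      h.frame_real 31 (by omega)]
    constructor
    · exact fun h => h.2
    · exact fun h => ⟨by push_cast at hlen; omega, h⟩
  have hnil : ∀ (A : Side) (σ : State), SidesRep o o' β σ₀ σ A B → (lowerTest o).Holds σ →
      A.units ≠ [] := by
    intro A σ h hb hA
    have hlen := h.left.deque.length
    rw [hA] at hlen
    simp [lowerTest, hlen] at hb
  obtain ⟨A', n, σ', h₁, h₂, h₃, h₄⟩ := run_loop (b := lowerTest o) (P := lowerBody o)
    (fun A σ => SidesRep o o' β σ₀ σ A B ∧ P A) (fun A => 100 * A.units.length) (by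
      rintro A σ ⟨h, hA⟩ hb
      have hne := hnil A σ h hb
      have hD := (List.dropLast_append_getLast hne).symm
      obtain ⟨n, hn, hn'⟩ := run_exec (P := lowerBody o)
        (by simp [lowerBody, pushProg, Program.LoopFree]) σ
      refine ⟨_, n, _, hn, ⟨h.lower ho hD, hP _ _ _ hA hD ((htest A σ h _ _ hD).1 hb)⟩, ?_⟩
      have e₁ : (lowerBody o).maxTime = 26 := rfl
      have e₂ : (lowerTest o).time = 16 := rfl
      have e₃ := List.length_pos_iff.2 hne
      simp only [Side.lower, List.length_dropLast]
      omega) A σ ⟨h, hA⟩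
  have e₂ : (lowerTest o).time = 16 := rfl
  exact ⟨A', n, σ', h₁, h₂.1, h₂.2, fun D u hA' => not_le.1 fun hu => h₃ ((htest A' σ' h₂.1 D u hA').2 hu),
    by omega⟩

/-! ### The step -/

/-- The reflected topmost single entry of the side at `o`. -/
def reflectUnit (o : ℕ) : RealExpr :=
  .sub (.sub (.sub .zero (.cell (o + 1) (.sub (.var (o + 3)) (.const 1)))) (.var 31)) (.var 31)

/-- The reflected topmost entry of the runs at `o`. -/
def reflectRun (o : ℕ) : RealExpr :=
  .sub (.sub (.sub .zero (.cell o (.var (o + 1)))) (.var 31)) (.var 31)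

def transferTest : Test := .intLE (.const 1) (.var 36)

/-- Move the topmost single entry of the side at `o` to the runs of the side at `o'`. -/
def transferBody (o o' : ℕ) : Program :=
  .seq (pushProg o' (reflectUnit o) (.const 1))
    (.seq (popUnit o) (.assign 36 (.sub (.var 36) (.const 1))))

theorem int_pushProg (o : ℕ) (e : RealExpr) (m : IntExpr) (σ : State) {a : ℕ} (h₁ : a ≠ o)
    (h₂ : a ≠ o + 1) : ((pushProg o e m).exec σ).int a = σ.int a := by
  simp [pushProg, h₁, h₂]

theorem int_pushZeros (o : ℕ) (m : IntExpr) (σ : State) {a : ℕ} (h₁ : a ≠ o)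
    (h₂ : a ≠ o + 1) : ((LCMM.pushZeros o m).exec σ).int a = σ.int a := by
  simp only [LCMM.pushZeros, Program.exec]
  split_ifs
  · exact int_pushProg o _ _ _ h₁ h₂
  · rfl

theorem int_transferBody (ho : Separate o o') (σ : State) {a : ℕ} (ha : 30 ≤ a) (ha' : a ≠ 36) :
    ((transferBody o o').exec σ).int a = σ.int a := by
  obtain ⟨h₁, h₂, -⟩ := ho
  rw [transferBody, Program.exec, ← int_pushProg o' (reflectUnit o) (.const 1) σ
    (show a ≠ o' by omega) (show a ≠ o' + 1 by omega)]
  simp [LCMM.popUnit, ha', show a ≠ o + 3 by omega]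

theorem run_transfer (ho : Separate o o') {r : ℕ} (h : SidesRep o o' β σ₀ σ A B)
    (hr : r ≤ A.units.length) (h36 : σ.int 36 0 = r) :
    ∃ n σ', Run (.loop transferTest (transferBody o o')) σ n σ' ∧
      SidesRep o o' β σ₀ σ' ⟨A.runs, A.units.drop r⟩
        ⟨transfer (σ₀.real 31 0) r A.units B.runs, B.units⟩ ∧
      σ'.int 35 = σ.int 35 ∧ n ≤ 100 * r + 10 := by
  induction r generalizing σ A B with
  | zero =>
    refine ⟨_, σ, Run.loopStop ?_, ?_, rfl, ?_⟩
    · simp [transferTest, h36]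
    · have : transfer (σ₀.real 31 0) 0 A.units B.runs = B.runs := by
        cases A.units <;> rfl
      simpa [this] using h
    · have : transferTest.time = 4 := rfl
      omega
  | succ r ih =>
    obtain ⟨K, _ | ⟨u, D⟩⟩ := A
    · simp at hr
    have hx := h.frame_real 31 (by omega)
    have h₁ := h.symm.push ho.symm (e := reflectUnit o) (m := .const 1)
      (u := 0 - u - σ₀.real 31 0 - σ₀.real 31 0) (c := 1)
      (by simp [reflectUnit, hx, h.left.deque.1]) (by simp)
    have h₂ := h₁.symm.popUnit ho (u := u) (D := D) rfl
    have h₃ : SidesRep o o' β σ₀ ((transferBody o o').exec σ) ⟨K, D⟩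
        ⟨(0 - u - σ₀.real 31 0 - σ₀.real 31 0, 1) :: B.runs, B.units⟩ := by
      refine h₂.change_aux ho (fun a h35 h36 => ?_) ?_
      · simp [transferBody, h36]
      · simp [transferBody]
    have h36' : ((transferBody o o').exec σ).int 36 0 = r := by
      have e := int_pushProg o' (reflectUnit o) (.const 1) σ (a := 36)
        (by have := ho.right; omega) (by have := ho.right; omega)
      simp [transferBody, LCMM.popUnit, show 36 ≠ o + 3 by have := ho.left; omega, e, h36]
    obtain ⟨n, hn, hn'⟩ := run_exec (P := transferBody o o')
      (by simp [transferBody, pushProg, LCMM.popUnit, Program.LoopFree]) σ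
    obtain ⟨n', σ', h₄, h₅, h₆, h₇⟩ := ih h₃ (by simpa using hr) h36'
    refine ⟨_, σ', Run.loopStep ?_ hn h₄, ?_, ?_, ?_⟩
    · simp [transferTest, h36]
    · exact h₅
    · rw [h₆, int_transferBody ho σ (by norm_num) (by norm_num)]
    · have e₁ : transferTest.time = 4 := rfl
      have e₂ : (transferBody o o').maxTime = 42 := rfl
      omega

/-- The capacity of the current point, whose number is held by the integer variable `8`. -/
abbrev capExpr : IntExpr := .cell 31 (.var 8)

/-- The step that moves entries from the side at `o` to the side at `o'`. -/
def moveProg (o o' : ℕ) : Program :=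
  let q : IntExpr := .sub (.var (o + 3)) (.var (o + 2))
  .cond (.intLT (.var (o + 2)) (.var (o + 3)))
    (.seq
      (.seq (.cond (.intLE q capExpr) (.assign 36 q) (.assign 36 capExpr))
        (.seq (.assign 35 (.sub capExpr (.var 36))) (pushZeros o (.sub (.var 36) (.const 1)))))
      (.seq (.loop transferTest (transferBody o o')) (pushZeros o' (.var 35))))
    (.seq (pushUnit o' (reflectRun o)) (.seq (popRunProg o) (pushZeros o' (.sub capExpr (.const 1)))))

/-- Without single entries on the giving side, the work is bounded and one single entry is created.
Otherwise the loop makes `r` iterations and removes `r` single entries, whose potential pays for it.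
-/
theorem run_move (ho : Separate o o') (h : SidesRep o o' β σ₀ σ A B) {c : ℕ} (hc : 1 ≤ c)
    (hcap : σ₀.int 31 (σ₀.int 8 0) = c) :
    ∃ n σ', Run (moveProg o o') σ n σ' ∧
      SidesRep o o' β σ₀ σ' (moveSides β (σ₀.real 31 0) c A B).1
        (moveSides β (σ₀.real 31 0) c A B).2 ∧
      n + 100 * ((moveSides β (σ₀.real 31 0) c A B).1.units.length +
        (moveSides β (σ₀.real 31 0) c A B).2.units.length) ≤
        100 * (A.units.length + B.units.length) + 1000 := by
  have hcapE : ∀ {τ : State} {A B : Side}, SidesRep o o' β σ₀ τ A B → capExpr.eval τ = c := by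
    intro τ A B hτ
    simp [hτ.frame_int 31 (by omega) (by norm_num) (by norm_num),
      hτ.frame_int 8 (by omega) (by norm_num) (by norm_num), hcap]
  have hlen := h.left.deque.length
  by_cases hA : A.units = []
  · have e : moveSides β (σ₀.real 31 0) c A B = (⟨popRun A.runs, []⟩,
        ⟨pushRun (0 - σ₀.real 31 0) (c - 1) B.runs,
          (0 - topRun β A.runs - σ₀.real 31 0 - σ₀.real 31 0) :: B.units⟩) := if_pos hA
    rw [e]
    have hx := h.frame_real 31 (by omega)
    have h₁ := (h.symm.pushUnit ho.symm (e := reflectRun o)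
      (u := 0 - topRun β A.runs - σ₀.real 31 0 - σ₀.real 31 0)
      (by simp [reflectRun, hx, h.left.top_eq])).symm
    have h₂ := h₁.popRun ho
    have h₃ := h₂.symm.pushZeros ho.symm (m := .sub capExpr (.const 1)) (c := c - 1) (by
      rw [IntExpr.eval, hcapE h₂]; simp; omega)
    obtain ⟨n, hn, hn'⟩ := run_exec (P := .seq (pushUnit o' (reflectRun o)) (.seq (popRunProg o)
      (pushZeros o' (.sub capExpr (.const 1)))))
      (by simp [pushProg, LCMM.pushUnit, LCMM.pushZeros, popRunProg, Program.LoopFree]) σ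
    refine ⟨_, _, Run.condFalse ?_ hn, ?_, ?_⟩
    · simp [hlen, hA]
    · have := h₃.symm
      rw [hA] at this
      exact this
    · have e₁ : Program.maxTime (.seq (pushUnit o' (reflectRun o)) (.seq (popRunProg o)
        (pushZeros o' (.sub capExpr (.const 1))))) = 80 := rfl
      simp only [Test.time, IntExpr.time, List.length_nil, List.length_cons]
      omega
  · have hq : 1 ≤ A.units.length := List.length_pos_iff.2 hA
    obtain ⟨r, hr⟩ : ∃ r, r = min c A.units.length := ⟨_, rfl⟩
    have e : moveSides β (σ₀.real 31 0) c A B =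
        (⟨pushRun (0 - σ₀.real 31 0) (r - 1) A.runs, A.units.drop r⟩,
        ⟨pushRun (0 - σ₀.real 31 0) (c - r) (transfer (σ₀.real 31 0) r A.units B.runs),
          B.units⟩) := by rw [hr]; exact if_neg hA
    rw [e]
    have hcap' := hcapE h
    -- Variable 36 receives the number `r` of transfers and is counted down by the loop; variable 35
    -- therefore saves `c - r`, the number of zeros needed afterwards.
    have h36 : ∀ (b : Test), (b.Holds σ ↔ A.units.length ≤ c) →
        ∃ τ, SidesRep o o' β σ₀ τ A B ∧ τ.int 36 0 = r ∧ τ.int 35 0 = (c - r : ℕ) ∧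
        ((Program.cond b (.assign 36 (.sub (.var (o + 3)) (.var (o + 2))))
          (.assign 36 capExpr)).seq (.assign 35 (.sub capExpr (.var 36)))).exec σ = τ := by
      intro b hb
      have hcap₁ : ∀ v, capExpr.eval (σ.setInt 36 0 v) = c := by
        intro v
        simpa using hcap'
      refine ⟨_, h.change_aux ho (fun a h35 h36 => ?_) ?_, ?_, ?_, rfl⟩
      · simp only [Program.exec]
        split_ifs <;> simp [h35, h36]
      · simp only [Program.exec]
        split_ifs <;> simp
      · by_cases hle : A.units.length ≤ c
        · simp [Program.exec, if_pos (hb.2 hle), hlen]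
          omega
        · simp only [Program.exec, if_neg (mt hb.1 hle), hcap']
          simp
          omega
      · by_cases hle : A.units.length ≤ c
        · simp only [Program.exec, if_pos (hb.2 hle), IntExpr.eval.eq_4, IntExpr.eval.eq_1, hcap₁]
          simp [hlen]
          omega
        · simp only [Program.exec, if_neg (mt hb.1 hle), hcap', IntExpr.eval.eq_4,
            IntExpr.eval.eq_1, hcap₁]
          simp
          omega
    obtain ⟨τ, h₁, hτ36, hτ35, hτ⟩ := h36 (.intLE (.sub (.var (o + 3)) (.var (o + 2))) capExpr) (by
      rw [Test.Holds, hcap']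
      simp [hlen])
    have h₂ := h₁.pushZeros ho (m := .sub (.var 36) (.const 1)) (c := r - 1) (by
      simp [hτ36]; omega)
    obtain ⟨n₁, hn₁, hn₁'⟩ := run_exec (P := .seq (.cond (.intLE (.sub (.var (o + 3)) (.var (o + 2)))
        capExpr) (.assign 36 (.sub (.var (o + 3)) (.var (o + 2)))) (.assign 36 capExpr))
        (.seq (.assign 35 (.sub capExpr (.var 36))) (pushZeros o (.sub (.var 36) (.const 1)))))
      (by simp [pushProg, LCMM.pushZeros, Program.LoopFree]) σ
    have hexec : Program.exec (.seq (.cond (.intLE (.sub (.var (o + 3)) (.var (o + 2)))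
        capExpr) (.assign 36 (.sub (.var (o + 3)) (.var (o + 2)))) (.assign 36 capExpr))
        (.seq (.assign 35 (.sub capExpr (.var 36))) (LCMM.pushZeros o (.sub (.var 36) (.const 1))))) σ =
        (LCMM.pushZeros o (.sub (.var 36) (.const 1))).exec τ := by
      rw [← hτ]
      rfl
    rw [hexec] at hn₁
    have hz : ∀ a, 30 ≤ a → ((LCMM.pushZeros o (.sub (.var 36) (.const 1))).exec τ).int a = τ.int a :=
      fun a ha => int_pushZeros o _ _ (by have := ho.left; omega) (by have := ho.left; omega)
    obtain ⟨n₂, τ', hn₂, h₃, h35, hn₂'⟩ := run_transfer ho (r := r) h₂ (by simp only; omega)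
      (by rw [hz 36 (by norm_num), hτ36])
    have h₄ := h₃.symm.pushZeros ho.symm (m := .var 35) (c := c - r) (by
      rw [IntExpr.eval.eq_2, IntExpr.eval.eq_1, h35, hz 35 (by norm_num), hτ35])
    obtain ⟨n₃, hn₃, hn₃'⟩ := run_exec (P := LCMM.pushZeros o' (.var 35))
      (by simp [pushProg, LCMM.pushZeros, Program.LoopFree]) τ'
    refine ⟨_, _, Run.condTrue ?_ (hn₁.seq (hn₂.seq hn₃)), h₄.symm, ?_⟩
    · simp [hlen]; omega
    · have e₁ : Program.maxTime (.seq (.cond (.intLE (.sub (.var (o + 3)) (.var (o + 2)))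
        capExpr) (.assign 36 (.sub (.var (o + 3)) (.var (o + 2)))) (.assign 36 capExpr))
        (.seq (.assign 35 (.sub capExpr (.var 36))) (LCMM.pushZeros o (.sub (.var 36) (.const 1))))) = 62 := rfl
      have e₂ : (LCMM.pushZeros o' (.var 35)).maxTime = 28 := rfl
      simp only [Test.time, IntExpr.time, List.length_drop]
      omega

end

/-! ## The program for the minima of the value functions -/

/-- The number of points. -/
abbrev sizeExpr : IntExpr := .add (.cell 2 (.const 0)) (.cell 2 (.const 1))

def dpTest : Test := .intLT (.var 8) sizeExpr

/-- One step of the dynamic program. The integer variable `8` holds the number of the point; the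
minimum goes to integer array `32`. -/
def dpBody : Program :=
  .seq (.setReal 31 (.const 0) (.cell 30 (.var 8)))
    (.seq (.loop (lowerTest 10) (lowerBody 10))
      (.seq (.loop (lowerTest 20) (lowerBody 20))
        (.seq (.setInt 32 (.var 8) (.sub (.sub (.var 23) (.var 22)) (.sub (.var 13) (.var 12))))
          (.seq (.cond (.intLE (.const 1) (.cell 30 (.var 8))) (moveProg 10 20) (moveProg 20 10))
            (.assign 8 (.add (.var 8) (.const 1)))))))

theorem separate : Separate 10 20 := ⟨by norm_num, by norm_num, by norm_num⟩

/-- The dynamic program has treated the first `k` points. -/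
structure DpInv (β : ℝ) (n : ℕ) (X : ℕ → ℝ) (E : ℕ → Bool) (c : ℕ → ℕ) (σ₀ : State)
    (g : ℕ × Side × Side) (σ : State) : Prop where
  le : g.1 ≤ n
  index : σ.int 8 0 = g.1
  left : SideRep 10 β σ g.2.1
  right : SideRep 20 β σ g.2.2
  slopes : ∃ m : ℕ → ℤ, (∀ j < g.1, σ.int 32 j = m j) ∧ SlopeInv β X E c m g.1 g.2.1 g.2.2
  frame_int : ∀ a, a < 10 ∨ 30 ≤ a → a ≠ 8 → a ≠ 32 → a ≠ 35 → a ≠ 36 → σ.int a = σ₀.int a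
  frame_real : ∀ a, a < 10 ∨ 30 ≤ a → a ≠ 31 → σ.real a = σ₀.real a

theorem run_dpBody {β : ℝ} {n : ℕ} {X : ℕ → ℝ} {E : ℕ → Bool} {c : ℕ → ℕ} {σ₀ : State}
    (hX : Monotone X) (hβ : 0 ≤ β + X 0) (hn : σ₀.int 2 0 + σ₀.int 2 1 = n)
    (hc : ∀ k < n, 1 ≤ c k) (hX₀ : ∀ k < n, σ₀.real 30 k = X k)
    (hE₀ : ∀ k < n, σ₀.int 30 k = if E k then 1 else 0) (hc₀ : ∀ k < n, σ₀.int 31 k = c k)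
    {g : ℕ × Side × Side} {σ : State} (h : DpInv β n X E c σ₀ g σ) (hb : dpTest.Holds σ) :
    ∃ g' t σ', Run dpBody σ t σ' ∧ DpInv β n X E c σ₀ g' σ' ∧ g'.1 = g.1 + 1 ∧
      t + 100 * (g'.2.1.units.length + g'.2.2.units.length) ≤
        100 * (g.2.1.units.length + g.2.2.units.length) + 1200 := by
  obtain ⟨k, A, B⟩ := g
  obtain ⟨hle, hk, hA, hB, ⟨m, hm, hs⟩, hfi, hfr⟩ := h
  simp only at hle hk hA hB hm hs
  have h2 := hfi 2 (by norm_num) (by norm_num) (by norm_num) (by norm_num) (by norm_num)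
  have hkn : k < n := by
    simp [dpTest, h2, hk, hn] at hb
    omega
  have h30 := hfr 30 (by norm_num) (by norm_num)
  have r₁ := Run.setReal σ 31 (.const 0) (.cell 30 (.var 8))
  generalize hσ₁ : σ.setReal 31 _ _ = σ₁ at r₁
  have hx : σ₁.real 31 0 = X k := by
    rw [← hσ₁]
    simp [hk, h30, hX₀ k hkn]
  have hint₁ : σ₁.int = σ.int := by rw [← hσ₁]; rfl
  have hreal₁ : ∀ a, a ≠ 31 → σ₁.real a = σ.real a := fun a ha => by
    rw [← hσ₁]; simp [ha]
  have w₁ : SidesRep 10 20 β σ₁ σ₁ A B :=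
    ⟨hA.congr (fun a _ _ => by rw [hint₁]) (fun a _ ha => hreal₁ a (by omega)),
      hB.congr (fun a _ _ => by rw [hint₁]) (fun a _ ha => hreal₁ a (by omega)),
      fun _ _ _ _ => rfl, fun _ _ => rfl⟩
  -- The offset has just advanced to `X k`, so both sides must be brought back to normal form before
  -- the minimum can be read off.
  obtain ⟨A', n₂, σ₂, r₂, w₂, hs₂, hA', t₂⟩ := run_lower separate
    (P := fun A => SlopeInv β X E c m k A B)
    (fun A D u hA hD hu => hA.lower_left hD (by rwa [hx] at hu)) w₁ hs
  obtain ⟨B', n₃, σ₃, r₃, w₃, hs₃, hB', t₃⟩ := run_lower separate.symm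
    (P := fun B => SlopeInv β X E c m k A' B)
    (fun A D u hA hD hu => hA.lower_right hD (by rwa [hx] at hu)) w₂.symm hs₂
  rw [hx] at hA' hB'
  have hint₃ : ∀ a, a < 10 ∨ 30 ≤ a → a ≠ 35 → a ≠ 36 → σ₃.int a = σ.int a := fun a h₁ h₂ h₃ => by
    rw [w₃.frame_int a h₁ h₂ h₃, hint₁]
  have hreal₃ : ∀ a, a < 10 ∨ 30 ≤ a → σ₃.real a = σ₁.real a := w₃.frame_real
  have r₄ := Run.setInt σ₃ 32 (.var 8) (.sub (.sub (.var 23) (.var 22)) (.sub (.var 13) (.var 12)))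
  generalize hσ₄ : σ₃.setInt 32 _ _ = σ₄ at r₄
  -- The minimum is the difference of the two numbers of single entries, each being the difference
  -- of the deque's ends.
  have hmin : σ₄.int 32 = Function.update (σ.int 32) k (sideMin A' B') := by
    have e₁ : σ₃.int 23 0 = σ₃.int 22 0 + _ := w₃.left.deque.length
    have e₂ : σ₃.int 13 0 = σ₃.int 12 0 + _ := w₃.right.deque.length
    rw [← hσ₄]
    simp only [IntExpr.eval, State.int_setInt_self, hint₃ 8 (by norm_num) (by norm_num) (by norm_num),
      hk, hint₃ 32 (by norm_num) (by norm_num) (by norm_num), sideMin]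
    congr 1
    omega
  have hint₄ : ∀ a, a ≠ 32 → σ₄.int a = σ₃.int a := fun a ha => by
    rw [← hσ₄]; simp [ha]
  have hreal₄ : σ₄.real = σ₃.real := by rw [← hσ₄]; rfl
  have w₄ : SidesRep 10 20 β σ₄ σ₄ A' B' :=
    ⟨w₃.right.congr (fun a _ _ => hint₄ a (by omega)) (fun a _ _ => by rw [hreal₄]),
      w₃.left.congr (fun a _ _ => hint₄ a (by omega)) (fun a _ _ => by rw [hreal₄]),
      fun _ _ _ _ => rfl, fun _ _ => rfl⟩
  have h8₄ : σ₄.int 8 0 = k := by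
    rw [hint₄ 8 (by norm_num), hint₃ 8 (by norm_num) (by norm_num) (by norm_num), hk]
  have hcap : σ₄.int 31 (σ₄.int 8 0) = c k := by
    rw [h8₄, hint₄ 31 (by norm_num), hint₃ 31 (by norm_num) (by norm_num) (by norm_num),
      hfi 31 (by norm_num) (by norm_num) (by norm_num) (by norm_num) (by norm_num), hc₀ k hkn]
  have hkind : σ₄.int 30 (σ₄.int 8 0) = if E k then 1 else 0 := by
    rw [h8₄, hint₄ 30 (by norm_num), hint₃ 30 (by norm_num) (by norm_num) (by norm_num),
      hfi 30 (by norm_num) (by norm_num) (by norm_num) (by norm_num) (by norm_num), hE₀ k hkn]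
  have hx₄ : σ₄.real 31 0 = X k := by rw [hreal₄, hreal₃ 31 (by norm_num), hx]
  obtain ⟨n₅, σ₅, r₅, w₅, t₅⟩ : ∃ t σ', Run (.cond (.intLE (.const 1) (.cell 30 (.var 8)))
      (moveProg 10 20) (moveProg 20 10)) σ₄ t σ' ∧ SidesRep 10 20 β σ₄ σ'
      (stepSides β (X k) (E k) (c k) A' B').1 (stepSides β (X k) (E k) (c k) A' B').2 ∧
      t + 100 * ((stepSides β (X k) (E k) (c k) A' B').1.units.length +
        (stepSides β (X k) (E k) (c k) A' B').2.units.length) ≤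
        100 * (A'.units.length + B'.units.length) + 1010 := by
    have e : (Test.intLE (.const 1) (.cell 30 (.var 8))).time + 1 = 6 := rfl
    cases hE : E k
    · obtain ⟨t, σ', r, w, ht⟩ := run_move separate.symm w₄.symm (hc k hkn) hcap
      rw [hx₄] at w ht
      refine ⟨_, σ', Run.condFalse ?_ r, w.symm, ?_⟩
      · simp [hkind, hE]
      · simp only [stepSides, Bool.false_eq_true, if_false, Prod.fst_swap, Prod.snd_swap]
        omega
    · obtain ⟨t, σ', r, w, ht⟩ := run_move separate w₄ (hc k hkn) hcap
      rw [hx₄] at w ht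
      refine ⟨_, σ', Run.condTrue ?_ r, w, ?_⟩
      · simp [hkind, hE]
      · simp only [stepSides, if_true]
        omega
  have r₆ := Run.setInt σ₅ 8 (.const 0) (.add (.var 8) (.const 1))
  have h8₅ : σ₅.int 8 0 = k := by
    rw [w₅.frame_int 8 (by norm_num) (by norm_num) (by norm_num), h8₄]
  refine ⟨(k + 1, (stepSides β (X k) (E k) (c k) A' B').1, (stepSides β (X k) (E k) (c k) A' B').2),
    _, _, r₁.seq (r₂.seq (r₃.seq (r₄.seq (r₅.seq r₆)))),
    ⟨hkn, ?_, w₅.left.congr (fun a h₁ h₂ => ?_) (fun a _ _ => rfl),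
    w₅.right.congr (fun a h₁ h₂ => ?_) (fun a _ _ => rfl),
    ⟨Function.update m k (sideMin A' B'), ?_, hs₃.step hX hβ (hc k hkn) hA' hB'⟩, ?_, ?_⟩, rfl, ?_⟩
  · simp [h8₅]
  · simp [show a ≠ 8 by omega]
  · simp [show a ≠ 8 by omega]
  · intro j hj
    simp only [State.int_setInt_of_ne _ _ _ (show 32 ≠ 8 by norm_num),
      w₅.frame_int 32 (by norm_num) (by norm_num) (by norm_num), hmin, Function.update_apply,
      Nat.cast_inj]
    split_ifs with hjk
    · rfl
    · exact hm j (by simp only at hj; omega)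
  · intro a h₁ h₂ h₃ h₄ h₅
    rw [State.int_setInt_of_ne _ _ _ h₂, w₅.frame_int a h₁ h₄ h₅, hint₄ a h₃, hint₃ a h₁ h₄ h₅,
      hfi a h₁ h₂ h₃ h₄ h₅]
  · intro a h₁ h₂
    rw [State.real_setInt, w₅.frame_real a h₁, hreal₄, hreal₃ a h₁, hreal₁ a h₂, hfr a h₁ h₂]
  · simp only [RealExpr.time, IntExpr.time]
    omega

def initProg : Program :=
  let last : RealExpr := .cell 30 (.sub sizeExpr (.const 1))
  let first : RealExpr := .cell 30 (.const 0)
  let β : RealExpr := .sub (.sub (.sub (.add last last) first) first) first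
  .seq (.setReal 10 (.const 0) β) (.setReal 20 (.const 0) β)

/-- The program for the minima of all value functions. -/
def dpProg : Program := .seq initProg (.loop dpTest dpBody)

theorem run_dpProg {n : ℕ} (hn1 : 1 ≤ n) {X : ℕ → ℝ} {E : ℕ → Bool} {c : ℕ → ℕ} {σ₀ : State}
    (hX : Monotone X) (hn : σ₀.int 2 0 + σ₀.int 2 1 = n)
    (hc : ∀ k < n, 1 ≤ c k) (hX₀ : ∀ k < n, σ₀.real 30 k = X k)
    (hE₀ : ∀ k < n, σ₀.int 30 k = if E k then 1 else 0) (hc₀ : ∀ k < n, σ₀.int 31 k = c k)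
    (hzero : ∀ a, 8 ≤ a → a < 30 → σ₀.int a 0 = 0) :
    ∃ (m : ℕ → ℤ) (t : ℕ) (σ : State), Run dpProg σ₀ t σ ∧ t ≤ 2000 * (n + 1) ∧
      (∀ k < n, IsValley (pathValue (2 * (X (n - 1) - X 0)) X E (fun j => c j) m k) (m k)) ∧
      (∀ k < n, σ.int 32 k = m k) ∧ σ.int 8 0 = n ∧
      (∀ a, a < 10 ∨ 30 ≤ a → a ≠ 8 → a ≠ 32 → a ≠ 35 → a ≠ 36 → σ.int a = σ₀.int a) := by
  obtain ⟨n₁, r₁, t₁⟩ := run_exec (P := initProg) (by simp [initProg, Program.LoopFree]) σ₀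
  have e₁ : initProg.maxTime = 56 := rfl
  -- At the initial offset `X 0` this entry represents the slope `β + X 0`, which is twice the span.
  set β : ℝ := X (n - 1) + X (n - 1) - X 0 - X 0 - X 0 with hβdef
  have hβ : β + X 0 = 2 * (X (n - 1) - X 0) := by ring
  have hβ0 : 0 ≤ β + X 0 := by
    have := hX (Nat.zero_le (n - 1))
    linarith
  have hlast : σ₀.real 30 ((n : ℤ) - 1) = X (n - 1) := by
    rw [← hX₀ (n - 1) (by omega), Nat.cast_sub hn1, Nat.cast_one]
  have hfirst : σ₀.real 30 0 = X 0 := by simpa using hX₀ 0 (by omega)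
  obtain ⟨g, t, σ, r₂, hI, hb, t₂⟩ := run_loop (b := dpTest) (P := dpBody)
    (DpInv β n X E c σ₀)
    (fun g => 100 * (g.2.1.units.length + g.2.2.units.length) + 1300 * (n - g.1))
    (fun g σ hI hb => by
      obtain ⟨g', t, σ', h₁, h₂, h₃, h₄⟩ := run_dpBody hX hβ0 hn hc hX₀ hE₀ hc₀ hI hb
      refine ⟨g', t, σ', h₁, h₂, ?_⟩
      have e : dpTest.time = 10 := rfl
      have := h₂.le
      omega)
    (0, ⟨[], []⟩, ⟨[], []⟩) (initProg.exec σ₀)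
    ⟨Nat.zero_le _, by simpa [initProg] using hzero 8 (by norm_num) (by norm_num),
      ⟨by simpa [initProg, StackRep] using hzero 11 (by norm_num) (by norm_num),
        by simp [initProg, hn, hlast, hfirst, hβdef],
        by simp [initProg, DequeRep, hzero 12, hzero 13]⟩,
      ⟨by simpa [initProg, StackRep] using hzero 21 (by norm_num) (by norm_num),
        by simp [initProg, hn, hlast, hfirst, hβdef],
        by simp [initProg, DequeRep, hzero 22, hzero 23]⟩,
      ⟨fun _ => 0, by simp, slopeInv_zero hβ0 E c _⟩,
      fun a _ _ _ _ _ => by simp [initProg],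
      fun a h _ => by simp [initProg, show a ≠ 10 by omega, show a ≠ 20 by omega]⟩
  obtain ⟨k, A, B⟩ := g
  obtain ⟨hle, hk, -, -, ⟨m, hm, hs⟩, hfi, -⟩ := hI
  simp only at hle hk hm hs
  have h2 := hfi 2 (by norm_num) (by norm_num) (by norm_num) (by norm_num) (by norm_num)
  obtain rfl : k = n := by
    simp [dpTest, h2, hk, hn] at hb
    omega
  refine ⟨m, _, σ, r₁.seq r₂, ?_, ?_, hm, hk, hfi⟩
  · have e : dpTest.time = 10 := rfl
    simp only [List.length_nil] at t₂
    omega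
  · rw [← hβ]
    exact hs.valley

/-! ## The program for the path -/

/-- The path that goes back from `0` along the minima `m`, in reverse order. -/
def backPath (n : ℕ) (E : ℕ → Bool) (c : ℕ → ℕ) (m : ℕ → ℤ) : ℕ → ℤ
  | 0 => 0
  | l + 1 => clampStep (E (n - 1 - l)) (c (n - 1 - l)) (m (n - 1 - l)) (backPath n E c m l)

/-- Going back by one step: the integer variables `8` and `9` hold the number of the point and the
value of the path, and `6` and `7` the numbers of the preceding points of `S` and `T`. The sums of
the degrees of the points of `S` and `T` from a given point on go to integer arrays `33` and `34`. -/
def backBody : Program :=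
  let min : IntExpr := .cell 32 (.var 8)
  let h : IntExpr := .var 9
  let clamp (hi lo : IntExpr) : Program :=
    .seq (.assign 35 hi)
      (.seq (.cond (.intLE min (.var 35)) (.assign 35 min) .skip)
        (.seq (.cond (.intLE (.var 35) lo) (.assign 35 lo) .skip) (.assign 9 (.var 35))))
  .seq (.assign 8 (.sub (.var 8) (.const 1)))
    (.cond (.intLE (.const 1) (.cell 30 (.var 8)))
      (.seq (clamp (.sub h (.const 1)) (.sub h capExpr))
        (.seq (.assign 6 (.sub (.var 6) (.const 1)))
          (.setInt 33 (.var 6) (.sub (.cell 34 (.var 7)) h))))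
      (.seq (clamp (.add h capExpr) (.add h (.const 1)))
        (.seq (.assign 7 (.sub (.var 7) (.const 1)))
          (.setInt 34 (.var 7) (.add (.cell 33 (.var 6)) h)))))

def backTest : Test := .intLE (.const 1) (.var 8)

/-- The hypotheses range over all `v` because `min` and `lo` are evaluated after the scratch
variable 35 has been overwritten. -/
theorem exec_clamp (σ : State) (min hi lo : IntExpr) (p q r : ℤ)
    (hmin : ∀ v, min.eval (σ.setInt 35 0 v) = p) (hhi : hi.eval σ = q)
    (hlo : ∀ v, lo.eval (σ.setInt 35 0 v) = r) :
    Program.exec (.seq (.assign 35 hi)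
      (.seq (.cond (.intLE min (.var 35)) (.assign 35 min) .skip)
        (.seq (.cond (.intLE (.var 35) lo) (.assign 35 lo) .skip) (.assign 9 (.var 35))))) σ =
      (σ.setInt 35 0 (max r (Min.min p q))).setInt 9 0 (max r (Min.min p q)) := by
  have hset : ∀ v w, (σ.setInt 35 0 v).setInt 35 0 w = σ.setInt 35 0 w := by
    intro v w
    simp [State.setInt]
  have h₁ : Program.exec (.seq (.assign 35 hi)
      (.cond (.intLE min (.var 35)) (.assign 35 min) .skip)) σ = σ.setInt 35 0 (Min.min p q) := by
    simp only [Program.exec, Test.Holds, IntExpr.eval, hhi, hmin, State.int_setInt_self,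
      Function.update_self, hset]
    split_ifs with h
    · rw [min_eq_left h]
    · rw [min_eq_right (by omega)]
  have h₂ : Program.exec (.cond (.intLE (.var 35) lo) (.assign 35 lo) .skip)
      (σ.setInt 35 0 (Min.min p q)) = σ.setInt 35 0 (max r (Min.min p q)) := by
    simp only [Program.exec, Test.Holds, IntExpr.eval, hlo, State.int_setInt_self,
      Function.update_self, hset]
    split_ifs with h
    · rw [max_eq_left h]
    · rw [max_eq_right (by omega)]
  have h₃ : ∀ P Q R S : Program, Program.exec (.seq P (.seq Q (.seq R S))) σ =
      S.exec (R.exec ((Program.seq P Q).exec σ)) := fun _ _ _ _ => rfl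
  rw [h₃, h₁, h₂]
  simp

/-- The path has been computed back to the `l`-th point from the end. -/
structure BackInv (n : ℕ) (a b : ℕ → ℕ) (h : ℕ → ℤ) (σ₀ : State) (l : ℕ) (σ : State) : Prop where
  le : l ≤ n
  index : σ.int 8 0 = (n - l : ℕ)
  value : σ.int 9 0 = h (n - l)
  i_eq : σ.int 6 0 = a (n - l)
  j_eq : σ.int 7 0 = b (n - l)
  sums : ∀ k, n - l ≤ k → k ≤ n → σ.int 34 (b k) - σ.int 33 (a k) = h k
  end_left : σ.int 33 (a n) = 0
  end_right : σ.int 34 (b n) = 0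
  frame_int : ∀ e, e ≠ 6 → e ≠ 7 → e ≠ 8 → e ≠ 9 → e ≠ 33 → e ≠ 34 → e ≠ 35 → σ.int e = σ₀.int e

/-- Only one of `a`, `b` drops between `k + 1` and `k`, so one new cell is determined by requiring
that the difference of the two suffix sums be `h k`. -/
theorem backInv_step {n : ℕ} {E : ℕ → Bool} {c : ℕ → ℕ} {m : ℕ → ℤ} {a b : ℕ → ℕ} {h : ℕ → ℤ}
    {σ₀ : State} (hE₀ : ∀ k < n, σ₀.int 30 k = if E k then 1 else 0)
    (hc₀ : ∀ k < n, σ₀.int 31 k = c k) (hm₀ : ∀ k < n, σ₀.int 32 k = m k)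
    (ha : ∀ k, a (k + 1) = if E k then a k + 1 else a k)
    (hb : ∀ k, b (k + 1) = if E k then b k else b k + 1)
    (hh : ∀ k < n, h k = clampStep (E k) (c k) (m k) (h (k + 1)))
    {l : ℕ} {σ : State} (hI : BackInv n a b h σ₀ l σ) (hT : backTest.Holds σ) :
    BackInv n a b h σ₀ (l + 1) (backBody.exec σ) := by
  obtain ⟨hle, h8, h9, h6, h7, hsum, h33, h34, hf⟩ := hI
  have hl : l < n := by
    simp [backTest, h8] at hT
    omega
  obtain ⟨k, hk⟩ : ∃ k, k = n - (l + 1) := ⟨_, rfl⟩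
  have hkl : n - l = k + 1 := by omega
  have hkn : k < n := by omega
  rw [hkl] at h8 h9 h6 h7 hsum
  have hmono_a : Monotone a := monotone_nat_of_le_succ fun k => by rw [ha]; split_ifs <;> omega
  have hmono_b : Monotone b := monotone_nat_of_le_succ fun k => by rw [hb]; split_ifs <;> omega
  have h30 := hf 30 (by decide) (by decide) (by decide) (by decide) (by decide) (by decide) (by decide)
  have h31 := hf 31 (by decide) (by decide) (by decide) (by decide) (by decide) (by decide) (by decide)
  have h32 := hf 32 (by decide) (by decide) (by decide) (by decide) (by decide) (by decide) (by decide)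
  have hhk := hh k hkn
  have hak := ha k
  have hbk := hb k
  have hEk := hE₀ k hkn
  have hck := hc₀ k hkn
  have hmk := hm₀ k hkn
  have h8' : σ.int 8 0 - 1 = k := by rw [h8]; push_cast; ring
  have hsum' := hsum (k + 1) le_rfl hkn
  have e₁ : ∀ P Q R S T : Program, ∀ t, Program.exec (.seq P (.cond t (.seq Q R) (.seq S T))) σ =
      Program.exec (.cond t (.seq Q R) (.seq S T)) (P.exec σ) := fun _ _ _ _ _ _ => rfl
  have e₂ : ∀ P Q : Program, ∀ τ, Program.exec (.seq P Q) τ = Q.exec (P.exec τ) := fun _ _ _ => rfl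
  have e₃ : ∀ τ, Program.exec (.assign 8 (.sub (.var 8) (.const 1))) τ =
      τ.setInt 8 0 (τ.int 8 0 - 1) := fun _ => rfl
  have hlast_a := hmono_a (show k + 1 ≤ n from hkn)
  have hlast_b := hmono_b (show k + 1 ≤ n from hkn)
  cases hE : E k
  · simp only [hE, Bool.false_eq_true, if_false] at hEk hak hbk
    rw [hE] at hhk
    simp only [clampStep, Bool.false_eq_true, if_false] at hhk
    have hexec : backBody.exec σ = (((((σ.setInt 8 0 k).setInt 35 0 (h k)).setInt 9 0 (h k)).setInt 7 0
        (b k)).setInt 34 (b k) (σ.int 33 (a k) + h k)) := by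
      rw [backBody, e₁, e₃, h8', Program.exec, if_neg (by simp [h30, hEk]), e₂,
        exec_clamp (p := m k) (q := h (k + 1) + c k) (r := h (k + 1) + 1)]
      · rw [← hhk]
        simp [h7, hbk, h6, hak]
      · intro v
        simp [h32, hmk]
      · simp [h31, hck, h9]
      · intro v
        simp [h9]
    rw [hexec]
    refine ⟨hl, ?_, ?_, ?_, ?_, ?_, ?_, ?_, ?_⟩
    · simp [← hk]
    · simp [← hk]
    · simp [← hk, h6, hak]
    · simp [← hk]
    · intro k' h₁ h₂
      rw [← hk] at h₁
      rcases h₁.eq_or_lt with rfl | h₁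
      · simp
      -- Later positions use addresses beyond `b k`, so the new entry overwrites none of theirs.
      · have := hmono_b (show k + 1 ≤ k' from h₁)
        have := hsum k' h₁ h₂
        simpa [Function.update_apply, show b k' ≠ b k by omega] using this
    · simpa using h33
    · simpa [Function.update_apply, show b n ≠ b k by omega] using h34
    · intro e f₁ f₂ f₃ f₄ f₅ f₆ f₇
      simp [f₁, f₂, f₃, f₄, f₅, f₆, f₇, hf]
  · simp only [hE, if_true] at hEk hak hbk
    rw [hE] at hhk
    simp only [clampStep, if_true] at hhk
    have hexec : backBody.exec σ = (((((σ.setInt 8 0 k).setInt 35 0 (h k)).setInt 9 0 (h k)).setInt 6 0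
        (a k)).setInt 33 (a k) (σ.int 34 (b k) - h k)) := by
      rw [backBody, e₁, e₃, h8', Program.exec, if_pos (by simp [h30, hEk]), e₂,
        exec_clamp (p := m k) (q := h (k + 1) - 1) (r := h (k + 1) - c k)]
      · rw [← hhk]
        simp [h7, hbk, h6, hak]
      · intro v
        simp [h32, hmk]
      · simp [h9]
      · intro v
        simp [h31, hck, h9]
    rw [hexec]
    refine ⟨hl, ?_, ?_, ?_, ?_, ?_, ?_, ?_, ?_⟩
    · simp [← hk]
    · simp [← hk]
    · simp [← hk]
    · simp [← hk, h7, hbk]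
    · intro k' h₁ h₂
      rw [← hk] at h₁
      rcases h₁.eq_or_lt with rfl | h₁
      · simp
      · have := hmono_a (show k + 1 ≤ k' from h₁)
        have := hsum k' h₁ h₂
        simpa [Function.update_apply, show a k' ≠ a k by omega] using this
    · simpa [Function.update_apply, show a n ≠ a k by omega] using h33
    · simpa using h34
    · intro e f₁ f₂ f₃ f₄ f₅ f₆ f₇
      simp [f₁, f₂, f₃, f₄, f₅, f₆, f₇, hf]

theorem run_back {n : ℕ} {E : ℕ → Bool} {c : ℕ → ℕ} {m : ℕ → ℤ} {a b : ℕ → ℕ} {h : ℕ → ℤ}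
    {σ₀ : State} (hE₀ : ∀ k < n, σ₀.int 30 k = if E k then 1 else 0)
    (hc₀ : ∀ k < n, σ₀.int 31 k = c k) (hm₀ : ∀ k < n, σ₀.int 32 k = m k)
    (ha : ∀ k, a (k + 1) = if E k then a k + 1 else a k)
    (hb : ∀ k, b (k + 1) = if E k then b k else b k + 1)
    (hh : ∀ k < n, h k = clampStep (E k) (c k) (m k) (h (k + 1))) (hhn : h n = 0)
    (h6 : σ₀.int 6 0 = a n) (h7 : σ₀.int 7 0 = b n) (h8 : σ₀.int 8 0 = n) (h9 : σ₀.int 9 0 = 0)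
    (h33 : σ₀.int 33 = fun _ => 0) (h34 : σ₀.int 34 = fun _ => 0) :
    ∃ t σ, Run (.loop backTest backBody) σ₀ t σ ∧ BackInv n a b h σ₀ n σ ∧
      t ≤ (backBody.maxTime + backTest.time + 1) * (n + 1) := by
  obtain ⟨l, t, σ, h₁, h₂, h₃, h₄⟩ := run_loop_count (b := backTest) (P := backBody)
    (by simp [backBody, Program.LoopFree]) n (BackInv n a b h σ₀) (fun _ _ hI => hI.le)
    (fun l σ hI hT => backInv_step hE₀ hc₀ hm₀ ha hb hh hI hT) (σ := σ₀)
    ⟨Nat.zero_le _, h8, by simp [h9, hhn], h6, h7,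
      fun k h₁ h₂ => by
        obtain rfl : k = n := by omega
        simp [h33, h34, hhn],
      by simp [h33], by simp [h34], fun _ _ _ _ _ _ _ _ => rfl⟩
  refine ⟨t, σ, h₁, ?_, h₄⟩
  suffices hl : l = n by rwa [hl] at h₂
  have := h₂.le
  have h8 := h₂.index
  simp [backTest, h8] at h₃
  omega

theorem backPath_eq {n : ℕ} (E : ℕ → Bool) (c : ℕ → ℕ) (m : ℕ → ℤ) {k : ℕ} (hk : k < n) :
    backPath n E c m (n - k) = clampStep (E k) (c k) (m k) (backPath n E c m (n - (k + 1))) := by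
  rw [show n - k = n - (k + 1) + 1 by omega, backPath, show n - 1 - (n - (k + 1)) = k by omega]

/-! ## The program for the list of pairs -/

def pairTest : Test := .intLT (.var 6) (.cell 2 (.const 0))

/-- Output the pair of the indices in the integer variables `6` and `7`, and go on to the next
pair of overlapping intervals. -/
def pairBody : Program :=
  let i : IntExpr := .var 6
  let j : IntExpr := .var 7
  let p : IntExpr := .cell 33 (.add i (.const 1))
  let r : IntExpr := .cell 34 (.add j (.const 1))
  .seq (.seq (.setInt 4 (.var 3) i) (.seq (.setInt 5 (.var 3) j) (.assign 3 (.add (.var 3) (.const 1)))))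
    (.cond (.intLE r p)
      (.cond (.intLE p r)
        (.seq (.assign 6 (.add i (.const 1))) (.assign 7 (.add j (.const 1))))
        (.assign 6 (.add i (.const 1))))
      (.assign 7 (.add j (.const 1))))

/-- The pairs with a first index below `i` or a second index below `j` have been listed. -/
structure PairInv {y z : ℕ} (P R : ℕ → ℤ) (σ₀ : State) (g : ℕ × ℕ × List (Fin y × Fin z))
    (σ : State) : Prop where
  i_le : g.1 ≤ y
  j_le : g.2.1 ≤ z
  end_iff : g.1 < y ↔ g.2.1 < z
  overlap : g.1 < y → P (g.1 + 1) < R g.2.1 ∧ R (g.2.1 + 1) < P g.1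
  nodup : g.2.2.Nodup
  mem : ∀ p, p ∈ g.2.2 ↔ p ∈ overlapPairs y z P R ∧ ((p.1 : ℕ) < g.1 ∨ (p.2 : ℕ) < g.2.1)
  i_eq : σ.int 6 0 = g.1
  j_eq : σ.int 7 0 = g.2.1
  length : σ.int 3 0 = g.2.2.length
  list : ∀ (k : ℕ) (hk : k < g.2.2.length),
    σ.int 4 k = ((g.2.2[k].1 : ℕ) : ℤ) ∧ σ.int 5 k = ((g.2.2[k].2 : ℕ) : ℤ)
  frame_int : ∀ e, e ≠ 3 → e ≠ 4 → e ≠ 5 → e ≠ 6 → e ≠ 7 → σ.int e = σ₀.int e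

/-- A sweep downwards through both subdivisions: the interval whose lower end is reached first is
left behind, or both if the ends coincide. The next two current intervals overlap again, and `i + j`
has grown. -/
theorem pairInv_step {y z : ℕ} {P R : ℕ → ℤ} {σ₀ : State} (hP : ∀ i < y, P (i + 1) < P i)
    (hR : ∀ j < z, R (j + 1) < R j) (hPy : P y = 0) (hRz : R z = 0) (hy : σ₀.int 2 0 = y)
    (h33 : ∀ i : ℕ, σ₀.int 33 i = P i) (h34 : ∀ j : ℕ, σ₀.int 34 j = R j)
    {g : ℕ × ℕ × List (Fin y × Fin z)} {σ : State} (h : PairInv P R σ₀ g σ)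
    (hb : pairTest.Holds σ) :
    ∃ g' : ℕ × ℕ × List (Fin y × Fin z), PairInv P R σ₀ g' (pairBody.exec σ) ∧ g.1 + g.2.1 + 1 ≤ g'.1 + g'.2.1 := by
  obtain ⟨i, j, L⟩ := g
  obtain ⟨hi, hj, hend, hov, hnd, hmem, h6, h7, h3, hL, hf⟩ := h
  simp only at hi hj hend hov hnd hmem h6 h7 h3 hL
  have hf2 := hf 2 (by decide) (by decide) (by decide) (by decide) (by decide)
  have hf33 := hf 33 (by decide) (by decide) (by decide) (by decide) (by decide)
  have hf34 := hf 34 (by decide) (by decide) (by decide) (by decide) (by decide)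
  have hiy : i < y := by
    simp [pairTest, hf2, h6, hy] at hb
    omega
  have hjz := hend.1 hiy
  obtain ⟨hov₁, hov₂⟩ := hov hiy
  have hPanti : ∀ i j, i ≤ j → j ≤ y → P j ≤ P i := by
    intro i j hij hj
    induction j, hij using Nat.le_induction with
    | base => exact le_rfl
    | succ j hij ih => exact (hP j hj).le.trans (ih (by omega))
  have hRanti : ∀ i j, i ≤ j → j ≤ z → R j ≤ R i := by
    intro i j hij hj
    induction j, hij using Nat.le_induction with
    | base => exact le_rfl
    | succ j hij ih => exact (hR j hj).le.trans (ih (by omega))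
  -- Both subdivisions end at 0, so positivity of an endpoint tells whether intervals remain; this
  -- makes the two lists run out simultaneously.
  have hP0 : ∀ i, i ≤ y → (0 < P i ↔ i < y) := by
    intro i hi
    refine ⟨fun h => ?_, fun h => ?_⟩
    · by_contra h'
      rw [show i = y by omega, hPy] at h
      exact lt_irrefl _ h
    · have h₁ := hP i h
      have h₂ := hPanti (i + 1) y h le_rfl
      omega
  have hR0 : ∀ j, j ≤ z → (0 < R j ↔ j < z) := by
    intro j hj
    refine ⟨fun h => ?_, fun h => ?_⟩
    · by_contra h'
      rw [show j = z by omega, hRz] at h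
      exact lt_irrefl _ h
    · have h₁ := hR j h
      have h₂ := hRanti (j + 1) z h le_rfl
      omega
  have hPi1 := hP0 (i + 1) hiy
  have hRj1 := hR0 (j + 1) hjz
  have hPnn := hPanti (i + 1) y hiy le_rfl
  have hRnn := hRanti (j + 1) z hjz le_rfl
  rw [hPy] at hPnn
  rw [hRz] at hRnn
  have hPi2 := hP (i + 1)
  have hRj2 := hR (j + 1)
  set p₀ : Fin y × Fin z := (⟨i, hiy⟩, ⟨j, hjz⟩) with hp₀
  have hp₀M : p₀ ∈ overlapPairs y z P R := by simp [overlapPairs, hp₀, hov₁, hov₂]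
  have hp₀L : p₀ ∉ L := fun h => by
    have := ((hmem _).1 h).2
    simp [hp₀] at this
  have hnd' : (L ++ [p₀]).Nodup := by
    rw [List.nodup_append]
    refine ⟨hnd, by simp, fun p hp q hq hpq => ?_⟩
    rw [List.mem_singleton.1 hq] at hpq
    exact hp₀L (hpq ▸ hp)
  have heq : ∀ p : Fin y × Fin z, p = p₀ ↔ (p.1 : ℕ) = i ∧ (p.2 : ℕ) = j := by
    intro p
    rw [hp₀, Prod.ext_iff, Fin.ext_iff, Fin.ext_iff]
  have hover : ∀ p : Fin y × Fin z, p ∈ overlapPairs y z P R ↔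
      P (p.1 + 1) < R p.2 ∧ R (p.2 + 1) < P p.1 := by
    intro p
    simp [overlapPairs]
  obtain ⟨τ, hτ⟩ : ∃ τ, τ = Program.exec (.seq (.setInt 4 (.var 3) (.var 6))
    (.seq (.setInt 5 (.var 3) (.var 7)) (.assign 3 (.add (.var 3) (.const 1))))) σ := ⟨_, rfl⟩
  have hτe : ∀ e, e ≠ 3 → e ≠ 4 → e ≠ 5 → τ.int e = σ.int e := by
    intro e h₃ h₄ h₅
    rw [hτ]
    simp [h₃, h₄, h₅]
  have hτ3 : τ.int 3 0 = (L ++ [p₀]).length := by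
    rw [hτ]
    simp [h3]
  have hτL : ∀ (k : ℕ) (hk : k < (L ++ [p₀]).length), τ.int 4 k = (((L ++ [p₀])[k].1 : ℕ) : ℤ) ∧
      τ.int 5 k = (((L ++ [p₀])[k].2 : ℕ) : ℤ) := by
    intro k hk
    simp only [List.length_append, List.length_singleton] at hk
    rw [hτ]
    rcases (Nat.lt_succ_iff.1 hk).lt_or_eq with hk | rfl
    · rw [List.getElem_append_left hk]
      simpa [h3, Function.update_apply, hk.ne] using hL k hk
    · simp [h3, h6, h7, hp₀]
  have h6τ : τ.int 6 0 = i := by rw [hτe 6 (by decide) (by decide) (by decide), h6]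
  have h7τ : τ.int 7 0 = j := by rw [hτe 7 (by decide) (by decide) (by decide), h7]
  have h33τ : τ.int 33 (i + 1) = P (i + 1) := by
    rw [hτe 33 (by decide) (by decide) (by decide), hf33]
    exact_mod_cast h33 (i + 1)
  have h34τ : τ.int 34 (j + 1) = R (j + 1) := by
    rw [hτe 34 (by decide) (by decide) (by decide), hf34]
    exact_mod_cast h34 (j + 1)
  have hfτ : ∀ e, e ≠ 3 → e ≠ 4 → e ≠ 5 → e ≠ 6 → e ≠ 7 → τ.int e = σ₀.int e :=
    fun e h₃ h₄ h₅ h₆ h₇ => by rw [hτe e h₃ h₄ h₅, hf e h₃ h₄ h₅ h₆ h₇]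
  have hexec : pairBody.exec σ = Program.exec (.cond
      (.intLE (.cell 34 (.add (.var 7) (.const 1))) (.cell 33 (.add (.var 6) (.const 1))))
      (.cond (.intLE (.cell 33 (.add (.var 6) (.const 1))) (.cell 34 (.add (.var 7) (.const 1))))
        (.seq (.assign 6 (.add (.var 6) (.const 1))) (.assign 7 (.add (.var 7) (.const 1))))
        (.assign 6 (.add (.var 6) (.const 1))))
      (.assign 7 (.add (.var 7) (.const 1)))) τ := by
    rw [hτ]
    rfl
  have hT₁ : (Test.intLE (.cell 34 (.add (.var 7) (.const 1)))
      (.cell 33 (.add (.var 6) (.const 1)))).Holds τ ↔ R (j + 1) ≤ P (i + 1) := by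
    simp only [Test.Holds, IntExpr.eval, h6τ, h7τ, h33τ, h34τ]
  have hT₂ : (Test.intLE (.cell 33 (.add (.var 6) (.const 1)))
      (.cell 34 (.add (.var 7) (.const 1)))).Holds τ ↔ P (i + 1) ≤ R (j + 1) := by
    simp only [Test.Holds, IntExpr.eval, h6τ, h7τ, h33τ, h34τ]
  -- The next intervals of `R` lie below the `i`-th interval of `P`, so advancing `i` skips no pair.
  have hrow : R (j + 1) ≤ P (i + 1) → ∀ p ∈ overlapPairs y z P R, (p.1 : ℕ) = i → (p.2 : ℕ) ≤ j := by
    intro h p hp hpi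
    by_contra! hpj
    have h₁ := ((hover p).1 hp).1
    have h₂ := hRanti (j + 1) p.2 hpj p.2.2.le
    rw [hpi] at h₁
    omega
  have hcol : P (i + 1) ≤ R (j + 1) → ∀ p ∈ overlapPairs y z P R, (p.2 : ℕ) = j → (p.1 : ℕ) ≤ i := by
    intro h p hp hpj
    by_contra! hpi
    have h₁ := ((hover p).1 hp).2
    have h₂ := hPanti (i + 1) p.1 hpi p.1.2.le
    rw [hpj] at h₁
    omega
  have hmem' : ∀ i' j', (∀ p ∈ overlapPairs y z P R,
      (((p.1 : ℕ) < i ∨ (p.2 : ℕ) < j) ∨ ((p.1 : ℕ) = i ∧ (p.2 : ℕ) = j) ↔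
        (p.1 : ℕ) < i' ∨ (p.2 : ℕ) < j')) → ∀ p, p ∈ L ++ [p₀] ↔
      p ∈ overlapPairs y z P R ∧ ((p.1 : ℕ) < i' ∨ (p.2 : ℕ) < j') := by
    intro i' j' h p
    rw [List.mem_append, List.mem_singleton, hmem]
    constructor
    · rintro (⟨h₁, h₂⟩ | h₁)
      · exact ⟨h₁, (h p h₁).1 (Or.inl h₂)⟩
      · exact ⟨h₁ ▸ hp₀M, (h p (h₁ ▸ hp₀M)).1 (Or.inr ((heq p).1 h₁))⟩
    · rintro ⟨h₁, h₂⟩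
      rcases (h p h₁).2 h₂ with h₃ | h₃
      · exact Or.inl ⟨h₁, h₃⟩
      · exact Or.inr ((heq p).2 h₃)
  rw [hexec]
  by_cases hc₁ : R (j + 1) ≤ P (i + 1)
  · by_cases hc₂ : P (i + 1) ≤ R (j + 1)
    · refine ⟨(i + 1, j + 1, L ++ [p₀]), ?_, by simp only; omega⟩
      simp only [Program.exec, if_pos (hT₁.2 hc₁), if_pos (hT₂.2 hc₂)]
      refine ⟨hiy, hjz, by simp only; omega, by simp only; omega, hnd', hmem' (i + 1) (j + 1) ?_, ?_, ?_, ?_, ?_,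
        ?_⟩
      · intro p hp
        have h₁ := hrow hc₁ p hp
        have h₂ := hcol hc₂ p hp
        omega
      · simp [h6τ]
      · simp [h7τ]
      · simpa using hτ3
      · simpa using hτL
      · intro e h₃ h₄ h₅ h₆ h₇
        simp [h₆, h₇, hfτ e h₃ h₄ h₅ h₆ h₇]
    · refine ⟨(i + 1, j, L ++ [p₀]), ?_, by simp only; omega⟩
      simp only [Program.exec, if_pos (hT₁.2 hc₁), if_neg (mt hT₂.1 hc₂)]
      refine ⟨hiy, hjz.le, by simp only; omega, by simp only; omega, hnd', hmem' (i + 1) j ?_, ?_, ?_, ?_,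
        ?_, ?_⟩
      · intro p hp
        have h₁ := hrow hc₁ p hp
        omega
      · simp [h6τ]
      · simp [h7τ]
      · simpa using hτ3
      · simpa using hτL
      · intro e h₃ h₄ h₅ h₆ h₇
        simp [h₆, hfτ e h₃ h₄ h₅ h₆ h₇]
  · refine ⟨(i, j + 1, L ++ [p₀]), ?_, by simp only; omega⟩
    simp only [Program.exec, if_neg (mt hT₁.1 hc₁)]
    refine ⟨hiy.le, hjz, by simp only; omega, by simp only; omega, hnd', hmem' i (j + 1) ?_, ?_, ?_, ?_, ?_,
      ?_⟩
    · intro p hp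
      have h₂ := hcol (by omega) p hp
      omega
    · simp [h6τ]
    · simp [h7τ]
    · simpa using hτ3
    · simpa using hτL
    · intro e h₃ h₄ h₅ h₆ h₇
      simp [h₇, hfτ e h₃ h₄ h₅ h₆ h₇]

theorem run_pairs {y z : ℕ} (hyz : 0 < y ↔ 0 < z) {P R : ℕ → ℤ} {σ₀ : State}
    (hP : ∀ i < y, P (i + 1) < P i) (hR : ∀ j < z, R (j + 1) < R j) (hPy : P y = 0) (hRz : R z = 0)
    (hPR : P 0 = R 0) (hy : σ₀.int 2 0 = y) (h33 : ∀ i : ℕ, σ₀.int 33 i = P i)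
    (h34 : ∀ j : ℕ, σ₀.int 34 j = R j) (h3 : σ₀.int 3 0 = 0) (h6 : σ₀.int 6 0 = 0)
    (h7 : σ₀.int 7 0 = 0) :
    ∃ t σ, Run (.loop pairTest pairBody) σ₀ t σ ∧ Outputs σ (overlapPairs y z P R) ∧
      t ≤ (pairBody.maxTime + pairTest.time + 1) * (y + z + 1) := by
  obtain ⟨k, t, σ, h₁, ⟨⟨i, j, L⟩, hI, -⟩, h₃, h₄⟩ := run_loop_count (b := pairTest) (P := pairBody)
    (by simp [pairBody, Program.LoopFree]) (y + z)
    (fun k σ => ∃ g : ℕ × ℕ × List (Fin y × Fin z), PairInv P R σ₀ g σ ∧ k ≤ g.1 + g.2.1)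
    (fun k σ ⟨g, hg, hk⟩ => by have := hg.i_le; have := hg.j_le; omega)
    (fun k σ ⟨g, hg, hk⟩ hb => by
      obtain ⟨g', hg', hk'⟩ := pairInv_step hP hR hPy hRz hy h33 h34 hg hb
      exact ⟨g', hg', by omega⟩) (σ := σ₀)
    ⟨(0, 0, []), ⟨Nat.zero_le _, Nat.zero_le _, hyz,
      fun h => ⟨by have := hP 0 h; simp only; omega, by have := hR 0 (hyz.1 h); simp only; omega⟩,
      List.nodup_nil, by simp, h6, h7, by simpa using h3, by simp, fun _ _ _ _ _ _ => rfl⟩,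
      Nat.zero_le _⟩
  refine ⟨t, σ, h₁, ⟨L, hI.nodup, ?_, hI.length, hI.list⟩, h₄⟩
  have h2 := hI.frame_int 2 (by decide) (by decide) (by decide) (by decide) (by decide)
  have hi : ¬ i < y := by
    simp [pairTest, hI.i_eq, h2, hy] at h₃
    omega
  ext p
  rw [List.mem_toFinset, hI.mem]
  have := p.1.2
  exact ⟨fun h => h.1, fun h => ⟨h, Or.inl (by simp only; omega)⟩⟩

/-! ## The whole program -/

/-- The program that computes a limited-capacity matching of minimum cost. -/
def matchingProg : Program :=
  .cond (.and (.intLE (.cell 2 (.const 0)) (.const 1)) (.intLE (.cell 2 (.const 1)) (.const 1)))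
    (.assign 3 (.cell 2 (.const 0)))
    (.seq (.loop mergeTest mergeBody)
      (.seq dpProg (.seq (.loop backTest backBody) (.loop pairTest pairBody))))

theorem arrayOf_natCast {α : Type} [Zero α] {n : ℕ} (f : Fin n → α) (i : Fin n) :
    arrayOf f (i : ℕ) = f i := by
  have h : (0 : ℤ) ≤ ((i : ℕ) : ℤ) ∧ ((i : ℕ) : ℤ) < n := ⟨by omega, by exact_mod_cast i.2⟩
  rw [arrayOf, dif_pos h]
  congr 1

theorem isMatching_eq_univ {y z : ℕ} (hy : y ≤ 1) (hz : z ≤ 1) {capS : Fin y → ℕ}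
    {capT : Fin z → ℕ} {M : Finset (Fin y × Fin z)} (hM : IsMatching capS capT M) :
    M = Finset.univ := by
  refine Finset.eq_univ_of_forall fun p => ?_
  obtain ⟨q, hq⟩ := Finset.card_pos.1 (hM.1 p.1).1
  have : q = p := Prod.ext (Fin.ext (by omega)) (Fin.ext (by omega))
  exact this ▸ (Finset.mem_filter.1 hq).1

theorem IsMatching.pos_iff {y z : ℕ} {capS : Fin y → ℕ} {capT : Fin z → ℕ}
    {M : Finset (Fin y × Fin z)} (hM : IsMatching capS capT M) : 0 < y ↔ 0 < z := by
  constructor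
  · intro h
    obtain ⟨q, -⟩ := Finset.card_pos.1 (hM.1 ⟨0, h⟩).1
    exact q.2.pos
  · intro h
    obtain ⟨q, -⟩ := Finset.card_pos.1 (hM.2 ⟨0, h⟩).1
    exact q.1.pos

/-- The case of at most one point in each set. -/
theorem run_matchingProg_small {y z : ℕ} (hy : y ≤ 1) (hz : z ≤ 1) (s : Fin y → ℝ) (t : Fin z → ℝ)
    {capS : Fin y → ℕ} {capT : Fin z → ℕ} {M : Finset (Fin y × Fin z)}
    (hM : IsMatching capS capT M) :
    ∃ n σ, Run matchingProg (input s t capS capT) n σ ∧ n ≤ 20 ∧ Outputs σ M ∧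
      IsMinCostMatching s t capS capT M := by
  refine ⟨_, _, Run.condTrue ?_ (Run.setInt _ 3 (.const 0) (.cell 2 (.const 0))), ?_, ?_, hM,
    fun M' hM' => ?_⟩
  · simp [input, arrayOf, hy, hz]
  · simp [Test.time, IntExpr.time]
  · have hcard : M.card = y := by
      rw [isMatching_eq_univ hy hz hM]
      have := hM.pos_iff
      simp only [Finset.card_univ, Fintype.card_prod, Fintype.card_fin]
      interval_cases y <;> interval_cases z <;> simp_all
    refine ⟨M.toList, M.nodup_toList, M.toList_toFinset, ?_, fun k hk => ?_⟩
    · simp [Finset.length_toList, hcard, input, arrayOf]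
    -- The only possible indices are 0, which is what the untouched output arrays contain.
    · rw [Finset.length_toList] at hk
      have h₁ : (M.toList[k]).1 = (⟨0, by omega⟩ : Fin y) := Fin.ext (by simp; omega)
      have h₂ : (M.toList[k]).2 = (⟨0, (M.toList[k]).2.pos⟩ : Fin z) := Fin.ext (by simp; omega)
      rw [h₁, h₂]
      simp [input]
  · rw [isMatching_eq_univ hy hz hM, isMatching_eq_univ hy hz hM']

/-- The total number of steps per point. -/
def matchingTime : ℕ :=
  (mergeBody.maxTime + mergeTest.time + 1) + 2000 + (backBody.maxTime + backTest.time + 1) +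
    (pairBody.maxTime + pairTest.time + 1) + 20

theorem le_matchingTime : 20 ≤ matchingTime := Nat.le_add_left _ _

/-- The 9 is the time of the initial test for the degenerate case. -/
theorem time_bound {n₁ n₂ n₃ n₄ v₁ v₂ v₃ N : ℕ} (hN : 1 ≤ N) (h₁ : n₁ ≤ v₁ * N)
    (h₂ : n₂ ≤ 2000 * N) (h₃ : n₃ ≤ v₂ * N) (h₄ : n₄ ≤ v₃ * N) :
    9 + (n₁ + (n₂ + (n₃ + n₄))) + 1 ≤ (v₁ + 2000 + v₂ + v₃ + 20) * N := by
  rw [add_mul, add_mul, add_mul, add_mul]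
  omega

theorem run_matchingProg_large {y z : ℕ} (hyz : ¬ (y ≤ 1 ∧ z ≤ 1)) {s : Fin y → ℝ} {t : Fin z → ℝ}
    (hs : StrictMono s) (ht : StrictMono t) {capS : Fin y → ℕ} {capT : Fin z → ℕ}
    {M₀ : Finset (Fin y × Fin z)} (hM₀ : IsMatching capS capT M₀) :
    ∃ n σ M, Run matchingProg (input s t capS capT) n σ ∧ n ≤ matchingTime * (y + z + 1) ∧
      Outputs σ M ∧ IsMinCostMatching s t capS capT M := by
  set σ₀ := input s t capS capT with hσ₀
  obtain ⟨n, hn⟩ : ∃ n, n = y + z := ⟨_, rfl⟩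
  have hn1 : 1 ≤ n := by omega
  set s' : ℕ → ℝ := fun i => arrayOf s i with hs'
  set t' : ℕ → ℝ := fun j => arrayOf t j with ht'
  set cS : ℕ → ℕ := fun i => if h : i < y then capS ⟨i, h⟩ else 0 with hcS
  set cT : ℕ → ℕ := fun j => if h : j < z then capT ⟨j, h⟩ else 0 with hcT
  have hs'i : ∀ i : Fin y, s' i = s i := arrayOf_natCast s
  have ht'j : ∀ j : Fin z, t' j = t j := arrayOf_natCast t
  have hs'm : ∀ i, i + 1 < y → s' i < s' (i + 1) := fun i hi => by
    rw [hs'i ⟨i, by omega⟩, hs'i ⟨i + 1, hi⟩]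
    exact hs (Fin.mk_lt_mk.2 (by omega))
  have ht'm : ∀ j, j + 1 < z → t' j < t' (j + 1) := fun j hj => by
    rw [ht'j ⟨j, by omega⟩, ht'j ⟨j + 1, hj⟩]
    exact ht (Fin.mk_lt_mk.2 (by omega))
  have h2y : σ₀.int 2 0 = y := by simp [hσ₀, input, arrayOf]
  have h2z : σ₀.int 2 1 = z := by simp [hσ₀, input, arrayOf]
  have hzero : ∀ a, 3 ≤ a → σ₀.int a = fun _ => 0 := fun a ha => by
    obtain ⟨a, rfl⟩ := Nat.exists_eq_add_of_le' ha
    rfl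
  have hcS₀ : ∀ i < y, σ₀.int 0 i = cS i := fun i hi => by
    rw [hcS]
    simp only [hi, dite_true]
    exact arrayOf_natCast (fun i => (capS i : ℤ)) ⟨i, hi⟩
  have hcT₀ : ∀ j < z, σ₀.int 1 j = cT j := fun j hj => by
    rw [hcT]
    simp only [hj, dite_true]
    exact arrayOf_natCast (fun j => (capT j : ℤ)) ⟨j, hj⟩
  obtain ⟨n₁, σ₁, r₁, hI₁, ht₁⟩ := run_merge (s := s') (t := t') (cS := cS) (cT := cT) h2y h2z
    (fun i _ => rfl) (fun j _ => rfl) hcS₀ hcT₀ (by rw [hzero 6 (by norm_num)])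
    (by rw [hzero 7 (by norm_num)])
  have hm := isMerge_mergePos (fun i hi => (hs'm i hi).le) (fun j hj => (ht'm j hj).le)
  set E := mergeKind y z s' t' with hE
  set a : ℕ → ℕ := fun k => (mergePos y z s' t' k).1 with ha
  set b : ℕ → ℕ := fun k => (mergePos y z s' t' k).2 with hb
  set X : ℕ → ℝ := fun k => mergeVal y z s' t' s' t' (min k (y + z - 1)) with hX
  set c : ℕ → ℕ := mergeVal y z s' t' cS cT with hc
  have hcS' : ∀ k (hk : k < y + z) (hEk : E k = true), c k = capS ⟨a k, hm.a_lt hk hEk⟩ := by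
    intro k hk hEk
    have h₁ : c k = cS (a k) := if_pos hEk
    rw [h₁]
    exact dif_pos (hm.a_lt hk hEk)
  have hcT' : ∀ k (hk : k < y + z) (hEk : E k = false), c k = capT ⟨b k, hm.b_lt hk hEk⟩ := by
    intro k hk hEk
    have h₁ : c k = cT (b k) := if_neg (by rw [← hE, hEk]; simp)
    rw [h₁]
    exact dif_pos (hm.b_lt hk hEk)
  have hc1 : ∀ k < n, 1 ≤ c k := by
    intro k hk
    rw [hn] at hk
    cases hEk : E k
    · rw [hcT' k hk hEk]
      exact (hM₀.2 _).1.trans (hM₀.2 _).2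
    · rw [hcS' k hk hEk]
      exact (hM₀.1 _).1.trans (hM₀.1 _).2
  have hint₁ : ∀ e, e ≠ 6 → e ≠ 7 → e ≠ 30 → e ≠ 31 → σ₁.int e = σ₀.int e := hI₁.frame_int
  have h2 := hint₁ 2 (by norm_num) (by norm_num) (by norm_num) (by norm_num)
  have hkind₁ : ∀ k < n, σ₁.int 30 k = if E k then 1 else 0 := fun k hk => hI₁.kind k (hn ▸ hk)
  have hcap₁ : ∀ k < n, σ₁.int 31 k = c k := fun k hk => hI₁.cap k (hn ▸ hk)
  obtain ⟨m, n₂, σ₂, r₂, ht₂, hvalley, hm₂, h8₂, hint₂⟩ := run_dpProg hn1 (X := X) (E := E) (c := c)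
    (σ₀ := σ₁) hm.mono (by rw [h2, h2y, h2z, hn]; push_cast; rfl) hc1
    (fun k hk => by
      rw [hI₁.coord k (hn ▸ hk), hX]
      simp only
      rw [min_eq_left (by omega)]) hkind₁ hcap₁
    (fun e h₁ h₂ => by
      rw [hint₁ e (by omega) (by omega) (by omega) (by omega), hzero e (by omega)])
  set h : ℕ → ℤ := fun k => backPath n E c m (n - k) with hh
  have hhn : h n = 0 := by simp [hh, backPath]
  have hhk : ∀ k < n, h k = clampStep (E k) (c k) (m k) (h (k + 1)) := fun k hk => backPath_eq E c m hk
  have ha_end : a n = y := by rw [hn]; exact hm.a_end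
  have hb_end : b n = z := by rw [hn]; exact hm.b_end
  have hzero₂ : ∀ e, 3 ≤ e → e < 10 ∨ 32 < e → e ≠ 6 → e ≠ 7 → e ≠ 8 → e ≠ 35 → e ≠ 36 →
      σ₂.int e = fun _ => 0 := fun e h₁ h₂ h₃ h₄ h₅ h₆ h₇ => by
    rw [hint₂ e (by omega) h₅ (by omega) h₆ h₇, hint₁ e h₃ h₄ (by omega) (by omega), hzero e h₁]
  obtain ⟨n₃, σ₃, r₃, hI₃, ht₃⟩ := run_back (n := n) (E := E) (c := c) (m := m) (a := a) (b := b)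
    (h := h) (σ₀ := σ₂)
    (fun k hk => by rw [hint₂ 30 (by norm_num) (by norm_num) (by norm_num) (by norm_num) (by norm_num),
      hkind₁ k hk])
    (fun k hk => by rw [hint₂ 31 (by norm_num) (by norm_num) (by norm_num) (by norm_num) (by norm_num),
      hcap₁ k hk])
    hm₂ hm.a_succ hm.b_succ hhk hhn
    (by
      rw [hint₂ 6 (by norm_num) (by norm_num) (by norm_num) (by norm_num) (by norm_num), hI₁.i_eq,
        ← hn])
    (by
      rw [hint₂ 7 (by norm_num) (by norm_num) (by norm_num) (by norm_num) (by norm_num), hI₁.j_eq,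
        ← hn])
    h8₂ (by rw [hzero₂ 9] <;> norm_num) (by rw [hzero₂ 33] <;> norm_num)
    (by rw [hzero₂ 34] <;> norm_num)
  have hpath : IsPath n E (fun k => c k) h := fun k hk => by
    rw [hhk k hk]
    exact isStep_clampStep _ (Int.ofNat_le.2 (hc1 k hk)) _ _
  have hpen : ∀ g, IsPath n E (fun k => c k) g → g n = 0 →
      2 * (X (n - 1) - X 0) * |(h 0 : ℝ)| + pathCost n X h ≤
        2 * (X (n - 1) - X 0) * |(g 0 : ℝ)| + pathCost n X g := fun g hg hgn =>
    penalized_pathCost_le hvalley hhk hg (hhn.trans hgn.symm)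
  -- One of the sets has two points, distinct by strict monotonicity; this makes twice the span
  -- strictly larger than the span.
  have hspan : X 0 < X (n - 1) := by
    have hXle : ∀ k, X k ≤ X (n - 1) := fun k => by
      simp only [hX]
      rw [hn, min_self]
      exact hm.mono (min_le_right k (y + z - 1)) |>.trans_eq' (by simp [hX]) |>.trans_eq (by simp [hX])
    by_cases hy : 1 < y
    · obtain ⟨p, hp, hEp, hap, -⟩ := exists_index (n := y + z) hm.a_zero hm.a_succ
        (show 0 < a (y + z) by rw [hm.a_end]; omega)
      obtain ⟨q, hq, hEq, haq, -⟩ := exists_index (n := y + z) hm.a_zero hm.a_succ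
        (show 1 < a (y + z) by rw [hm.a_end]; omega)
      have h₁ := hm.coord p hp
      have h₂ := hm.coord q hq
      rw [if_pos hEp, hap] at h₁
      rw [if_pos hEq, haq] at h₂
      have h₃ := hs'm 0 hy
      have h₄ := hm.mono p.zero_le
      have h₅ := hXle q
      linarith
    · have hz : 1 < z := by omega
      obtain ⟨p, hp, hEp, hbp, -⟩ := exists_index (n := y + z) (a := b) (E := fun k => !E k) hm.b_zero
        (fun k => by rw [hm.b_succ]; cases E k <;> simp)
        (show 0 < b (y + z) by rw [hm.b_end]; omega)
      obtain ⟨q, hq, hEq, hbq, -⟩ := exists_index (n := y + z) (a := b) (E := fun k => !E k) hm.b_zero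
        (fun k => by rw [hm.b_succ]; cases E k <;> simp)
        (show 1 < b (y + z) by rw [hm.b_end]; omega)
      have h₁ := hm.coord p hp
      have h₂ := hm.coord q hq
      rw [if_neg (by simpa using hEp), hbp] at h₁
      rw [if_neg (by simpa using hEq), hbq] at h₂
      have h₃ := ht'm 0 hz
      have h₄ := hm.mono p.zero_le
      have h₅ := hXle q
      linarith
  have hXn : X n = X (n - 1) := by
    simp only [hX]
    congr 1
    omega
  -- The assumed matching supplies the feasible path from 0 to 0 with which `start_eq_zero` corrects
  -- the start.
  have hpath₀ := hM₀.isPath hm hcS' hcT'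
  rw [← hn] at hpath₀
  have hh0 : h 0 = 0 := start_eq_zero hm.mono (by rw [hXn]; linarith) hpath hpath₀ hhn
    (by rw [hn]; exact height_end hm _) (height_zero hm _) hpen
  obtain ⟨hP, hR, hPR, hmin⟩ := isMinCostMatching_overlapPairs hm hcS' hcT' (h := h)
    (hn ▸ hpath) hh0 (fun g hg hg0 hgn => by
      have := hpen g (hn ▸ hg) (hn ▸ hgn)
      rw [hh0, hg0, hn] at this
      simpa using this)
    (P := fun i => σ₃.int 33 i) (R := fun j => σ₃.int 34 j)
    (fun k hk => hI₃.sums k (by omega) (hn ▸ hk)) (by simpa [ha_end] using hI₃.end_left)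
    (by simpa [hb_end] using hI₃.end_right)
  have hint₃ := hI₃.frame_int
  obtain ⟨n₄, σ₄, r₄, hout, ht₄⟩ := run_pairs hM₀.pos_iff hP hR (by simpa [ha_end] using hI₃.end_left)
    (by simpa [hb_end] using hI₃.end_right) hPR
    (by rw [hint₃ 2 (by norm_num) (by norm_num) (by norm_num) (by norm_num) (by norm_num) (by norm_num)
          (by norm_num),
        hint₂ 2 (by norm_num) (by norm_num) (by norm_num) (by norm_num) (by norm_num), h2, h2y])
    (fun _ => rfl) (fun _ => rfl)
    (by rw [hint₃ 3 (by norm_num) (by norm_num) (by norm_num) (by norm_num) (by norm_num) (by norm_num)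
          (by norm_num), hzero₂ 3] <;> norm_num)
    (by rw [hI₃.i_eq]; simp [ha, mergePos]) (by rw [hI₃.j_eq]; simp [hb, mergePos])
  have htest : ¬ (Test.and (.intLE (.cell 2 (.const 0)) (.const 1))
      (.intLE (.cell 2 (.const 1)) (.const 1))).Holds σ₀ := by
    simp only [Test.Holds, IntExpr.eval, h2y, h2z]
    omega
  have r := Run.condFalse (P := .assign 3 (.cell 2 (.const 0))) htest
    (r₁.seq (r₂.seq (r₃.seq r₄)))
  rw [hn] at ht₂ ht₃
  exact ⟨_, σ₄, _, r, time_bound (by omega) ht₁ ht₂ ht₃ ht₄, hout, by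
    rw [show s = fun i : Fin y => s' i from (funext hs'i).symm,
      show t = fun j : Fin z => t' j from (funext ht'j).symm]
    exact hmin⟩

end LCMM

theorem mainTheorem2 :
    ∃ (P : LCMM.Program) (c : ℕ),
      ∀ (y z : ℕ) (s : Fin y → ℝ) (t : Fin z → ℝ) (capS : Fin y → ℕ) (capT : Fin z → ℕ),
        StrictMono s → StrictMono t →
        (∃ M : Finset (Fin y × Fin z), LCMM.IsMatching capS capT M) →
        ∃ (n : ℕ) (σ : LCMM.State) (M : Finset (Fin y × Fin z)),
          LCMM.Run P (LCMM.input s t capS capT) n σ ∧ n ≤ c * (y + z + 1) ∧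
          LCMM.Outputs σ M ∧ LCMM.IsMinCostMatching s t capS capT M := by
  refine ⟨LCMM.matchingProg, LCMM.matchingTime, fun y z s t capS capT hs ht ⟨M, hM⟩ => ?_⟩
  by_cases hyz : y ≤ 1 ∧ z ≤ 1
  · obtain ⟨n, σ, hr, hn, ho, hm⟩ := LCMM.run_matchingProg_small hyz.1 hyz.2 s t hM
    refine ⟨n, σ, M, hr, hn.trans ?_, ho, hm⟩
    exact LCMM.le_matchingTime.trans (Nat.le_mul_of_pos_right _ (by omega))
  · exact LCMM.run_matchingProg_large hyz hs ht hM
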